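/- All manifolds are smooth, connected, oriented, Hausdorff, second countable and without boundary, and the "mostly minus" convention is used. Let $(\widetilde M,\tilde g)$ be a $5$-dimensional Lorentzian manifold of signature $(+,-,-,-,-)$. Let $(M,g)$ be a $6$-dimensional Riemannian manifold, with $g$ taken negative definite, and suppose that it is Kähler with integrable complex structure $J$ and Kähler form $\delta=g(J\cdot,\cdot)$; orient $M$ by $\delta\wedge\delta\wedge\delta$. Let $\tilde\gamma$ be a smooth closed $2$-form on $\widetilde M$. Equip $\mathsf X=\widetilde M\times M$ with the product metric $h=\tilde g+g$ and the volume form $\mathrm{vol}_{\widetilde M}\wedge\mathrm{vol}_M$. For a metric with volume form $\mathrm{vol}$, let $\langle\omega,\phi\rangle=\frac1{k!}\sum\omega_{i_1\dots i_k}\phi_{j_1\dots j_k}g^{i_1j_1}\cdots g^{i_kj_k}$ for $k$-forms, $\|\omega\|^2=\langle\omega,\omega\rangle$, and let the Hodge star be given by $\alpha\wedge\star\beta=\langle\alpha,\beta\rangle\,\mathrm{vol}$. For a $4$-form $F$ on $\mathsf X$, the triple $(\mathsf X,h,F)$ is called a bosonic supergravity background if $$dF=0,\qquad d\star F=\tfrac12F\wedge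 F,\qquad \mathrm{Ric}_h(X,Y)=-\tfrac12\langle X\lrcorner F,Y\lrcorner F\rangle_h+\tfrac16h(X,Y)\|F\|_h^2$$ for all vector fields $X,Y$ on $\mathsf X$. Then $(\mathsf X,h,F=\tilde\gamma\wedge\delta)$ is a bosonic supergravity background if and only if $(M,g)$ is Ricci-flat, $d\star_5\tilde\gamma=\tilde\gamma\wedge\tilde\gamma$ on $\widetilde M$, and $$\mathrm{Ric}_{\tilde g}(\tilde X,\tilde Y)=\tfrac12\|\tilde\gamma\|_{\tilde g}^2\,\tilde g(\tilde X,\tilde Y)-\tfrac32\langle\tilde X\lrcorner\tilde\gamma,\tilde Y\lrcorner\tilde\gamma\rangle_{\tilde g}$$ for all vector fields $\tilde X,\tilde Y$ on $\widetilde M$. -/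

import Mathlib

open scoped Manifold ContDiff

set_option maxSynthPendingDepth 3

namespace Sugra

/-! ### Multilinear algebra on one tangent space -/

section Pointwise

variable {V : Type*} [AddCommGroup V] [Module ℝ V] [TopologicalSpace V]

/-- The (non-antisymmetrised) product of two alternating forms,
`v ↦ α (v₀, …, v_{k-1}) * β (v_k, …, v_{k+l-1})`. -/
noncomputable def tensorMul {k l : ℕ} (α : V [⋀^Fin k]→L[ℝ] ℝ) (β : V [⋀^Fin l]→L[ℝ] ℝ) :
    ContinuousMultilinearMap ℝ (fun _ : Fin (k + l) => V) ℝ where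
  toMultilinearMap :=
    ((LinearMap.mul' ℝ ℝ).compMultilinearMap
      (α.toMultilinearMap.domCoprod β.toMultilinearMap)).domDomCongr finSumFinEquiv
  cont := by
    change Continuous fun v : Fin (k + l) → V =>
      α (fun i => v (finSumFinEquiv (Sum.inl i))) * β (fun i => v (finSumFinEquiv (Sum.inr i)))
    exact (α.cont.comp (by fun_prop)).mul (β.cont.comp (by fun_prop))

theorem tensorMul_apply {k l : ℕ} (α : V [⋀^Fin k]→L[ℝ] ℝ) (β : V [⋀^Fin l]→L[ℝ] ℝ)
    (v : Fin (k + l) → V) :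
    tensorMul α β v = α (fun i => v (Fin.castAdd l i)) * β (fun i => v (Fin.natAdd k i)) :=
  rfl

/-- The wedge product, normalised so that `(e¹ ∧ e²)(e₁, e₂) = 1`:
`(α ∧ β)(v) = (1 / (k! l!)) ∑_σ sign σ · α (v_{σ 0}, …) β (v_{σ k}, …)`. -/
noncomputable def wedge {k l : ℕ} (α : V [⋀^Fin k]→L[ℝ] ℝ) (β : V [⋀^Fin l]→L[ℝ] ℝ) :
    V [⋀^Fin (k + l)]→L[ℝ] ℝ :=
  ((k.factorial : ℝ) * (l.factorial : ℝ))⁻¹ •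
    ContinuousMultilinearMap.alternatization (tensorMul α β)

/-- The contraction `v ↦ η (w₀, …, w_{k-1}, v₀, …, v_{m-1})` of the first `k` slots of `η`. -/
noncomputable def contractFirst {k m : ℕ} (w : Fin k → V) (η : V [⋀^Fin (k + m)]→L[ℝ] ℝ) :
    V [⋀^Fin m]→L[ℝ] ℝ where
  toFun v := η (Fin.append w v)
  map_update_add' v i x y := by
    have key : ∀ z : V, Fin.append w (Function.update v i z)
        = Function.update (Fin.append w v) (Fin.natAdd k i) z := by
      intro z
      ext j
      refine Fin.addCases (fun a => ?_) (fun a => ?_) j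
      · simp [Function.update_of_ne, Fin.ext_iff, Nat.ne_of_lt (Nat.lt_add_right i.1 a.2)]
      · by_cases h : a = i
        · subst h; simp
        · simp [h]
    simp only [key]
    exact η.map_update_add _ _ _ _
  map_update_smul' v i c x := by
    have key : ∀ z : V, Fin.append w (Function.update v i z)
        = Function.update (Fin.append w v) (Fin.natAdd k i) z := by
      intro z
      ext j
      refine Fin.addCases (fun a => ?_) (fun a => ?_) j
      · simp [Function.update_of_ne, Fin.ext_iff, Nat.ne_of_lt (Nat.lt_add_right i.1 a.2)]
      · by_cases h : a = i
        · subst h; simp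
        · simp [h]
    simp only [key]
    exact η.map_update_smul _ _ _ _
  map_eq_zero_of_eq' v i j hv hij := by
    refine η.map_eq_zero_of_eq _ (i := Fin.natAdd k i) (j := Fin.natAdd k j) ?_ ?_
    · simpa using hv
    · simpa using hij
  cont := by
    refine η.cont.comp (continuous_pi fun j => ?_)
    refine Fin.addCases (fun a => ?_) (fun a => ?_) j
    · simpa using continuous_const
    · simpa using continuous_apply a

/-- The interior product `u ⌟ η = η (u, ·, …, ·)`. -/
noncomputable def interiorProd {k : ℕ} (u : V) (η : V [⋀^Fin (k + 1)]→L[ℝ] ℝ) :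
    V [⋀^Fin k]→L[ℝ] ℝ where
  toMultilinearMap := (η.toAlternatingMap.curryLeft u).toMultilinearMap
  map_eq_zero_of_eq' := (η.toAlternatingMap.curryLeft u).map_eq_zero_of_eq'
  cont := by
    change Continuous fun v : Fin k → V => η (Matrix.vecCons u v)
    exact η.cont.comp (by fun_prop)

theorem interiorProd_apply {k : ℕ} (u : V) (η : V [⋀^Fin (k + 1)]→L[ℝ] ℝ) (v : Fin k → V) :
    interiorProd u η v = η (Matrix.vecCons u v) :=
  rfl

variable [FiniteDimensional ℝ V]

/-- The inverse matrix `g^{ij}` of the Gram matrix of `g` in the basis `Module.finBasis ℝ V`. -/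
noncomputable def gramInv (g : V →L[ℝ] V →L[ℝ] ℝ) :
    Matrix (Fin (Module.finrank ℝ V)) (Fin (Module.finrank ℝ V)) ℝ :=
  (Matrix.of fun i j => g (Module.finBasis ℝ V i) (Module.finBasis ℝ V j))⁻¹

/-- The bilinear form on `k`-forms induced by a nondegenerate symmetric bilinear form `g`:
`⟨η, φ⟩ = (1 / k!) ∑ η_{i₁…i_k} φ_{j₁…j_k} g^{i₁j₁} ⋯ g^{i_kj_k}`
(the value does not depend on the basis in which the components are taken). -/
noncomputable def formInner (g : V →L[ℝ] V →L[ℝ] ℝ) {k : ℕ} (η φ : V [⋀^Fin k]→L[ℝ] ℝ) : ℝ :=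
  (k.factorial : ℝ)⁻¹ *
    ∑ i : Fin k → Fin (Module.finrank ℝ V), ∑ j : Fin k → Fin (Module.finrank ℝ V),
      η (fun a => Module.finBasis ℝ V (i a)) * φ (fun a => Module.finBasis ℝ V (j a)) *
        ∏ a, gramInv g (i a) (j a)

/-- The Hodge star of a `k`-form `β` with respect to `g` and a volume form `vol` of degree `k + m`,
`(⋆β)_{l₁…l_m} = (1 / k!) ∑ β_{i₁…i_k} g^{i₁j₁} ⋯ g^{i_kj_k} vol_{j₁…j_kl₁…l_m}`,
i.e. the `m`-form with `α ∧ ⋆β = ⟨α, β⟩ vol` for all `k`-forms `α` (when `dim V = k + m`). -/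
noncomputable def hodge (g : V →L[ℝ] V →L[ℝ] ℝ) {k m : ℕ} (vol : V [⋀^Fin (k + m)]→L[ℝ] ℝ)
    (β : V [⋀^Fin k]→L[ℝ] ℝ) : V [⋀^Fin m]→L[ℝ] ℝ :=
  (k.factorial : ℝ)⁻¹ •
    ∑ i : Fin k → Fin (Module.finrank ℝ V), ∑ j : Fin k → Fin (Module.finrank ℝ V),
      (β (fun a => Module.finBasis ℝ V (i a)) * ∏ a, gramInv g (i a) (j a)) •
        contractFirst (fun a => Module.finBasis ℝ V (j a)) vol

end Pointwise

/-! ### The Ricci tensor of a metric on (an open subset of) a vector space -/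

section Flat

variable {E : Type*} [NormedAddCommGroup E] [NormedSpace ℝ E]

/-- The Christoffel symbols of the first kind,
`(u, v) ↦ (w ↦ ½ (∂_u G(v, w) + ∂_v G(u, w) - ∂_w G(u, v)))`, at the point `y`. -/
noncomputable def christoffelFirst (G : E → E →L[ℝ] E →L[ℝ] ℝ) (y : E) :
    E →L[ℝ] E →L[ℝ] E →L[ℝ] ℝ :=
  (1 / 2 : ℝ) • (fderiv ℝ G y + (fderiv ℝ G y).flip -
    (ContinuousLinearMap.flipₗᵢ ℝ E E ℝ).toContinuousLinearEquiv.toContinuousLinearMap.comp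
      (fderiv ℝ G y).flip)

theorem christoffelFirst_apply (G : E → E →L[ℝ] E →L[ℝ] ℝ) (y u v w : E) :
    christoffelFirst G y u v w =
      1 / 2 * (fderiv ℝ G y u v w + fderiv ℝ G y v u w - fderiv ℝ G y w u v) :=
  rfl

/-- The Christoffel symbols `Γ_y(u, v)` of the Levi-Civita connection of `G`, characterised by
`G_y (Γ_y(u, v), w) = christoffelFirst G y u v w`. -/
noncomputable def christoffel (G : E → E →L[ℝ] E →L[ℝ] ℝ) (y : E) : E →L[ℝ] E →L[ℝ] E :=
  (ContinuousLinearMap.compL ℝ E (E →L[ℝ] ℝ) E (G y).inverse).comp (christoffelFirst G y)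

theorem christoffel_apply (G : E → E →L[ℝ] E →L[ℝ] ℝ) (y u v : E) :
    christoffel G y u v = (G y).inverse (christoffelFirst G y u v) :=
  rfl

/-- For fixed `v`, `w`, the endomorphism `u ↦ R(u, v)w`, where
`R(u, v)w = (∂_u Γ)(v, w) - (∂_v Γ)(u, w) + Γ(u, Γ(v, w)) - Γ(v, Γ(u, w))`. -/
noncomputable def curvatureEnd (G : E → E →L[ℝ] E →L[ℝ] ℝ) (y v w : E) : E →L[ℝ] E :=
  ((fderiv ℝ (christoffel G) y).flip v).flip w - (fderiv ℝ (christoffel G) y v).flip w +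
    (christoffel G y).flip (christoffel G y v w) -
    (christoffel G y v).comp ((christoffel G y).flip w)

theorem curvatureEnd_apply (G : E → E →L[ℝ] E →L[ℝ] ℝ) (y u v w : E) :
    curvatureEnd G y v w u =
      fderiv ℝ (christoffel G) y u v w - fderiv ℝ (christoffel G) y v u w +
        christoffel G y u (christoffel G y v w) - christoffel G y v (christoffel G y u w) :=
  rfl

/-- The Ricci tensor `Ric(v, w) = tr (u ↦ R(u, v)w)` at the point `y`. -/
noncomputable def flatRicci (G : E → E →L[ℝ] E →L[ℝ] ℝ) (y v w : E) : ℝ :=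
  LinearMap.trace ℝ E (curvatureEnd G y v w : E →ₗ[ℝ] E)

end Flat

/-! ### Forms and metrics on a manifold (without boundary) -/

section Manifold

variable {E : Type*} [NormedAddCommGroup E] [NormedSpace ℝ E] {H : Type*} [TopologicalSpace H]
  (I : ModelWithCorners ℝ E H) (M : Type*) [TopologicalSpace M] [ChartedSpace H M]
  {E' : Type*} [NormedAddCommGroup E'] [NormedSpace ℝ E'] {H' : Type*} [TopologicalSpace H']
  (I' : ModelWithCorners ℝ E' H') {M' : Type*} [TopologicalSpace M'] [ChartedSpace H' M']

/-- Tangent spaces of a finite-dimensional manifold are finite-dimensional. -/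
instance tangentSpace_finiteDimensional [FiniteDimensional ℝ E] (x : M) :
    FiniteDimensional ℝ (TangentSpace I x) :=
  inferInstanceAs (FiniteDimensional ℝ E)

/-- A (not necessarily smooth) field of alternating `k`-forms on `M`. -/
abbrev FormField (k : ℕ) := ∀ x : M, TangentSpace I x [⋀^Fin k]→L[ℝ] ℝ

/-- A (not necessarily smooth) field of bilinear forms on the tangent spaces of `M`. -/
abbrev BilinField := ∀ x : M, TangentSpace I x →L[ℝ] TangentSpace I x →L[ℝ] ℝ

variable {I M}

/-- Pointwise wedge product of forms. -/
noncomputable def FormField.wedge {k l : ℕ} (α : FormField I M k) (β : FormField I M l) :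
    FormField I M (k + l) :=
  fun x => Sugra.wedge (α x) (β x)

/-- Pullback of a `k`-form under a map. -/
noncomputable def FormField.pullback {k : ℕ} (f : M' → M) (η : FormField I M k) :
    FormField I' M' k :=
  fun x => (η (f x)).compContinuousLinearMap (mfderiv I' I f x)

/-- Pullback of a field of bilinear forms under a map. -/
noncomputable def BilinField.pullback (f : M' → M) (g : BilinField I M) : BilinField I' M' :=
  fun x => (ContinuousLinearMap.precomp ℝ (mfderiv I' I f x)).comp
    ((g (f x)).comp (mfderiv I' I f x))

theorem BilinField.pullback_apply (f : M' → M) (g : BilinField I M) (x : M')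
    (u v : TangentSpace I' x) :
    BilinField.pullback I' f g x u v = g (f x) (mfderiv I' I f x u) (mfderiv I' I f x v) :=
  rfl

/-- The expression of a `k`-form in the chart at `x₀`: its pullback to the model vector space
under the inverse of the chart. -/
noncomputable def FormField.inChart {k : ℕ} (η : FormField I M k) (x₀ : M) :
    E → E [⋀^Fin k]→L[ℝ] ℝ :=
  FormField.pullback 𝓘(ℝ, E) (extChartAt I x₀).symm η

/-- The expression of a field of bilinear forms in the chart at `x₀`. -/
noncomputable def BilinField.inChart (g : BilinField I M) (x₀ : M) : E → E →L[ℝ] E →L[ℝ] ℝ :=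
  BilinField.pullback 𝓘(ℝ, E) (extChartAt I x₀).symm g

/-- A form is smooth if it is smooth in charts. -/
def FormField.IsSmooth {k : ℕ} (η : FormField I M k) : Prop :=
  ∀ x₀ : M, ContDiffOn ℝ ∞ (η.inChart x₀) (extChartAt I x₀).target

/-- A field of bilinear forms is smooth if it is smooth in charts. -/
def BilinField.IsSmooth (g : BilinField I M) : Prop :=
  ∀ x₀ : M, ContDiffOn ℝ ∞ (g.inChart x₀) (extChartAt I x₀).target

/-- The exterior derivative, computed in the chart at the point. -/
noncomputable def FormField.d {k : ℕ} (η : FormField I M k) : FormField I M (k + 1) :=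
  fun x => (extDeriv (η.inChart x) (extChartAt I x x)).compContinuousLinearMap
    (mfderiv I 𝓘(ℝ, E) (extChartAt I x) x)

/-- The Ricci tensor of a metric, computed in the chart at the point. -/
noncomputable def ricci (g : BilinField I M) (x : M) (u v : TangentSpace I x) : ℝ :=
  flatRicci (g.inChart x) (extChartAt I x x)
    (mfderiv I 𝓘(ℝ, E) (extChartAt I x) x u) (mfderiv I 𝓘(ℝ, E) (extChartAt I x) x v)

/-- The Hodge star operator of a metric `g` with volume form `vol`. -/
noncomputable def FormField.star [FiniteDimensional ℝ E] (g : BilinField I M) {k m : ℕ}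
    (vol : FormField I M (k + m)) (β : FormField I M k) : FormField I M m :=
  fun x => hodge (g x) (vol x) (β x)

/-- `g` is a smooth Lorentzian metric of signature `(+, -, …, -)` on an `(n + 1)`-dimensional
manifold. -/
structure IsLorentzianMetric (n : ℕ) (g : BilinField I M) : Prop where
  smooth : g.IsSmooth
  signature : ∀ x : M, ∃ b : Module.Basis (Fin (n + 1)) ℝ (TangentSpace I x),
    ∀ i j, g x (b i) (b j) = if i = j then (if i = 0 then 1 else -1) else 0

/-- `g` is a smooth Riemannian metric in the "mostly minus" convention, i.e. a smooth negative
definite metric. -/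
structure IsNegRiemannianMetric (g : BilinField I M) : Prop where
  smooth : g.IsSmooth
  symm : ∀ (x : M) (u v : TangentSpace I x), g x u v = g x v u
  neg : ∀ (x : M) (u : TangentSpace I x), u ≠ 0 → g x u u < 0

/-- `vol` is the volume form of the metric `g` for some orientation of the `n`-dimensional
manifold `M`: a smooth `n`-form with `vol(v₁, …, v_n)² = |det g(v_i, v_j)|`; thus it takes the
values `±1` on `g`-orthonormal frames, and the frames on which it is positive are the oriented
ones. -/
structure IsVolumeForm {n : ℕ} (g : BilinField I M) (vol : FormField I M n) : Prop where
  smooth : vol.IsSmooth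
  normalized : ∀ (x : M) (v : Fin n → TangentSpace I x),
    vol x v ^ 2 = |(Matrix.of fun i j => g x (v i) (v j)).det|

/-- `(g, J)` is a Kähler structure with Kähler form `δ = g(J·, ·)`: `J` is an integrable smooth
almost complex structure (its Nijenhuis tensor vanishes) which is orthogonal for the (definite)
metric `g`, and `δ` is closed. -/
structure IsKahler [IsManifold I ∞ M] (g : BilinField I M)
    (J : ∀ x : M, TangentSpace I x →L[ℝ] TangentSpace I x) (δ : FormField I M 2) : Prop where
  smooth_J : ∀ X : ∀ x : M, TangentSpace I x,
    ContMDiff I I.tangent ∞ (fun x => (⟨x, X x⟩ : TangentBundle I M)) →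
    ContMDiff I I.tangent ∞ (fun x => (⟨x, J x (X x)⟩ : TangentBundle I M))
  J_sq : ∀ (x : M) (u : TangentSpace I x), J x (J x u) = -u
  nijenhuis : ∀ X Y : ∀ x : M, TangentSpace I x,
    ContMDiff I I.tangent ∞ (fun x => (⟨x, X x⟩ : TangentBundle I M)) →
    ContMDiff I I.tangent ∞ (fun x => (⟨x, Y x⟩ : TangentBundle I M)) →
    ∀ x : M,
      VectorField.mlieBracket I (fun y => J y (X y)) (fun y => J y (Y y)) x
        - J x (VectorField.mlieBracket I (fun y => J y (X y)) Y x)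
        - J x (VectorField.mlieBracket I X (fun y => J y (Y y)) x)
        - VectorField.mlieBracket I X Y x = 0
  orthogonal : ∀ (x : M) (u v : TangentSpace I x), g x (J x u) (J x v) = g x u v
  smooth_form : δ.IsSmooth
  form_eq : ∀ (x : M) (u v : TangentSpace I x), δ x ![u, v] = g x (J x u) v
  closed : ∀ x : M, δ.d x = 0

/-- The bosonic equations of eleven-dimensional supergravity (in the "mostly minus" convention)
for a metric `h` with volume form `vol` and a flux form `F`: the closedness condition `dF = 0`,
the Maxwell equation `d⋆F = ½ F ∧ F` and the Einstein equation
`Ric(X, Y) = -½ ⟨X ⌟ F, Y ⌟ F⟩ + ⅙ h(X, Y) ‖F‖²`. -/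
structure IsBosonicBackground [FiniteDimensional ℝ E] (h : BilinField I M)
    (vol : FormField I M 11) (F : FormField I M 4) : Prop where
  closedness : ∀ x : M, F.d x = 0
  maxwell : ∀ x : M,
    (FormField.star h (k := 4) (m := 7) vol F).d x = (1 / 2 : ℝ) • (F.wedge F) x
  einstein : ∀ (x : M) (u v : TangentSpace I x),
    ricci h x u v =
      -(1 / 2) * formInner (h x) (interiorProd (k := 3) u (F x)) (interiorProd (k := 3) v (F x))
        + 1 / 6 * h x u v * formInner (h x) (F x) (F x)

variable {I'}

/-- The wedge product `pr₁^*α ∧ pr₂^*β` on `M × M'` of a form on `M` and a form on `M'`. -/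
noncomputable def prodWedge {k l : ℕ} (α : FormField I M k) (β : FormField I' M' l) :
    FormField (I.prod I') (M × M') (k + l) :=
  (FormField.pullback (I.prod I') Prod.fst α).wedge (FormField.pullback (I.prod I') Prod.snd β)

/-- The product metric `pr₁^*g + pr₂^*g'` on `M × M'`. -/
noncomputable def prodMetric (g : BilinField I M) (g' : BilinField I' M') :
    BilinField (I.prod I') (M × M') :=
  fun p => BilinField.pullback (I.prod I') Prod.fst g p
    + BilinField.pullback (I.prod I') Prod.snd g' p

end Manifold

end Sugra

open Sugra

namespace Sugra

/-- The signed sum of a function of `n` vectors over all permutations of its arguments. -/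
noncomputable def altSum {V : Type*} {n : ℕ} (m : (Fin n → V) → ℝ) (v : Fin n → V) : ℝ :=
  ∑ σ : Equiv.Perm (Fin n), ((Equiv.Perm.sign σ : ℤ) : ℝ) * m (v ∘ σ)

section AltSum

variable {V : Type*} {k l n : ℕ}

theorem sign_mul_self_cast (σ : Equiv.Perm (Fin n)) :
    ((Equiv.Perm.sign σ : ℤ) : ℝ) * ((Equiv.Perm.sign σ : ℤ) : ℝ) = 1 := by
  rcases Int.units_eq_one_or (Equiv.Perm.sign σ) with h | h <;> simp [h]

theorem altSum_const_mul (c : ℝ) (m : (Fin n → V) → ℝ) (v : Fin n → V) :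
    altSum (fun w => c * m w) v = c * altSum m v := by
  simp only [altSum, Finset.mul_sum]
  exact Finset.sum_congr rfl fun σ _ => by ring

theorem altSum_add (m m' : (Fin n → V) → ℝ) (v : Fin n → V) :
    altSum (fun w => m w + m' w) v = altSum m v + altSum m' v := by
  simp only [altSum, mul_add, Finset.sum_add_distrib]

theorem altSum_comp_perm (m : (Fin n → V) → ℝ) (ρ : Equiv.Perm (Fin n)) (v : Fin n → V) :
    altSum (fun w => m (w ∘ ρ)) v = (Equiv.Perm.sign ρ : ℤ) * altSum m v := by
  simp only [altSum, Finset.mul_sum]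
  refine Fintype.sum_equiv (Equiv.mulRight ρ) _ _ fun σ => ?_
  have h := sign_mul_self_cast ρ
  simp only [Equiv.coe_mulRight, Equiv.Perm.sign_mul, Units.val_mul, Int.cast_mul,
    Equiv.Perm.coe_mul, Function.comp_assoc]
  linear_combination (-((Equiv.Perm.sign σ : ℤ) : ℝ) * m (v ∘ σ ∘ ρ)) * h

theorem altSum_of_alternating (m : (Fin n → V) → ℝ)
    (hm : ∀ (v : Fin n → V) (σ : Equiv.Perm (Fin n)), m (v ∘ σ) = (Equiv.Perm.sign σ : ℤ) * m v)
    (v : Fin n → V) : altSum m v = n.factorial * m v := by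
  simp only [altSum, hm, ← mul_assoc, sign_mul_self_cast, one_mul, Finset.sum_const,
    Finset.card_univ, Fintype.card_perm, Fintype.card_fin, nsmul_eq_mul]

/-- The permutation of `Fin (k + l)` that acts by `σ` and `τ` on the first `k` and the last `l`
elements. -/
def blockPerm (σ : Equiv.Perm (Fin k)) (τ : Equiv.Perm (Fin l)) : Equiv.Perm (Fin (k + l)) :=
  finSumFinEquiv.permCongr (Equiv.sumCongr σ τ)

theorem sign_blockPerm (σ : Equiv.Perm (Fin k)) (τ : Equiv.Perm (Fin l)) :
    Equiv.Perm.sign (blockPerm σ τ) = Equiv.Perm.sign σ * Equiv.Perm.sign τ := by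
  rw [blockPerm, Equiv.Perm.sign_permCongr]
  exact Equiv.Perm.sign_sumCongr σ τ

theorem blockPerm_comp_castAdd (σ : Equiv.Perm (Fin k)) (τ : Equiv.Perm (Fin l)) :
    blockPerm σ τ ∘ Fin.castAdd l = Fin.castAdd l ∘ σ := by
  funext i; simp [blockPerm, Equiv.permCongr_apply]

theorem blockPerm_comp_natAdd (σ : Equiv.Perm (Fin k)) (τ : Equiv.Perm (Fin l)) :
    blockPerm σ τ ∘ Fin.natAdd k = Fin.natAdd k ∘ τ := by
  funext i; simp [blockPerm, Equiv.permCongr_apply]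

/-- The tensor product of two functions of `k` and `l` vectors. -/
def tmul (a : (Fin k → V) → ℝ) (b : (Fin l → V) → ℝ) : (Fin (k + l) → V) → ℝ :=
  fun w => a (w ∘ Fin.castAdd l) * b (w ∘ Fin.natAdd k)

theorem tmul_comp_blockPerm (a : (Fin k → V) → ℝ) (b : (Fin l → V) → ℝ)
    (σ : Equiv.Perm (Fin k)) (τ : Equiv.Perm (Fin l)) (w : Fin (k + l) → V) :
    tmul a b (w ∘ blockPerm σ τ) =
      a ((w ∘ Fin.castAdd l) ∘ σ) * b ((w ∘ Fin.natAdd k) ∘ τ) := by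
  simp only [tmul, Function.comp_assoc, blockPerm_comp_castAdd, blockPerm_comp_natAdd]

theorem altSum_sum {ι : Type*} (s : Finset ι) (m : ι → (Fin n → V) → ℝ) (v : Fin n → V) :
    altSum (fun w => ∑ i ∈ s, m i w) v = ∑ i ∈ s, altSum (m i) v := by
  simp only [altSum, Finset.mul_sum]
  exact Finset.sum_comm

theorem altSum_tmul_altSum_left (a : (Fin k → V) → ℝ) (b : (Fin l → V) → ℝ)
    (v : Fin (k + l) → V) :
    altSum (tmul (altSum a) b) v = k.factorial * altSum (tmul a b) v := by
  have h : (tmul (altSum a) b : (Fin (k + l) → V) → ℝ) = fun w => ∑ σ : Equiv.Perm (Fin k),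
      ((Equiv.Perm.sign σ : ℤ) : ℝ) * tmul a b (w ∘ blockPerm σ 1) := by
    funext w
    simp only [tmul_comp_blockPerm]
    simp only [tmul, altSum, Finset.sum_mul, mul_assoc, Equiv.Perm.coe_one, Function.comp_id]
  rw [h, altSum_sum]
  simp only [altSum_const_mul, altSum_comp_perm _ (blockPerm _ _), sign_blockPerm, map_one,
    mul_one, ← mul_assoc, sign_mul_self_cast, one_mul, Finset.sum_const, Finset.card_univ,
    Fintype.card_perm, Fintype.card_fin, nsmul_eq_mul]

theorem altSum_tmul_altSum_right (a : (Fin k → V) → ℝ) (b : (Fin l → V) → ℝ)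
    (v : Fin (k + l) → V) :
    altSum (tmul a (altSum b)) v = l.factorial * altSum (tmul a b) v := by
  have h : (tmul a (altSum b) : (Fin (k + l) → V) → ℝ) = fun w => ∑ σ : Equiv.Perm (Fin l),
      ((Equiv.Perm.sign σ : ℤ) : ℝ) * tmul a b (w ∘ blockPerm 1 σ) := by
    funext w
    simp only [tmul_comp_blockPerm]
    simp only [tmul, altSum, Finset.mul_sum, Equiv.Perm.coe_one, Function.comp_id]
    exact Finset.sum_congr rfl fun _ _ => by ring
  rw [h, altSum_sum]
  simp only [altSum_const_mul, altSum_comp_perm _ (blockPerm _ _), sign_blockPerm, map_one,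
    one_mul, ← mul_assoc, sign_mul_self_cast, Finset.sum_const, Finset.card_univ,
    Fintype.card_perm, Fintype.card_fin, nsmul_eq_mul]

/-- Permutations of `Fin (n + 1)` are described by the preimage `p` of `0` and a permutation of
the remaining elements. -/
noncomputable def permFinSucc (n : ℕ) :
    Fin (n + 1) × Equiv.Perm (Fin n) ≃ Equiv.Perm (Fin (n + 1)) :=
  Equiv.ofBijective
    (fun q => Equiv.Perm.decomposeFin.symm (0, q.2) * q.1.cycleRange) <| by
    rw [Fintype.bijective_iff_injective_and_card]
    constructor
    · rintro ⟨p, e⟩ ⟨p', e'⟩ h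
      have hp : p = p' := by
        have h0 := congrArg (fun σ : Equiv.Perm (Fin (n + 1)) => σ.symm 0) h
        have key : ∀ (p : Fin (n + 1)) (e : Equiv.Perm (Fin n)),
            (Equiv.Perm.decomposeFin.symm (0, e) * p.cycleRange).symm 0 = p := by
          intro p e
          rw [Equiv.symm_apply_eq]
          simp [Fin.cycleRange_self]
        simpa only [key] using h0
      subst hp
      have := mul_right_cancel h
      simpa using this
    · simp [Fintype.card_perm, Nat.factorial_succ]

theorem permFinSucc_apply (p : Fin (n + 1)) (e : Equiv.Perm (Fin n)) :
    permFinSucc n (p, e) = Equiv.Perm.decomposeFin.symm (0, e) * p.cycleRange :=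
  rfl

theorem sign_permFinSucc (p : Fin (n + 1)) (e : Equiv.Perm (Fin n)) :
    ((Equiv.Perm.sign (permFinSucc n (p, e)) : ℤ) : ℝ) = (-1) ^ (p : ℕ) * (Equiv.Perm.sign e : ℤ) := by
  rw [permFinSucc_apply, Equiv.Perm.sign_mul, Fin.sign_cycleRange,
    Equiv.Perm.decomposeFin.symm_sign]
  simp [mul_comm]

theorem cons_comp_permFinSucc (p : Fin (n + 1)) (e : Equiv.Perm (Fin n)) (u : V)
    (v : Fin n → V) :
    (Fin.cons u v : Fin (n + 1) → V) ∘ permFinSucc n (p, e) = p.insertNth u (v ∘ e) := by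
  rw [Fin.eq_insertNth_iff]
  constructor
  · simp [permFinSucc_apply]
  · funext i
    simp [permFinSucc_apply, Fin.removeNth, Fin.cycleRange_succAbove]

theorem altSum_cons (m : (Fin (n + 1) → V) → ℝ) (u : V) (v : Fin n → V) :
    altSum m (Fin.cons u v) =
      ∑ p : Fin (n + 1), (-1) ^ (p : ℕ) * altSum (fun w => m (p.insertNth u w)) v := by
  rw [altSum, ← (permFinSucc n).sum_comp, Fintype.sum_prod_type]
  simp only [sign_permFinSucc, cons_comp_permFinSucc, altSum, Finset.mul_sum, mul_assoc]

theorem comp_permFinSucc_inv (p : Fin (n + 1)) (e : Equiv.Perm (Fin n)) (v : Fin (n + 1) → V) :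
    v ∘ ⇑(permFinSucc n (p, e))⁻¹ = Fin.cons (v p) (p.removeNth v ∘ ⇑e⁻¹) := by
  have h : (Fin.cons (v p) (p.removeNth v ∘ ⇑e⁻¹) : Fin (n + 1) → V) ∘ permFinSucc n (p, e) = v := by
    rw [cons_comp_permFinSucc, Function.comp_assoc]
    simp
  conv_lhs => rw [← h]
  rw [Function.comp_assoc]
  simp

theorem altSum_eq_sum_removeNth (m : (Fin (n + 1) → V) → ℝ) (v : Fin (n + 1) → V) :
    altSum m v =
      ∑ p : Fin (n + 1), (-1) ^ (p : ℕ) *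
        altSum (fun w => m (Fin.cons (v p) w)) (p.removeNth v) := by
  have h : altSum m v = ∑ σ : Equiv.Perm (Fin (n + 1)),
      ((Equiv.Perm.sign σ⁻¹ : ℤ) : ℝ) * m (v ∘ ⇑σ⁻¹) :=
    Fintype.sum_equiv (Equiv.inv _) _ _ fun σ => by simp
  rw [h, ← (permFinSucc n).sum_comp, Fintype.sum_prod_type]
  refine Finset.sum_congr rfl fun p _ => ?_
  rw [altSum, Finset.mul_sum]
  refine Fintype.sum_equiv (Equiv.inv _) _ _ fun e => ?_
  simp only [Equiv.inv_apply, Equiv.Perm.sign_inv, comp_permFinSucc_inv, sign_permFinSucc,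
    mul_assoc]

end AltSum

section Insert

variable {V : Type*} {k l : ℕ}

theorem insertNth_castAdd_comp_castAdd (a : Fin (k + 1)) (u : V) (w : Fin (k + 1 + l) → V) :
    (Fin.insertNth (α := fun _ : Fin (k + 1 + l + 1) => V) (Fin.castAdd (l + 1) a) u w) ∘
      Fin.castAdd (l + 1) =
      a.insertNth u ((w ∘ Fin.cast (show k + (l + 1) = k + 1 + l by omega)) ∘ Fin.castAdd (l + 1)) := by
  rw [Fin.eq_insertNth_iff]
  refine ⟨by simp, ?_⟩
  funext i
  have : Fin.castAdd (l + 1) (a.succAbove i) =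
      (Fin.castAdd (l + 1) a : Fin (k + 1 + l + 1)).succAbove
        (Fin.cast (show k + (l + 1) = k + 1 + l by omega) (Fin.castAdd (l + 1) i)) := by
    ext
    simp only [Fin.succAbove, Fin.lt_def, Fin.val_castAdd, Fin.val_castSucc, Fin.val_cast]
    split_ifs <;> simp
  simp only [Fin.removeNth, Function.comp_apply]
  rw [this, Fin.insertNth_apply_succAbove]

theorem insertNth_castAdd_comp_natAdd (a : Fin (k + 1)) (u : V) (w : Fin (k + 1 + l) → V) :
    (Fin.insertNth (α := fun _ : Fin (k + 1 + l + 1) => V) (Fin.castAdd (l + 1) a) u w) ∘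
      Fin.natAdd (k + 1) = (w ∘ Fin.cast (show k + (l + 1) = k + 1 + l by omega)) ∘ Fin.natAdd (m := l + 1) k := by
  funext i
  have : Fin.natAdd (k + 1) i =
      (Fin.castAdd (l + 1) a : Fin (k + 1 + l + 1)).succAbove
        (Fin.cast (show k + (l + 1) = k + 1 + l by omega) (Fin.natAdd (m := l + 1) k i)) := by
    ext
    simp only [Fin.succAbove, Fin.lt_def, Fin.val_castAdd, Fin.val_castSucc, Fin.val_cast,
      Fin.val_natAdd]
    split_ifs
    · omega
    · simp; omega
  simp only [Function.comp_apply]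
  rw [this, Fin.insertNth_apply_succAbove]

theorem insertNth_natAdd_comp_castAdd (b : Fin (l + 1)) (u : V) (w : Fin (k + l) → V) :
    (Fin.insertNth (α := fun _ : Fin (k + l + 1) => V) (Fin.natAdd k b) u w) ∘
      Fin.castAdd (l + 1) = w ∘ Fin.castAdd l := by
  funext i
  have : Fin.castAdd (l + 1) i =
      (Fin.natAdd k b : Fin (k + l + 1)).succAbove (Fin.castAdd l i) := by
    ext
    simp only [Fin.succAbove, Fin.lt_def, Fin.val_castAdd, Fin.val_castSucc, Fin.val_natAdd]
    split_ifs
    · simp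
    · omega
  simp only [Function.comp_apply]
  rw [this, Fin.insertNth_apply_succAbove]

theorem insertNth_natAdd_comp_natAdd (b : Fin (l + 1)) (u : V) (w : Fin (k + l) → V) :
    (Fin.insertNth (α := fun _ : Fin (k + l + 1) => V) (Fin.natAdd k b) u w) ∘
      Fin.natAdd k = b.insertNth u (w ∘ Fin.natAdd k) := by
  rw [Fin.eq_insertNth_iff]
  refine ⟨by simp, ?_⟩
  funext i
  have : Fin.natAdd k (b.succAbove i) =
      (Fin.natAdd k b : Fin (k + l + 1)).succAbove (Fin.natAdd k i) := by
    ext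
    simp only [Fin.succAbove, Fin.lt_def, Fin.val_castSucc, Fin.val_natAdd]
    split_ifs <;> simp <;> omega
  simp only [Fin.removeNth, Function.comp_apply]
  rw [this, Fin.insertNth_apply_succAbove]

theorem altSum_comp_cast {m n : ℕ} (h : m = n) (f : (Fin m → V) → ℝ) (v : Fin n → V) :
    altSum (fun w => f (w ∘ Fin.cast h)) v = altSum f (v ∘ Fin.cast h) := by
  subst h; rfl

theorem neg_one_pow_mul_neg_one_pow (a : ℕ) : ((-1 : ℝ)) ^ a * (-1) ^ a = 1 := by
  rw [← mul_pow]; simp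

theorem tmul_const_mul_left (c : ℝ) (a : (Fin k → V) → ℝ) (b : (Fin l → V) → ℝ) :
    tmul (fun w => c * a w) b = fun w => c * tmul a b w := by
  funext w; simp [tmul, mul_assoc]

theorem tmul_const_mul_right (c : ℝ) (a : (Fin k → V) → ℝ) (b : (Fin l → V) → ℝ) :
    tmul a (fun w => c * b w) = fun w => c * tmul a b w := by
  funext w; simp only [tmul]; ring

end Insert

section Wedge

variable {V W : Type*} [AddCommGroup V] [Module ℝ V] [TopologicalSpace V]
  [AddCommGroup W] [Module ℝ W] [TopologicalSpace W] {k l n : ℕ}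

theorem wedge_apply (α : V [⋀^Fin k]→L[ℝ] ℝ) (β : V [⋀^Fin l]→L[ℝ] ℝ) (v : Fin (k + l) → V) :
    wedge α β v = ((k.factorial : ℝ) * l.factorial)⁻¹ * altSum (tmul α β) v := by
  rw [wedge, ContinuousAlternatingMap.smul_apply,
    ContinuousMultilinearMap.alternatization_apply_apply, smul_eq_mul, altSum]
  congr 1
  refine Finset.sum_congr rfl fun σ _ => ?_
  rw [Units.smul_def, zsmul_eq_mul]
  rfl

theorem map_comp_perm (α : V [⋀^Fin n]→L[ℝ] ℝ) (v : Fin n → V) (σ : Equiv.Perm (Fin n)) :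
    α (v ∘ σ) = (Equiv.Perm.sign σ : ℤ) * α v := by
  have := α.toAlternatingMap.map_perm v σ
  rwa [Units.smul_def, zsmul_eq_mul] at this

theorem altSum_form (α : V [⋀^Fin n]→L[ℝ] ℝ) (v : Fin n → V) :
    altSum α v = n.factorial * α v :=
  altSum_of_alternating _ (map_comp_perm α) v

theorem map_insertNth_form (α : V [⋀^Fin (n + 1)]→L[ℝ] ℝ) (p : Fin (n + 1)) (u : V)
    (w : Fin n → V) : α (p.insertNth u w) = (-1) ^ (p : ℕ) * α (Fin.cons u w) := by
  have := α.toAlternatingMap.map_insertNth p u w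
  rw [zsmul_eq_mul] at this
  push_cast at this
  exact this

theorem interiorProd_cons (u : V) (α : V [⋀^Fin (n + 1)]→L[ℝ] ℝ) (v : Fin n → V) :
    interiorProd u α v = α (Fin.cons u v) :=
  rfl

theorem tmul_insertNth_castAdd (α : V [⋀^Fin (k + 1)]→L[ℝ] ℝ) (β : V [⋀^Fin (l + 1)]→L[ℝ] ℝ)
    (a : Fin (k + 1)) (u : V) (w : Fin (k + 1 + l) → V) :
    tmul α β (Fin.insertNth (α := fun _ : Fin (k + 1 + l + 1) => V)
      (Fin.castAdd (l + 1) a) u w) =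
      (-1) ^ (a : ℕ) * tmul (interiorProd u α) β (w ∘ Fin.cast (show k + (l + 1) = k + 1 + l by omega)) := by
  simp only [tmul]
  rw [insertNth_castAdd_comp_castAdd, insertNth_castAdd_comp_natAdd, map_insertNth_form,
    interiorProd_cons, mul_assoc]

theorem tmul_insertNth_natAdd (α : V [⋀^Fin k]→L[ℝ] ℝ) (β : V [⋀^Fin (l + 1)]→L[ℝ] ℝ)
    (b : Fin (l + 1)) (u : V) (w : Fin (k + l) → V) :
    tmul α β (Fin.insertNth (α := fun _ : Fin (k + l + 1) => V)
      (Fin.natAdd k b) u w) =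
      (-1) ^ (b : ℕ) * tmul α (interiorProd u β) w := by
  simp only [tmul]
  rw [insertNth_natAdd_comp_castAdd, insertNth_natAdd_comp_natAdd, map_insertNth_form,
    interiorProd_cons]
  ring

/-- The interior product is an antiderivation of the wedge product. -/
theorem wedge_cons (α : V [⋀^Fin (k + 1)]→L[ℝ] ℝ) (β : V [⋀^Fin (l + 1)]→L[ℝ] ℝ) (u : V)
    (v : Fin (k + 1 + l) → V) :
    wedge α β (Fin.cons u v : Fin (k + 1 + l + 1) → V) =
      wedge (interiorProd u α) β (v ∘ Fin.cast (show k + (l + 1) = k + 1 + l by omega)) +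
        (-1) ^ (k + 1) * wedge α (interiorProd u β) v := by
  have hs : altSum (tmul α β) (Fin.cons u v : Fin (k + 1 + l + 1) → V) =
      (k + 1) * altSum (tmul (interiorProd u α) β) (v ∘ Fin.cast (show k + (l + 1) = k + 1 + l by omega)) +
        (-1) ^ (k + 1) * ((l + 1) * altSum (tmul α (interiorProd u β)) v) := by
    rw [altSum_cons]
    refine (Fin.sum_univ_add (a := k + 1) (b := l + 1) _).trans ?_
    congr 1
    · simp only [tmul_insertNth_castAdd, altSum_const_mul, ← mul_assoc, Fin.val_castAdd,
        neg_one_pow_mul_neg_one_pow, one_mul, Finset.sum_const, Finset.card_univ,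
        Fintype.card_fin, nsmul_eq_mul]
      rw [altSum_comp_cast]
      push_cast
      ring
    · have hterm : ∀ b : Fin (l + 1), (-1 : ℝ) ^ (Fin.natAdd (k + 1) b : ℕ) *
          altSum (fun w => tmul α β (Fin.insertNth (α := fun _ : Fin (k + 1 + l + 1) => V)
            (Fin.natAdd (k + 1) b) u w)) v =
          (-1) ^ (k + 1) * altSum (tmul α (interiorProd u β)) v := by
        intro b
        simp only [tmul_insertNth_natAdd, altSum_const_mul, Fin.val_natAdd, pow_add _ (k + 1)]
        linear_combination ((-1 : ℝ) ^ (k + 1) * altSum (tmul α (interiorProd u β)) v) *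
          neg_one_pow_mul_neg_one_pow b
      refine (Finset.sum_congr rfl fun b _ => hterm b).trans ?_
      rw [Finset.sum_const, Finset.card_univ, Fintype.card_fin, nsmul_eq_mul]
      push_cast
      ring
  rw [wedge_apply, wedge_apply, wedge_apply, hs, Nat.factorial_succ, Nat.factorial_succ]
  have h1 : (k.factorial : ℝ) ≠ 0 := by positivity
  have h2 : (l.factorial : ℝ) ≠ 0 := by positivity
  have h3 : (k : ℝ) + 1 ≠ 0 := by positivity
  have h4 : (l : ℝ) + 1 ≠ 0 := by positivity
  push_cast
  field_simp

theorem wedge_compContinuousLinearMap (α : W [⋀^Fin k]→L[ℝ] ℝ) (β : W [⋀^Fin l]→L[ℝ] ℝ)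
    (L : V →L[ℝ] W) :
    (wedge α β).compContinuousLinearMap L =
      wedge (α.compContinuousLinearMap L) (β.compContinuousLinearMap L) := by
  ext v
  rw [ContinuousAlternatingMap.compContinuousLinearMap_apply, wedge_apply, wedge_apply]
  rfl

theorem wedge_add_left (α α' : V [⋀^Fin k]→L[ℝ] ℝ) (β : V [⋀^Fin l]→L[ℝ] ℝ) :
    wedge (α + α') β = wedge α β + wedge α' β := by
  ext v
  simp only [ContinuousAlternatingMap.add_apply, wedge_apply, ← mul_add, ← altSum_add]
  congr 2
  funext w
  simp [tmul, add_mul]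

theorem wedge_add_right (α : V [⋀^Fin k]→L[ℝ] ℝ) (β β' : V [⋀^Fin l]→L[ℝ] ℝ) :
    wedge α (β + β') = wedge α β + wedge α β' := by
  ext v
  simp only [ContinuousAlternatingMap.add_apply, wedge_apply, ← mul_add, ← altSum_add]
  congr 2
  funext w
  simp [tmul, mul_add]

theorem wedge_smul_left (c : ℝ) (α : V [⋀^Fin k]→L[ℝ] ℝ) (β : V [⋀^Fin l]→L[ℝ] ℝ) :
    wedge (c • α) β = c • wedge α β := by
  ext v
  have : tmul (c • α) β = fun w => c * tmul α β w := by funext w; simp [tmul, mul_assoc]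
  simp only [ContinuousAlternatingMap.smul_apply, wedge_apply, smul_eq_mul, this,
    altSum_const_mul]
  ring

theorem wedge_smul_right (c : ℝ) (α : V [⋀^Fin k]→L[ℝ] ℝ) (β : V [⋀^Fin l]→L[ℝ] ℝ) :
    wedge α (c • β) = c • wedge α β := by
  ext v
  have : tmul α (c • β) = fun w => c * tmul α β w := by funext w; simp [tmul]; ring
  simp only [ContinuousAlternatingMap.smul_apply, wedge_apply, smul_eq_mul, this,
    altSum_const_mul]
  ring

theorem wedge_zero_left (β : V [⋀^Fin l]→L[ℝ] ℝ) :
    wedge (0 : V [⋀^Fin k]→L[ℝ] ℝ) β = 0 := by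
  simpa using wedge_smul_left 0 (0 : V [⋀^Fin k]→L[ℝ] ℝ) β

theorem wedge_zero_right (α : V [⋀^Fin k]→L[ℝ] ℝ) :
    wedge α (0 : V [⋀^Fin l]→L[ℝ] ℝ) = 0 := by
  simpa using wedge_smul_right 0 α (0 : V [⋀^Fin l]→L[ℝ] ℝ)

theorem coe_wedge (α : V [⋀^Fin k]→L[ℝ] ℝ) (β : V [⋀^Fin l]→L[ℝ] ℝ) :
    (wedge α β : (Fin (k + l) → V) → ℝ) =
      fun v => ((k.factorial : ℝ) * l.factorial)⁻¹ * altSum (tmul α β) v :=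
  funext (wedge_apply α β)

theorem wedge_wedge_left_apply {m : ℕ} (α : V [⋀^Fin k]→L[ℝ] ℝ) (β : V [⋀^Fin l]→L[ℝ] ℝ)
    (η : V [⋀^Fin m]→L[ℝ] ℝ) (v : Fin (k + l + m) → V) :
    wedge (wedge α β) η v =
      ((k.factorial : ℝ) * l.factorial * m.factorial)⁻¹ * altSum (tmul (tmul α β) η) v := by
  have h1 : ((k + l).factorial : ℝ) ≠ 0 := by positivity
  rw [wedge_apply, coe_wedge, tmul_const_mul_left, altSum_const_mul, altSum_tmul_altSum_left]
  field_simp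

theorem wedge_wedge_wedge_apply {m p : ℕ} (α : V [⋀^Fin k]→L[ℝ] ℝ) (β : V [⋀^Fin l]→L[ℝ] ℝ)
    (η : V [⋀^Fin m]→L[ℝ] ℝ) (φ : V [⋀^Fin p]→L[ℝ] ℝ) (v : Fin (k + l + (m + p)) → V) :
    wedge (wedge α β) (wedge η φ) v =
      ((k.factorial : ℝ) * l.factorial * (m.factorial * p.factorial))⁻¹ *
        altSum (tmul (tmul α β) (tmul η φ)) v := by
  have h1 : ((k + l).factorial : ℝ) ≠ 0 := by positivity
  have h2 : ((m + p).factorial : ℝ) ≠ 0 := by positivity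
  rw [wedge_apply, coe_wedge, coe_wedge, tmul_const_mul_left, tmul_const_mul_right]
  simp only [altSum_const_mul]
  rw [altSum_tmul_altSum_left, altSum_tmul_altSum_right]
  field_simp

/-- Two-forms commute under the wedge product. -/
theorem wedge_wedge_wedge_comm (α β η φ : V [⋀^Fin 2]→L[ℝ] ℝ) :
    wedge (wedge α β) (wedge η φ) = wedge (wedge α η) (wedge β φ) := by
  ext v
  rw [wedge_wedge_wedge_apply, wedge_wedge_wedge_apply]
  congr 1
  let ρ : Equiv.Perm (Fin 8) :=
    ⟨![0, 1, 4, 5, 2, 3, 6, 7], ![0, 1, 4, 5, 2, 3, 6, 7], by decide, by decide⟩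
  have hρ : Equiv.Perm.sign ρ = 1 := by decide
  have h : (tmul (tmul α β) (tmul η φ) : (Fin 8 → V) → ℝ) =
      fun w => tmul (tmul α η) (tmul β φ) (w ∘ ρ) := by
    funext w
    simp only [tmul]
    rw [mul_mul_mul_comm]
    congr 2 <;> congr 1 <;> funext i <;> fin_cases i <;> rfl
  rw [h, altSum_comp_perm, hρ]
  simp

end Wedge

section Pfaffian

variable {V : Type*} {f : V → V → ℝ}

/-- The Pfaffian of four vectors with respect to an antisymmetric function. -/
def pf4 (f : V → V → ℝ) (a b c d : V) : ℝ :=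
  f a b * f c d - f a c * f b d + f a d * f b c

/-- The Pfaffian of six vectors with respect to an antisymmetric function. -/
def pf6 (f : V → V → ℝ) (a b c d e g : V) : ℝ :=
  f a b * pf4 f c d e g - f a c * pf4 f b d e g + f a d * pf4 f b c e g -
    f a e * pf4 f b c d g + f a g * pf4 f b c d e

theorem altSum_zero_args (m : (Fin 0 → V) → ℝ) (v : Fin 0 → V) : altSum m v = m v := by
  simp [altSum]

theorem altSum_two (hf : ∀ a b, f a b = -f b a) (v : Fin 2 → V) :
    altSum (fun w => f (w 0) (w 1)) v = 2 * f (v 0) (v 1) := by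
  rw [altSum_eq_sum_removeNth]
  simp only [altSum_eq_sum_removeNth (n := 0), altSum_zero_args, Fin.sum_univ_succ,
    Fin.removeNth, Fin.succAbove, Fin.lt_def]
  simp
  rw [hf (v 1) (v 0)]
  ring

theorem altSum_four (hf : ∀ a b, f a b = -f b a) (v : Fin 4 → V) :
    altSum (fun w => f (w 0) (w 1) * f (w 2) (w 3)) v = 8 * pf4 f (v 0) (v 1) (v 2) (v 3) := by
  have h2 : ∀ (c : ℝ) (v : Fin 2 → V),
      altSum (fun w => c * f (w 0) (w 1)) v = c * (2 * f (v 0) (v 1)) := fun c v => by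
    rw [altSum_const_mul, altSum_two hf]
  have h3 : ∀ (a : V) (v : Fin 3 → V),
      altSum (fun w => f a (w 0) * f (w 1) (w 2)) v =
        2 * (f a (v 0) * f (v 1) (v 2) - f a (v 1) * f (v 0) (v 2) + f a (v 2) * f (v 0) (v 1)) := by
    intro a v
    have h : ∀ p : Fin 3, altSum (fun w : Fin 2 → V =>
        (fun w : Fin 3 → V => f a (w 0) * f (w 1) (w 2)) (Fin.cons (v p) w)) (p.removeNth v) =
        f a (v p) * (2 * f (p.removeNth v 0) (p.removeNth v 1)) := fun p => h2 (f a (v p)) (p.removeNth v)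
    rw [altSum_eq_sum_removeNth]
    simp only [h]
    refine (Fin.sum_univ_three _).trans ?_
    change (-1) ^ 0 * (f a (v 0) * (2 * f (v 1) (v 2))) +
      (-1) ^ 1 * (f a (v 1) * (2 * f (v 0) (v 2))) +
      (-1) ^ 2 * (f a (v 2) * (2 * f (v 0) (v 1))) = _
    ring
  have h : ∀ p : Fin 4, altSum (fun w : Fin 3 → V =>
      (fun w : Fin 4 → V => f (w 0) (w 1) * f (w 2) (w 3)) (Fin.cons (v p) w)) (p.removeNth v) =
      2 * (f (v p) (p.removeNth v 0) * f (p.removeNth v 1) (p.removeNth v 2) -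
        f (v p) (p.removeNth v 1) * f (p.removeNth v 0) (p.removeNth v 2) +
        f (v p) (p.removeNth v 2) * f (p.removeNth v 0) (p.removeNth v 1)) := fun p => h3 (v p) (p.removeNth v)
  rw [altSum_eq_sum_removeNth]
  simp only [h]
  refine (Fin.sum_univ_four _).trans ?_
  change (-1) ^ 0 * (2 * (f (v 0) (v 1) * f (v 2) (v 3) - f (v 0) (v 2) * f (v 1) (v 3) +
      f (v 0) (v 3) * f (v 1) (v 2))) +
    (-1) ^ 1 * (2 * (f (v 1) (v 0) * f (v 2) (v 3) - f (v 1) (v 2) * f (v 0) (v 3) +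
      f (v 1) (v 3) * f (v 0) (v 2))) +
    (-1) ^ 2 * (2 * (f (v 2) (v 0) * f (v 1) (v 3) - f (v 2) (v 1) * f (v 0) (v 3) +
      f (v 2) (v 3) * f (v 0) (v 1))) +
    (-1) ^ 3 * (2 * (f (v 3) (v 0) * f (v 1) (v 2) - f (v 3) (v 1) * f (v 0) (v 2) +
      f (v 3) (v 2) * f (v 0) (v 1))) = _
  rw [pf4, hf (v 1) (v 0), hf (v 2) (v 0), hf (v 2) (v 1), hf (v 3) (v 0), hf (v 3) (v 1),
    hf (v 3) (v 2)]
  ring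

theorem altSum_five (hf : ∀ a b, f a b = -f b a) (u : V) (v : Fin 5 → V) :
    altSum (fun w => f u (w 0) * (f (w 1) (w 2) * f (w 3) (w 4))) v =
      8 * pf6 f u (v 0) (v 1) (v 2) (v 3) (v 4) := by
  have h4 : ∀ (c : ℝ) (v : Fin 4 → V),
      altSum (fun w => c * (f (w 0) (w 1) * f (w 2) (w 3))) v =
        c * (8 * pf4 f (v 0) (v 1) (v 2) (v 3)) := fun c v => by
    rw [altSum_const_mul, altSum_four hf]
  have h : ∀ p : Fin 5, altSum (fun w : Fin 4 → V =>
      (fun w : Fin 5 → V => f u (w 0) * (f (w 1) (w 2) * f (w 3) (w 4))) (Fin.cons (v p) w))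
        (p.removeNth v) =
      f u (v p) * (8 * pf4 f (p.removeNth v 0) (p.removeNth v 1) (p.removeNth v 2)
        (p.removeNth v 3)) := fun p =>
    h4 (f u (v p)) (p.removeNth v)
  rw [altSum_eq_sum_removeNth]
  simp only [h]
  refine (Fin.sum_univ_five _).trans ?_
  change (-1) ^ 0 * (f u (v 0) * (8 * pf4 f (v 1) (v 2) (v 3) (v 4))) +
    (-1) ^ 1 * (f u (v 1) * (8 * pf4 f (v 0) (v 2) (v 3) (v 4))) +
    (-1) ^ 2 * (f u (v 2) * (8 * pf4 f (v 0) (v 1) (v 3) (v 4))) +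
    (-1) ^ 3 * (f u (v 3) * (8 * pf4 f (v 0) (v 1) (v 2) (v 4))) +
    (-1) ^ 4 * (f u (v 4) * (8 * pf4 f (v 0) (v 1) (v 2) (v 3))) = _
  rw [pf6]
  ring

theorem altSum_six (hf : ∀ a b, f a b = -f b a) (v : Fin 6 → V) :
    altSum (fun w => f (w 0) (w 1) * f (w 2) (w 3) * f (w 4) (w 5)) v =
      48 * pf6 f (v 0) (v 1) (v 2) (v 3) (v 4) (v 5) := by
  set m : (Fin 6 → V) → ℝ := fun w => f (w 0) (w 1) * f (w 2) (w 3) * f (w 4) (w 5)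
  set q : (Fin 5 → V) → ℝ := fun w => f (v 0) (w 0) * (f (w 1) (w 2) * f (w 3) (w 4)) with hq
  have key : ∀ (p : Fin 6) (t : Fin 5 → V),
      altSum (fun w => m (p.insertNth (v 0) w)) t = (-1) ^ (p : ℕ) * altSum q t := by
    let ρ : Equiv.Perm (Fin 5) :=
      ⟨![2, 0, 1, 3, 4], ![1, 2, 0, 3, 4], by decide, by decide⟩
    have hρ : Equiv.Perm.sign ρ = 1 := by decide
    let τ : Equiv.Perm (Fin 5) :=
      ⟨![4, 0, 1, 2, 3], ![1, 2, 3, 4, 0], by decide, by decide⟩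
    have hτ : Equiv.Perm.sign τ = 1 := by decide
    have e0 : ∀ t, altSum (fun w => m (Fin.insertNth 0 (v 0) w)) t = altSum q t := fun t => by
      congr 1; funext w; simp only [hq]; exact mul_assoc _ _ _
    have e2 : ∀ t, altSum (fun w => m (Fin.insertNth 2 (v 0) w)) t = altSum q t := fun t => by
      rw [← one_mul (altSum q t)]
      have h := altSum_comp_perm q ρ t
      rw [hρ] at h
      simp only [Units.val_one, Int.cast_one] at h
      rw [← h]
      congr 1
      funext w
      change f (w 0) (w 1) * f (v 0) (w 2) * f (w 3) (w 4) =
        f (v 0) (w 2) * (f (w 0) (w 1) * f (w 3) (w 4))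
      ring
    have e4 : ∀ t, altSum (fun w => m (Fin.insertNth 4 (v 0) w)) t = altSum q t := fun t => by
      rw [← one_mul (altSum q t)]
      have h := altSum_comp_perm q τ t
      rw [hτ] at h
      simp only [Units.val_one, Int.cast_one] at h
      rw [← h]
      congr 1
      funext w
      change f (w 0) (w 1) * f (w 2) (w 3) * f (v 0) (w 4) =
        f (v 0) (w 4) * (f (w 0) (w 1) * f (w 2) (w 3))
      ring
    have e1 : ∀ w : Fin 5 → V, m (Fin.insertNth 1 (v 0) w) =
        -1 * m (Fin.insertNth 0 (v 0) w) := fun w => by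
      change f (w 0) (v 0) * f (w 1) (w 2) * f (w 3) (w 4) =
        -1 * (f (v 0) (w 0) * f (w 1) (w 2) * f (w 3) (w 4))
      rw [hf (w 0)]; ring
    have e3 : ∀ w : Fin 5 → V, m (Fin.insertNth 3 (v 0) w) =
        -1 * m (Fin.insertNth 2 (v 0) w) := fun w => by
      change f (w 0) (w 1) * f (w 2) (v 0) * f (w 3) (w 4) =
        -1 * (f (w 0) (w 1) * f (v 0) (w 2) * f (w 3) (w 4))
      rw [hf (w 2)]; ring
    have e5 : ∀ w : Fin 5 → V, m (Fin.insertNth 5 (v 0) w) =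
        -1 * m (Fin.insertNth 4 (v 0) w) := fun w => by
      change f (w 0) (w 1) * f (w 2) (w 3) * f (w 4) (v 0) =
        -1 * (f (w 0) (w 1) * f (w 2) (w 3) * f (v 0) (w 4))
      rw [hf (w 4)]; ring
    intro p t
    fin_cases p
    · simpa using e0 t
    · simp only [Fin.mk_one, e1, altSum_const_mul, e0]; norm_num
    · refine (e2 t).trans ?_; norm_num
    · simp only [Fin.reduceFinMk, e3, altSum_const_mul, e2]; norm_num
    · refine (e4 t).trans ?_; norm_num
    · simp only [Fin.reduceFinMk, e5, altSum_const_mul, e4]; norm_num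
  have hv : v = Fin.cons (v 0) (Fin.tail v) := (Fin.cons_self_tail v).symm
  rw [hv, altSum_cons]
  simp only [key, ← mul_assoc, neg_one_pow_mul_neg_one_pow, one_mul, Finset.sum_const,
    Finset.card_univ, Fintype.card_fin, nsmul_eq_mul]
  rw [hq, altSum_five hf]
  simp only [Fin.tail]
  change _ = 48 * pf6 f (v 0) (v 1) (v 2) (v 3) (v 4) (v 5)
  change (6 : ℕ) * (8 * pf6 f (v 0) (v 1) (v 2) (v 3) (v 4) (v 5)) = _
  push_cast; ring

end Pfaffian

section TwoForms

variable {V : Type*} [AddCommGroup V] [Module ℝ V] [TopologicalSpace V]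

theorem two_form_antisymm (δ : V [⋀^Fin 2]→L[ℝ] ℝ) (a b : V) : δ ![a, b] = -δ ![b, a] := by
  have h := map_comp_perm δ ![b, a] (Equiv.swap 0 1)
  have e : ![b, a] ∘ (Equiv.swap (0 : Fin 2) 1) = ![a, b] := by
    funext i; fin_cases i <;> rfl
  rw [e, Equiv.Perm.sign_swap (by decide)] at h
  simpa using h

theorem two_form_eq (δ : V [⋀^Fin 2]→L[ℝ] ℝ) (v : Fin 2 → V) : δ v = δ ![v 0, v 1] := by
  congr 1; funext i; fin_cases i <;> rfl

theorem wedge_self_apply (δ : V [⋀^Fin 2]→L[ℝ] ℝ) (v : Fin 4 → V) :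
    wedge δ δ v = 2 * pf4 (fun a b => δ ![a, b]) (v 0) (v 1) (v 2) (v 3) := by
  have h : (tmul δ δ : (Fin 4 → V) → ℝ) =
      fun w => δ ![w 0, w 1] * δ ![w 2, w 3] := by
    funext w
    simp only [tmul]
    rw [two_form_eq δ, two_form_eq δ (_ ∘ Fin.natAdd 2)]
    rfl
  rw [wedge_apply, h, altSum_four (f := fun a b => δ ![a, b]) (two_form_antisymm δ)]
  norm_num [Nat.factorial]
  ring

theorem wedge_self_self_apply (δ : V [⋀^Fin 2]→L[ℝ] ℝ) (v : Fin 6 → V) :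
    wedge (wedge δ δ) δ v =
      6 * pf6 (fun a b => δ ![a, b]) (v 0) (v 1) (v 2) (v 3) (v 4) (v 5) := by
  have h : (tmul (tmul δ δ) δ : (Fin 6 → V) → ℝ) =
      fun w => δ ![w 0, w 1] * δ ![w 2, w 3] * δ ![w 4, w 5] := by
    funext w
    simp only [tmul]
    rw [two_form_eq δ, two_form_eq δ (_ ∘ Fin.natAdd 2), two_form_eq δ (_ ∘ Fin.natAdd (2 + 2))]
    rfl
  rw [wedge_wedge_left_apply, h, altSum_six (f := fun a b => δ ![a, b]) (two_form_antisymm δ)]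
  norm_num [Nat.factorial]
  ring

end TwoForms

section Box

variable {V W : Type*} [AddCommGroup V] [Module ℝ V] [TopologicalSpace V]
  [AddCommGroup W] [Module ℝ W] [TopologicalSpace W] {k l n : ℕ}

/-- The wedge product `pr₁^*α ∧ pr₂^*β` on `V × W`. -/
noncomputable def boxWedge (α : V [⋀^Fin k]→L[ℝ] ℝ) (β : W [⋀^Fin l]→L[ℝ] ℝ) :
    (V × W) [⋀^Fin (k + l)]→L[ℝ] ℝ :=
  wedge (α.compContinuousLinearMap (ContinuousLinearMap.fst ℝ V W))
    (β.compContinuousLinearMap (ContinuousLinearMap.snd ℝ V W))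

theorem interiorProd_fst (α : V [⋀^Fin (k + 1)]→L[ℝ] ℝ) (u : V × W) :
    interiorProd u (α.compContinuousLinearMap (ContinuousLinearMap.fst ℝ V W)) =
      (interiorProd u.1 α).compContinuousLinearMap (ContinuousLinearMap.fst ℝ V W) := by
  ext v
  simp only [interiorProd_cons, ContinuousAlternatingMap.compContinuousLinearMap_apply]
  congr 1
  funext i
  refine Fin.cases ?_ (fun j => ?_) i <;> simp

theorem interiorProd_snd (β : W [⋀^Fin (k + 1)]→L[ℝ] ℝ) (u : V × W) :
    interiorProd u (β.compContinuousLinearMap (ContinuousLinearMap.snd ℝ V W)) =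
      (interiorProd u.2 β).compContinuousLinearMap (ContinuousLinearMap.snd ℝ V W) := by
  ext v
  simp only [interiorProd_cons, ContinuousAlternatingMap.compContinuousLinearMap_apply]
  congr 1
  funext i
  refine Fin.cases ?_ (fun j => ?_) i <;> simp

theorem boxWedge_cons (α : V [⋀^Fin (k + 1)]→L[ℝ] ℝ) (β : W [⋀^Fin (l + 1)]→L[ℝ] ℝ)
    (u : V × W) (v : Fin (k + 1 + l) → V × W) :
    boxWedge α β (Fin.cons u v : Fin (k + 1 + l + 1) → V × W) =
      boxWedge (interiorProd u.1 α) β (v ∘ Fin.cast (show k + (l + 1) = k + 1 + l by omega)) +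
        (-1) ^ (k + 1) * boxWedge α (interiorProd u.2 β) v := by
  rw [boxWedge, wedge_cons, interiorProd_fst, interiorProd_snd]
  rfl

theorem interiorProd_zero (α : V [⋀^Fin (k + 1)]→L[ℝ] ℝ) : interiorProd 0 α = 0 := by
  ext v
  rw [interiorProd_cons]
  exact α.map_coord_zero 0 rfl

theorem boxWedge_zero_left (β : W [⋀^Fin l]→L[ℝ] ℝ) :
    boxWedge (0 : V [⋀^Fin k]→L[ℝ] ℝ) β = 0 :=
  wedge_zero_left _

theorem boxWedge_zero_right (α : V [⋀^Fin k]→L[ℝ] ℝ) :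
    boxWedge α (0 : W [⋀^Fin l]→L[ℝ] ℝ) = 0 :=
  wedge_zero_right _

theorem blockPerm_injective :
    Function.Injective fun q : Equiv.Perm (Fin k) × Equiv.Perm (Fin l) => blockPerm q.1 q.2 := by
  rintro ⟨σ, τ⟩ ⟨σ', τ'⟩ h
  have := finSumFinEquiv.permCongr.injective h
  exact Equiv.Perm.sumCongrHom_injective (a₁ := (σ, τ)) (a₂ := (σ', τ')) this

theorem exists_blockPerm (σ : Equiv.Perm (Fin (k + l)))
    (h : ∀ i : Fin k, ∃ j : Fin k, σ (Fin.castAdd l i) = Fin.castAdd l j) :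
    ∃ q : Equiv.Perm (Fin k) × Equiv.Perm (Fin l), blockPerm q.1 q.2 = σ := by
  have h2 : finSumFinEquiv.permCongr.symm σ ∈ (Equiv.Perm.sumCongrHom (Fin k) (Fin l)).range := by
    refine Equiv.Perm.mem_sumCongrHom_range_of_perm_mapsTo_inl ?_
    rintro _ ⟨i, rfl⟩
    obtain ⟨j, hj⟩ := h i
    refine ⟨j, ?_⟩
    rw [Equiv.permCongr_symm_apply, finSumFinEquiv_apply_left, hj,
      finSumFinEquiv_symm_apply_castAdd]
  obtain ⟨q, hq⟩ := h2
  refine ⟨q, ?_⟩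
  rw [Equiv.eq_symm_apply] at hq
  exact hq

theorem boxWedge_apply_of_pure (α : V [⋀^Fin k]→L[ℝ] ℝ) (β : W [⋀^Fin l]→L[ℝ] ℝ)
    (w : Fin (k + l) → V × W) (u : Fin k → V) (v : Fin l → W)
    (hu : ∀ i, w (Fin.castAdd l i) = (u i, 0)) (hv : ∀ j, w (Fin.natAdd k j) = (0, v j)) :
    boxWedge α β w = α u * β v := by
  have hs : altSum (tmul (α.compContinuousLinearMap (ContinuousLinearMap.fst ℝ V W))
      (β.compContinuousLinearMap (ContinuousLinearMap.snd ℝ V W))) w =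
      ∑ q : Equiv.Perm (Fin k) × Equiv.Perm (Fin l), α u * β v := by
    symm
    refine Finset.sum_of_injOn (fun q => blockPerm q.1 q.2) blockPerm_injective.injOn
      (fun _ _ => Finset.mem_coe.2 (Finset.mem_univ _)) (fun σ _ hσ => ?_) fun q _ => ?_
    · by_cases h : ∀ i : Fin k, ∃ j : Fin k, σ (Fin.castAdd l i) = Fin.castAdd l j
      · obtain ⟨q, hq⟩ := exists_blockPerm σ h
        exact absurd ⟨q, by simp, hq⟩ hσ
      · push Not at h
        obtain ⟨i, hi⟩ := h
        have h0 : (w (σ (Fin.castAdd l i))).1 = 0 := by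
          obtain ⟨j, hj⟩ : ∃ j : Fin l, σ (Fin.castAdd l i) = Fin.natAdd k j := by
            generalize hx : σ (Fin.castAdd l i) = x at hi
            induction x using Fin.addCases with
            | left j => exact absurd rfl (hi j)
            | right j => exact ⟨j, rfl⟩
          rw [hj, hv]
        simp only [tmul, ContinuousAlternatingMap.compContinuousLinearMap_apply]
        rw [α.map_coord_zero i h0]
        simp
    · have hu' : (⇑(ContinuousLinearMap.fst ℝ V W) ∘ w ∘ Fin.castAdd l) = u := by
        funext i; simp [hu]
      have hv' : (⇑(ContinuousLinearMap.snd ℝ V W) ∘ w ∘ Fin.natAdd k) = v := by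
        funext i; simp [hv]
      rw [tmul_comp_blockPerm, map_comp_perm, map_comp_perm, sign_blockPerm,
        ContinuousAlternatingMap.compContinuousLinearMap_apply,
        ContinuousAlternatingMap.compContinuousLinearMap_apply, hu', hv']
      push_cast
      linear_combination (-(α u * β v)) * (sign_mul_self_cast q.1) *
        (((Equiv.Perm.sign q.2 : ℤ) : ℝ) * ((Equiv.Perm.sign q.2 : ℤ) : ℝ))
        + (-(α u * β v)) * (sign_mul_self_cast q.2)
  rw [boxWedge, wedge_apply, hs, Finset.sum_const, Finset.card_univ, Fintype.card_prod,
    Fintype.card_perm, Fintype.card_perm, Fintype.card_fin, Fintype.card_fin, nsmul_eq_mul]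
  push_cast
  have h1 : (k.factorial : ℝ) ≠ 0 := by positivity
  have h2 : (l.factorial : ℝ) ≠ 0 := by positivity
  field_simp

/-- A `1`-form wedge a `2`-form vanishes on a triple with two arguments in the first factor. -/
theorem boxWedge_one_two_eq_zero (α : V [⋀^Fin 1]→L[ℝ] ℝ) (β : W [⋀^Fin 2]→L[ℝ] ℝ)
    (w : Fin 3 → V × W) (h0 : (w 0).2 = 0) (h1 : (w 1).2 = 0) : boxWedge α β w = 0 := by
  have key : ∀ σ : Equiv.Perm (Fin 3), ∃ j : Fin 2, σ (Fin.natAdd 1 j) = 0 ∨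
      σ (Fin.natAdd 1 j) = 1 := by decide
  rw [boxWedge, wedge_apply, altSum, Finset.sum_eq_zero, mul_zero]
  intro σ _
  obtain ⟨j, hj⟩ := key σ
  have h : (w (σ (Fin.natAdd 1 j))).2 = 0 := by rcases hj with hj | hj <;> rw [hj] <;> assumption
  simp only [tmul, ContinuousAlternatingMap.compContinuousLinearMap_apply]
  rw [β.map_coord_zero j h]
  simp

theorem boxWedge_eq_zero_left {α : V [⋀^Fin k]→L[ℝ] ℝ} {β : W [⋀^Fin l]→L[ℝ] ℝ}
    (h : boxWedge α β = 0) (hβ : β ≠ 0) : α = 0 := by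
  obtain ⟨v, hv⟩ : ∃ v, β v ≠ 0 := by
    by_contra hc
    push Not at hc
    exact hβ (by ext v; simpa using hc v)
  ext u
  have := boxWedge_apply_of_pure α β (Fin.append (fun i => (u i, 0)) fun j => (0, v j)) u v
    (by simp) (by simp)
  rw [h] at this
  simpa [hv] using this.symm

end Box

/-- A pseudo-orthonormal basis `b` of `g`: `g (b i, b j) = c i δ_{ij}` with `c i = ±1`. -/
structure IsFrame {V κ : Type*} [AddCommGroup V] [Module ℝ V] [TopologicalSpace V]
    [DecidableEq κ] (g : V →L[ℝ] V →L[ℝ] ℝ) (b : Module.Basis κ ℝ V) (c : κ → ℝ) : Prop where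
  apply_eq : ∀ i j, g (b i) (b j) = if i = j then c i else 0
  sq : ∀ i, c i * c i = 1

section Frame

variable {V κ : Type*} [AddCommGroup V] [Module ℝ V] [TopologicalSpace V] [Fintype κ]
  [DecidableEq κ] {g : V →L[ℝ] V →L[ℝ] ℝ} {b : Module.Basis κ ℝ V} {c : κ → ℝ} {k l m n : ℕ}

theorem IsFrame.repr_eq (hb : IsFrame g b c) (u : V) (i : κ) :
    b.repr u i = c i * g (b i) u := by
  conv_rhs => rw [← b.sum_repr u]
  simp only [map_sum, map_smul, hb.apply_eq, smul_eq_mul, mul_ite, mul_zero,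
    Finset.sum_ite_eq, Finset.mem_univ, if_true]
  linear_combination (-b.repr u i) * hb.sq i

theorem IsFrame.inner_eq_sum (hb : IsFrame g b c) (u v : V) :
    g u v = ∑ i, c i * (g u (b i) * g (b i) v) := by
  conv_lhs => rw [← b.sum_repr v]
  simp only [map_sum, map_smul, hb.repr_eq, smul_eq_mul]
  exact Finset.sum_congr rfl fun _ _ => by ring

theorem IsFrame.symm (hb : IsFrame g b c) (u v : V) : g u v = g v u := by
  rw [← b.sum_repr u, ← b.sum_repr v]
  simp only [map_sum, map_smul, hb.apply_eq, _root_.sum_apply,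
    _root_.smul_apply, smul_eq_mul, Finset.mul_sum]
  rw [Finset.sum_comm]
  refine Finset.sum_congr rfl fun i _ => Finset.sum_congr rfl fun j _ => ?_
  by_cases h : i = j
  · subst h; simp; ring
  · simp [h, Ne.symm h]

/-- The sum of `f` over all `k`-tuples of basis vectors, weighted with the signs of `g`. -/
noncomputable def frameSum (b : Module.Basis κ ℝ V) (c : κ → ℝ) (f : (Fin k → V) → ℝ) : ℝ :=
  ∑ i : Fin k → κ, (∏ a, c (i a)) * f (b ∘ i)

section FiniteDim

variable [FiniteDimensional ℝ V]

theorem IsFrame.gram_mul_eq_one (hb : IsFrame g b c) :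
    (Matrix.of fun i j => g (Module.finBasis ℝ V i) (Module.finBasis ℝ V j)) *
      ((Module.finBasis ℝ V).toMatrix b * Matrix.diagonal c *
        ((Module.finBasis ℝ V).toMatrix b).transpose) = 1 := by
  set e := Module.finBasis ℝ V
  set P := e.toMatrix b with hP
  have hG : (Matrix.of fun i j => g (e i) (e j)) * P = Matrix.of fun i j => g (e i) (b j) := by
    ext i j
    simp only [Matrix.mul_apply, Matrix.of_apply]
    conv_rhs => rw [← e.sum_repr (b j)]
    simp only [map_sum, map_smul, smul_eq_mul]
    exact Finset.sum_congr rfl fun _ _ => mul_comm _ _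
  have hR : (Matrix.of fun i j => g (e i) (b j)) * Matrix.diagonal c =
      (b.toMatrix e).transpose := by
    ext i j
    rw [Matrix.mul_diagonal, Matrix.transpose_apply, Matrix.of_apply, Module.Basis.toMatrix_apply,
      hb.repr_eq, hb.symm (e i), mul_comm]
  rw [← Matrix.mul_assoc, ← Matrix.mul_assoc, hG, hR, ← Matrix.transpose_mul,
    Module.Basis.toMatrix_mul_toMatrix_flip, Matrix.transpose_one]

theorem IsFrame.gramInv_eq (hb : IsFrame g b c)
    (m n : Fin (Module.finrank ℝ V)) :
    gramInv g m n = ∑ i, (Module.finBasis ℝ V).toMatrix b m i * c i *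
      (Module.finBasis ℝ V).toMatrix b n i := by
  have h : gramInv g = (Module.finBasis ℝ V).toMatrix b * Matrix.diagonal c *
        ((Module.finBasis ℝ V).toMatrix b).transpose := Matrix.inv_eq_right_inv hb.gram_mul_eq_one
  rw [h, Matrix.mul_apply]
  simp only [Matrix.mul_diagonal, Matrix.transpose_apply]

theorem IsFrame.sum_gramInv (hb : IsFrame g b c)
    (A B : MultilinearMap ℝ (fun _ : Fin k => V) ℝ) :
    ∑ i : Fin k → Fin (Module.finrank ℝ V), ∑ j : Fin k → Fin (Module.finrank ℝ V),
      A (fun a => Module.finBasis ℝ V (i a)) * B (fun a => Module.finBasis ℝ V (j a)) *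
        ∏ a, gramInv g (i a) (j a) = frameSum b c fun w => A w * B w := by
  set e := Module.finBasis ℝ V
  set P := e.toMatrix b with hP
  have hexp : ∀ (A : MultilinearMap ℝ (fun _ : Fin k => V) ℝ) (i : Fin k → κ),
      A (b ∘ i) = ∑ r : Fin k → Fin (Module.finrank ℝ V),
        (∏ a, P (r a) (i a)) * A (fun a => e (r a)) := by
    intro A i
    have : b ∘ i = fun a => ∑ r, P r (i a) • e r := by
      funext a
      exact (e.sum_repr (b (i a))).symm
    rw [this, MultilinearMap.map_sum]
    exact Finset.sum_congr rfl fun r _ => by rw [MultilinearMap.map_smul_univ, smul_eq_mul]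
  have hprod : ∀ r s : Fin k → Fin (Module.finrank ℝ V), ∏ a, gramInv g (r a) (s a) =
      ∑ i : Fin k → κ, (∏ a, c (i a)) * ((∏ a, P (r a) (i a)) * ∏ a, P (s a) (i a)) := by
    intro r s
    simp only [hb.gramInv_eq]
    rw [Finset.prod_univ_sum, Fintype.piFinset_univ]
    refine Finset.sum_congr rfl fun i _ => ?_
    rw [← Finset.prod_mul_distrib, ← Finset.prod_mul_distrib]
    exact Finset.prod_congr rfl fun _ _ => by ring
  simp only [frameSum, hprod, hexp]
  simp only [Finset.mul_sum, Finset.sum_mul]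
  rw [Finset.sum_comm_cycle]
  refine Finset.sum_congr rfl fun i _ => ?_
  rw [Finset.sum_comm]
  exact Finset.sum_congr rfl fun r _ => Finset.sum_congr rfl fun s _ => by ring

theorem IsFrame.formInner_eq (hb : IsFrame g b c) (η φ : V [⋀^Fin k]→L[ℝ] ℝ) :
    formInner g η φ = (k.factorial : ℝ)⁻¹ * frameSum b c fun w => η w * φ w := by
  rw [formInner]
  congr 1
  exact hb.sum_gramInv η.toMultilinearMap φ.toMultilinearMap

/-- `w ↦ η (w, v)` as a multilinear map. -/
noncomputable def contractLast (η : V [⋀^Fin (k + m)]→L[ℝ] ℝ) (v : Fin m → V) :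
    MultilinearMap ℝ (fun _ : Fin k => V) ℝ where
  toFun w := (η.toMultilinearMap.domDomCongr finSumFinEquiv.symm).currySum w v
  map_update_add' w i x y := by
    rw [MultilinearMap.map_update_add]; rfl
  map_update_smul' w i x y := by
    rw [MultilinearMap.map_update_smul]; rfl

omit [FiniteDimensional ℝ V] in
theorem contractLast_apply (η : V [⋀^Fin (k + m)]→L[ℝ] ℝ) (v : Fin m → V) (w : Fin k → V) :
    contractLast η v w = η (Fin.append w v) := by
  change η _ = η _
  congr 1
  funext i
  refine Fin.addCases (fun j => ?_) (fun j => ?_) i <;> simp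

theorem IsFrame.hodge_apply (hb : IsFrame g b c) (vol : V [⋀^Fin (k + m)]→L[ℝ] ℝ)
    (β : V [⋀^Fin k]→L[ℝ] ℝ) (v : Fin m → V) :
    hodge g vol β v =
      (k.factorial : ℝ)⁻¹ * frameSum b c fun w => β w * vol (Fin.append w v) := by
  have h := hb.sum_gramInv β.toMultilinearMap (contractLast vol v)
  simp only [contractLast_apply] at h
  rw [hodge, ContinuousAlternatingMap.smul_apply, smul_eq_mul, ContinuousAlternatingMap.sum_apply]
  congr 1
  refine Eq.trans ?_ h
  refine Finset.sum_congr rfl fun i _ => ?_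
  rw [ContinuousAlternatingMap.sum_apply]
  refine Finset.sum_congr rfl fun j _ => ?_
  rw [ContinuousAlternatingMap.smul_apply, smul_eq_mul, mul_right_comm]
  rfl

theorem IsFrame.hodge_eq (hb : IsFrame g b c) (vol : V [⋀^Fin (k + m)]→L[ℝ] ℝ)
    (β : V [⋀^Fin k]→L[ℝ] ℝ) :
    hodge g vol β = ∑ i : Fin k → κ,
      ((k.factorial : ℝ)⁻¹ * ((∏ a, c (i a)) * β (b ∘ i))) • contractFirst (b ∘ i) vol := by
  ext v
  rw [hb.hodge_apply, frameSum, ContinuousAlternatingMap.sum_apply, Finset.mul_sum]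
  refine Finset.sum_congr rfl fun i _ => ?_
  rw [ContinuousAlternatingMap.smul_apply, smul_eq_mul, mul_assoc, mul_assoc]
  rfl

end FiniteDim

omit [TopologicalSpace V] [DecidableEq κ] in
theorem frameSum_comp_perm (f : (Fin k → V) → ℝ) (σ : Equiv.Perm (Fin k)) :
    (frameSum b c fun w => f (w ∘ σ)) = frameSum b c f := by
  refine Fintype.sum_equiv (Equiv.arrowCongr σ.symm (Equiv.refl κ)) _ _ fun i => ?_
  have : (Equiv.arrowCongr σ.symm (Equiv.refl κ)) i = i ∘ σ := by
    funext a; simp [Equiv.arrowCongr]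
  rw [this]
  congr 1
  exact (Equiv.prod_comp σ fun a => c (i a)).symm

omit [TopologicalSpace V] [DecidableEq κ] in
theorem frameSum_sum {ι : Type*} (s : Finset ι) (f : ι → (Fin k → V) → ℝ) :
    (frameSum b c fun w => ∑ i ∈ s, f i w) = ∑ i ∈ s, frameSum b c (f i) := by
  simp only [frameSum, Finset.mul_sum]
  exact Finset.sum_comm

omit [TopologicalSpace V] [DecidableEq κ] in
theorem frameSum_const_mul (r : ℝ) (f : (Fin k → V) → ℝ) :
    (frameSum b c fun w => r * f w) = r * frameSum b c f := by
  simp only [frameSum, Finset.mul_sum]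
  exact Finset.sum_congr rfl fun i _ => by ring

omit [TopologicalSpace V] [DecidableEq κ] in
theorem frameSum_mul_altSum (η m : (Fin k → V) → ℝ)
    (hη : ∀ (v : Fin k → V) (σ : Equiv.Perm (Fin k)), η (v ∘ σ) = (Equiv.Perm.sign σ : ℤ) * η v) :
    (frameSum b c fun w => η w * altSum m w) =
      k.factorial * frameSum b c fun w => η w * m w := by
  have h : ∀ w, η w * altSum m w = ∑ σ : Equiv.Perm (Fin k),
      (fun w => η w * m w) (w ∘ σ) := by
    intro w
    rw [altSum, Finset.mul_sum]
    exact Finset.sum_congr rfl fun σ _ => by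
      change _ = η (w ∘ σ) * m (w ∘ σ)
      rw [hη]; ring
  rw [funext h, frameSum_sum]
  refine (Finset.sum_congr rfl fun σ _ => frameSum_comp_perm (fun w => η w * m w) σ).trans ?_
  rw [Finset.sum_const, Finset.card_univ, Fintype.card_perm, Fintype.card_fin, nsmul_eq_mul]

end Frame

section ProductFrame

variable {V W κ κ' : Type*} [AddCommGroup V] [Module ℝ V] [TopologicalSpace V]
  [AddCommGroup W] [Module ℝ W] [TopologicalSpace W] [Fintype κ] [DecidableEq κ]
  [Fintype κ'] [DecidableEq κ'] {g : V →L[ℝ] V →L[ℝ] ℝ} {g' : W →L[ℝ] W →L[ℝ] ℝ}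
  {h : (V × W) →L[ℝ] (V × W) →L[ℝ] ℝ}
  {b : Module.Basis κ ℝ V} {c : κ → ℝ} {b' : Module.Basis κ' ℝ W} {c' : κ' → ℝ} {k l m n : ℕ}

omit [Fintype κ] [Fintype κ'] in
theorem IsFrame.prod (hb : IsFrame g b c) (hb' : IsFrame g' b' c')
    (hh : ∀ u v, h u v = g u.1 v.1 + g' u.2 v.2) :
    IsFrame h (b.prod b') (Sum.elim c c') where
  apply_eq i j := by
    rw [hh]
    rcases i with i | i <;> rcases j with j | j <;> simp [hb.apply_eq, hb'.apply_eq]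
  sq i := by rcases i with i | i <;> simp [hb.sq, hb'.sq]

omit [TopologicalSpace V] [TopologicalSpace W] [DecidableEq κ] [DecidableEq κ'] in
theorem frameSum_prod (f : (Fin (k + l) → V × W) → ℝ)
    (h1 : ∀ w a, (w (Fin.castAdd l a)).1 = 0 → f w = 0)
    (h2 : ∀ w a, (w (Fin.natAdd k a)).2 = 0 → f w = 0) :
    frameSum (b.prod b') (Sum.elim c c') f =
      frameSum b c fun u => frameSum b' c' fun v =>
        f (Fin.append (fun a => (u a, 0)) fun a => (0, v a)) := by
  simp only [frameSum, Finset.mul_sum]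
  rw [← Fintype.sum_prod_type']
  symm
  refine Finset.sum_of_injOn
    (fun q : (Fin k → κ) × (Fin l → κ') => Fin.append (Sum.inl ∘ q.1) (Sum.inr ∘ q.2))
    ?_ (fun _ _ => Finset.mem_coe.2 (Finset.mem_univ _)) (fun i _ hi => ?_) fun q _ => ?_
  · rintro ⟨i, j⟩ _ ⟨i', j'⟩ _ hij
    refine Prod.ext ?_ ?_
    · funext a
      simpa using congrFun hij (Fin.castAdd l a)
    · funext a
      simpa using congrFun hij (Fin.natAdd k a)
  · by_cases hl : ∃ a x, i (Fin.castAdd l a) = Sum.inr x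
    · obtain ⟨a, x, hx⟩ := hl
      rw [h1 _ a (by simp [hx]), mul_zero]
    by_cases hr : ∃ a x, i (Fin.natAdd k a) = Sum.inl x
    · obtain ⟨a, x, hx⟩ := hr
      rw [h2 _ a (by simp [hx]), mul_zero]
    refine absurd ?_ hi
    have hl' : ∀ a, ∃ x, i (Fin.castAdd l a) = Sum.inl x := fun a => by
      rcases hx : i (Fin.castAdd l a) with x | x
      · exact ⟨x, rfl⟩
      · exact absurd ⟨a, x, hx⟩ hl
    have hr' : ∀ a, ∃ x, i (Fin.natAdd k a) = Sum.inr x := fun a => by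
      rcases hx : i (Fin.natAdd k a) with x | x
      · exact absurd ⟨a, x, hx⟩ hr
      · exact ⟨x, rfl⟩
    choose p hp using hl'
    choose q hq using hr'
    refine ⟨(p, q), by simp, ?_⟩
    funext a
    refine Fin.addCases (fun a => ?_) (fun a => ?_) a <;> simp [hp, hq]
  · rw [Fin.prod_univ_add, ← mul_assoc]
    simp only [Fin.append_left, Fin.append_right, Function.comp_apply, Sum.elim_inl, Sum.elim_inr]
    congr 2
    funext a
    refine Fin.addCases (fun a => ?_) (fun a => ?_) a <;> simp

theorem tmul_fst_snd_eq_zero (α : V [⋀^Fin k]→L[ℝ] ℝ) (β : W [⋀^Fin l]→L[ℝ] ℝ)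
    (w : Fin (k + l) → V × W)
    (hw : (∃ a, (w (Fin.castAdd l a)).1 = 0) ∨ ∃ a, (w (Fin.natAdd k a)).2 = 0) :
    tmul (α.compContinuousLinearMap (ContinuousLinearMap.fst ℝ V W))
      (β.compContinuousLinearMap (ContinuousLinearMap.snd ℝ V W)) w = 0 := by
  simp only [tmul, ContinuousAlternatingMap.compContinuousLinearMap_apply]
  rcases hw with ⟨a, ha⟩ | ⟨a, ha⟩
  · rw [α.map_coord_zero a ha, zero_mul]
  · rw [β.map_coord_zero a ha, mul_zero]

theorem tmul_fst_snd_append (α : V [⋀^Fin k]→L[ℝ] ℝ) (β : W [⋀^Fin l]→L[ℝ] ℝ)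
    (u : Fin k → V) (v : Fin l → W) :
    tmul (α.compContinuousLinearMap (ContinuousLinearMap.fst ℝ V W))
      (β.compContinuousLinearMap (ContinuousLinearMap.snd ℝ V W))
      (Fin.append (fun a => (u a, 0)) fun a => (0, v a)) = α u * β v := by
  simp only [tmul, ContinuousAlternatingMap.compContinuousLinearMap_apply]
  congr 2 <;> funext a <;> simp

omit [DecidableEq κ] [DecidableEq κ'] in
/-- Contraction of a function alternating in `k + l` arguments with a product form. -/
theorem frameSum_mul_boxWedge (η : (Fin (k + l) → V × W) → ℝ)
    (hη : ∀ (v : Fin (k + l) → V × W) (σ : Equiv.Perm (Fin (k + l))),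
      η (v ∘ σ) = (Equiv.Perm.sign σ : ℤ) * η v)
    (α : V [⋀^Fin k]→L[ℝ] ℝ) (β : W [⋀^Fin l]→L[ℝ] ℝ) :
    (frameSum (b.prod b') (Sum.elim c c') fun w => η w * boxWedge α β w) =
      (k + l).factorial * (((k.factorial : ℝ) * l.factorial)⁻¹ *
        frameSum b c fun u => frameSum b' c' fun v =>
          η (Fin.append (fun a => (u a, 0)) fun a => (0, v a)) * (α u * β v)) := by
  have e : (fun w => η w * boxWedge α β w) = fun w => ((k.factorial : ℝ) * l.factorial)⁻¹ *
      (η w * altSum (tmul (α.compContinuousLinearMap (ContinuousLinearMap.fst ℝ V W))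
        (β.compContinuousLinearMap (ContinuousLinearMap.snd ℝ V W))) w) := by
    funext w
    rw [boxWedge, wedge_apply, mul_left_comm]
  rw [e, frameSum_const_mul, frameSum_mul_altSum _ _ hη, frameSum_prod]
  · simp only [tmul_fst_snd_append]
    rw [mul_left_comm]
  · intro w a ha
    rw [tmul_fst_snd_eq_zero _ _ _ (Or.inl ⟨a, ha⟩), mul_zero]
  · intro w a ha
    rw [tmul_fst_snd_eq_zero _ _ _ (Or.inr ⟨a, ha⟩), mul_zero]

variable [FiniteDimensional ℝ V] [FiniteDimensional ℝ W]

theorem formInner_boxWedge (hb : IsFrame g b c) (hb' : IsFrame g' b' c')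
    (hh : ∀ u v, h u v = g u.1 v.1 + g' u.2 v.2) (α α' : V [⋀^Fin k]→L[ℝ] ℝ)
    (β β' : W [⋀^Fin l]→L[ℝ] ℝ) :
    formInner h (boxWedge α β) (boxWedge α' β') = formInner g α α' * formInner g' β β' := by
  rw [(hb.prod hb' hh).formInner_eq, frameSum_mul_boxWedge _ (map_comp_perm _), hb.formInner_eq,
    hb'.formInner_eq]
  have e : ∀ u v, boxWedge α β (Fin.append (fun a => (u a, 0)) fun a => (0, v a)) = α u * β v :=
    fun u v => boxWedge_apply_of_pure α β _ u v (by simp) (by simp)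
  have e2 : ∀ u, (frameSum b' c' fun v => α u * β v * (α' u * β' v)) =
      (frameSum b' c' fun v => β v * β' v) * (α u * α' u) := by
    intro u
    rw [mul_comm, ← frameSum_const_mul]
    congr 1; funext v; ring
  simp only [e, e2]
  rw [frameSum_const_mul]
  have h1 : ((k + l).factorial : ℝ) ≠ 0 := by positivity
  field_simp

theorem formInner_boxWedge_one_two (hb : IsFrame g b c) (hb' : IsFrame g' b' c')
    (hh : ∀ u v, h u v = g u.1 v.1 + g' u.2 v.2) (α : V [⋀^Fin 1]→L[ℝ] ℝ)
    (α' : V [⋀^Fin 2]→L[ℝ] ℝ) (β : W [⋀^Fin 2]→L[ℝ] ℝ) (β' : W [⋀^Fin 1]→L[ℝ] ℝ) :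
    formInner h (k := 3) (boxWedge α β) (boxWedge α' β') = 0 := by
  rw [(hb.prod hb' hh).formInner_eq, frameSum_mul_boxWedge (k := 2) (l := 1) _
    (map_comp_perm (n := 3) _)]
  have e : ∀ (u : Fin 2 → V) (v : Fin 1 → W), boxWedge α β (Fin.append (m := 2) (n := 1) (fun a => (u a, 0))
      fun a => (0, v a)) = 0 :=
    fun u v => boxWedge_one_two_eq_zero α β _ rfl rfl
  have e' : (frameSum b c fun u => frameSum b' c' fun v => boxWedge α β
      (Fin.append (m := 2) (n := 1) (fun a => (u a, 0)) fun a => (0, v a)) * (α' u * β' v)) = 0 := by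
    simp only [e, zero_mul]
    simp [frameSum]
  refine (congrArg _ (congrArg _ (congrArg _ e'))).trans ?_
  simp

omit [FiniteDimensional ℝ V] [FiniteDimensional ℝ W] in
theorem interiorProd_boxWedge_two_two (γ : V [⋀^Fin 2]→L[ℝ] ℝ) (δ : W [⋀^Fin 2]→L[ℝ] ℝ)
    (u : V × W) :
    interiorProd (k := 3) u (boxWedge (k := 2) (l := 2) γ δ) =
      boxWedge (k := 1) (l := 2) (interiorProd (k := 1) u.1 γ) δ + boxWedge (k := 2) (l := 1) γ (interiorProd (k := 1) u.2 δ) := by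
  ext v
  have := boxWedge_cons (k := 1) (l := 1) γ δ u v
  rw [interiorProd_cons, ContinuousAlternatingMap.add_apply]
  refine this.trans ?_
  norm_num

theorem IsFrame.formInner_add_left (hb : IsFrame g b c) (η η' φ : V [⋀^Fin k]→L[ℝ] ℝ) :
    formInner g (η + η') φ = formInner g η φ + formInner g η' φ := by
  simp only [hb.formInner_eq, ContinuousAlternatingMap.add_apply, frameSum, add_mul, mul_add,
    Finset.sum_add_distrib]

theorem IsFrame.formInner_add_right (hb : IsFrame g b c) (η φ φ' : V [⋀^Fin k]→L[ℝ] ℝ) :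
    formInner g η (φ + φ') = formInner g η φ + formInner g η φ' := by
  simp only [hb.formInner_eq, ContinuousAlternatingMap.add_apply, frameSum, mul_add,
    Finset.sum_add_distrib]

theorem IsFrame.formInner_add_add (hb : IsFrame g b c) (η η' φ φ' : V [⋀^Fin k]→L[ℝ] ℝ) :
    formInner g (η + η') (φ + φ') = formInner g η φ + formInner g η φ' +
      (formInner g η' φ + formInner g η' φ') := by
  rw [hb.formInner_add_left, hb.formInner_add_right, hb.formInner_add_right]

theorem IsFrame.formInner_comm (hb : IsFrame g b c) (η φ : V [⋀^Fin k]→L[ℝ] ℝ) :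
    formInner g η φ = formInner g φ η := by
  simp only [hb.formInner_eq, mul_comm (η _)]

theorem formInner_interiorProd_boxWedge (hb : IsFrame g b c) (hb' : IsFrame g' b' c')
    (hh : ∀ u v, h u v = g u.1 v.1 + g' u.2 v.2)
    (γ : V [⋀^Fin 2]→L[ℝ] ℝ) (δ : W [⋀^Fin 2]→L[ℝ] ℝ) (u v : V × W) :
    formInner h (interiorProd (k := 3) u (boxWedge (k := 2) (l := 2) γ δ))
        (interiorProd (k := 3) v (boxWedge (k := 2) (l := 2) γ δ)) =
      formInner g (interiorProd (k := 1) u.1 γ) (interiorProd (k := 1) v.1 γ) *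
          formInner g' δ δ +
        formInner g γ γ *
          formInner g' (interiorProd (k := 1) u.2 δ) (interiorProd (k := 1) v.2 δ) := by
  have hp := hb.prod hb' hh
  have e1 := formInner_boxWedge_one_two hb hb' hh (interiorProd (k := 1) u.1 γ) γ δ
    (interiorProd (k := 1) v.2 δ)
  have e2 := formInner_boxWedge_one_two hb hb' hh (interiorProd (k := 1) v.1 γ) γ δ
    (interiorProd (k := 1) u.2 δ)
  have e3 := formInner_boxWedge hb hb' hh (interiorProd (k := 1) u.1 γ)
    (interiorProd (k := 1) v.1 γ) δ δ
  have e4 := formInner_boxWedge hb hb' hh γ γ (interiorProd (k := 1) u.2 δ)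
    (interiorProd (k := 1) v.2 δ)
  rw [hp.formInner_comm] at e2
  rw [interiorProd_boxWedge_two_two, interiorProd_boxWedge_two_two]
  refine (hp.formInner_add_add (k := 3) _ _ _ _).trans ?_
  linarith [e1, e2, e3, e4]

end ProductFrame

section HodgeProduct

variable {V W κ κ' : Type*} [AddCommGroup V] [Module ℝ V] [TopologicalSpace V]
  [AddCommGroup W] [Module ℝ W] [TopologicalSpace W] [Fintype κ] [DecidableEq κ]
  [Fintype κ'] [DecidableEq κ'] {g : V →L[ℝ] V →L[ℝ] ℝ} {g' : W →L[ℝ] W →L[ℝ] ℝ}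
  {h : (V × W) →L[ℝ] (V × W) →L[ℝ] ℝ}
  {b : Module.Basis κ ℝ V} {c : κ → ℝ} {b' : Module.Basis κ' ℝ W} {c' : κ' → ℝ} {k l m n : ℕ}

theorem boxWedge_add_left (α α' : V [⋀^Fin k]→L[ℝ] ℝ) (β : W [⋀^Fin l]→L[ℝ] ℝ) :
    boxWedge (α + α') β = boxWedge α β + boxWedge α' β := by
  have h : (α + α').compContinuousLinearMap (ContinuousLinearMap.fst ℝ V W) =
      α.compContinuousLinearMap (ContinuousLinearMap.fst ℝ V W) +
        α'.compContinuousLinearMap (ContinuousLinearMap.fst ℝ V W) := by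
    ext v; rfl
  rw [boxWedge, h, wedge_add_left, boxWedge, boxWedge]

theorem boxWedge_add_right (α : V [⋀^Fin k]→L[ℝ] ℝ) (β β' : W [⋀^Fin l]→L[ℝ] ℝ) :
    boxWedge α (β + β') = boxWedge α β + boxWedge α β' := by
  have h : (β + β').compContinuousLinearMap (ContinuousLinearMap.snd ℝ V W) =
      β.compContinuousLinearMap (ContinuousLinearMap.snd ℝ V W) +
        β'.compContinuousLinearMap (ContinuousLinearMap.snd ℝ V W) := by
    ext v; rfl
  rw [boxWedge, h, wedge_add_right, boxWedge, boxWedge]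

theorem boxWedge_smul_left (r : ℝ) (α : V [⋀^Fin k]→L[ℝ] ℝ) (β : W [⋀^Fin l]→L[ℝ] ℝ) :
    boxWedge (r • α) β = r • boxWedge α β := by
  have h : (r • α).compContinuousLinearMap (ContinuousLinearMap.fst ℝ V W) =
      r • α.compContinuousLinearMap (ContinuousLinearMap.fst ℝ V W) := by
    ext v; rfl
  rw [boxWedge, h, wedge_smul_left, boxWedge]

theorem boxWedge_smul_right (r : ℝ) (α : V [⋀^Fin k]→L[ℝ] ℝ) (β : W [⋀^Fin l]→L[ℝ] ℝ) :
    boxWedge α (r • β) = r • boxWedge α β := by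
  have h : (r • β).compContinuousLinearMap (ContinuousLinearMap.snd ℝ V W) =
      r • β.compContinuousLinearMap (ContinuousLinearMap.snd ℝ V W) := by
    ext v; rfl
  rw [boxWedge, h, wedge_smul_right, boxWedge]

theorem boxWedge_sum_smul {ι ι' : Type*} (s : Finset ι) (t : Finset ι') (x : ι → ℝ) (y : ι' → ℝ)
    (α : ι → V [⋀^Fin k]→L[ℝ] ℝ) (β : ι' → W [⋀^Fin l]→L[ℝ] ℝ) :
    boxWedge (∑ i ∈ s, x i • α i) (∑ j ∈ t, y j • β j) =
      ∑ i ∈ s, ∑ j ∈ t, (x i * y j) • boxWedge (α i) (β j) := by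
  classical
  induction s using Finset.induction_on with
  | empty => simp [boxWedge_zero_left]
  | insert i s hi ih =>
    rw [Finset.sum_insert hi, Finset.sum_insert hi, boxWedge_add_left, ih]
    congr 1
    clear ih
    induction t using Finset.induction_on with
    | empty => simp [boxWedge_zero_right]
    | insert j t hj ih =>
      rw [Finset.sum_insert hj, Finset.sum_insert hj, boxWedge_add_right, ih, boxWedge_smul_left,
        boxWedge_smul_right, smul_smul]

theorem boxWedge_cons_left (α : V [⋀^Fin (k + 1)]→L[ℝ] ℝ) (β : W [⋀^Fin (l + 1)]→L[ℝ] ℝ)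
    (y : V) (z : Fin (k + 1 + l) → V × W) (z' : Fin (k + (l + 1)) → V × W)
    (hz : ∀ i : Fin (k + (l + 1)), z' i = z (Fin.cast (by omega) i)) :
    boxWedge α β (Fin.cons ((y, 0) : V × W) z : Fin (k + 1 + l + 1) → V × W) =
      boxWedge (interiorProd y α) β z' := by
  obtain rfl : z' = z ∘ Fin.cast (show k + (l + 1) = k + 1 + l by omega) := funext hz
  rw [boxWedge_cons]
  simp [interiorProd_zero, boxWedge_zero_right]

theorem boxWedge_cons_right (α : V [⋀^Fin (k + 1)]→L[ℝ] ℝ) (β : W [⋀^Fin (l + 1)]→L[ℝ] ℝ)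
    (y : W) (z : Fin (k + 1 + l) → V × W) :
    boxWedge α β (Fin.cons ((0, y) : V × W) z : Fin (k + 1 + l + 1) → V × W) =
      (-1) ^ (k + 1) * boxWedge α (interiorProd y β) z := by
  rw [boxWedge_cons]
  simp [interiorProd_zero, boxWedge_zero_left]

/-- Contraction of a product volume form, for any product of forms satisfying the same rules for
the interior product as the wedge product. -/
theorem contract_product_append
    (B : ∀ k l : ℕ, V [⋀^Fin k]→L[ℝ] ℝ → W [⋀^Fin l]→L[ℝ] ℝ → (V × W) [⋀^Fin (k + l)]→L[ℝ] ℝ)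
    (hl : ∀ (k l : ℕ) (α : V [⋀^Fin (k + 1)]→L[ℝ] ℝ) (β : W [⋀^Fin (l + 1)]→L[ℝ] ℝ)
      (y : V) (z : Fin (k + 1 + l) → V × W) (z' : Fin (k + (l + 1)) → V × W),
      (∀ i : Fin (k + (l + 1)), z' i = z (Fin.cast (by omega) i)) →
      B (k + 1) (l + 1) α β (Fin.cons ((y, 0) : V × W) z : Fin (k + 1 + l + 1) → V × W) =
        B k (l + 1) (interiorProd y α) β z')
    (hr : ∀ (k l : ℕ) (α : V [⋀^Fin (k + 1)]→L[ℝ] ℝ) (β : W [⋀^Fin (l + 1)]→L[ℝ] ℝ)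
      (y : W) (z : Fin (k + 1 + l) → V × W),
      B (k + 1) (l + 1) α β (Fin.cons ((0, y) : V × W) z : Fin (k + 1 + l + 1) → V × W) =
        (-1) ^ (k + 1) * B (k + 1) l α (interiorProd y β) z)
    (volV : V [⋀^Fin 5]→L[ℝ] ℝ) (volW : W [⋀^Fin 6]→L[ℝ] ℝ)
    (u : Fin 2 → V) (v : Fin 2 → W) (x : Fin 7 → V × W) :
    B 5 6 volV volW (Fin.append (m := 4) (n := 7)
      (Fin.append (fun a => (u a, 0)) fun a => (0, v a)) x) =
      B 3 4 (contractFirst (m := 3) u volV) (contractFirst (m := 4) v volW) x := by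
  have h1 : contractFirst (m := 3) u volV =
      interiorProd (u 1) (interiorProd (k := 4) (u 0) volV) := by
    ext z
    change volV _ = volV _
    congr 1
    funext i; fin_cases i <;> rfl
  have h2 : contractFirst (m := 4) v volW =
      interiorProd (v 1) (interiorProd (k := 5) (v 0) volW) := by
    ext z
    change volW _ = volW _
    congr 1
    funext i; fin_cases i <;> rfl
  have hx : (Fin.append (m := 4) (n := 7)
      (Fin.append (fun a => (u a, 0)) fun a => (0, v a)) x : Fin 11 → V × W) =
      Fin.cons (u 0, 0) (Fin.cons (u 1, 0) (Fin.cons (0, v 0) (Fin.cons (0, v 1) x))) := by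
    funext i; fin_cases i <;> rfl
  rw [h1, h2]
  refine (congrArg _ hx).trans ?_
  refine (hl 4 5 volV volW (u 0) _ (Fin.cons (u 1, 0) (Fin.cons (0, v 0) (Fin.cons (0, v 1) x)))
    fun i => rfl).trans ?_
  refine (hl 3 5 _ volW (u 1) _ (Fin.cons (0, v 0) (Fin.cons (0, v 1) x)) fun i => rfl).trans ?_
  refine (hr 2 5 _ volW (v 0) (Fin.cons (0, v 1) x)).trans ?_
  have h3 := hr 2 4 (interiorProd (u 1) (interiorProd (k := 4) (u 0) volV))
    (interiorProd (k := 5) (v 0) volW) (v 1) x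
  refine (congrArg _ h3).trans ?_
  norm_num

theorem boxWedge_sum_smul_apply {ι ι' : Type*} (s : Finset ι) (t : Finset ι') (x : ι → ℝ)
    (y : ι' → ℝ) (α : ι → V [⋀^Fin k]→L[ℝ] ℝ) (β : ι' → W [⋀^Fin l]→L[ℝ] ℝ)
    (v : Fin (k + l) → V × W) :
    boxWedge (∑ i ∈ s, x i • α i) (∑ j ∈ t, y j • β j) v =
      ∑ i ∈ s, ∑ j ∈ t, (x i * y j) * boxWedge (α i) (β j) v := by
  rw [boxWedge_sum_smul]
  simp only [ContinuousAlternatingMap.sum_apply, ContinuousAlternatingMap.smul_apply, smul_eq_mul]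

theorem boxWedge_append (volV : V [⋀^Fin 5]→L[ℝ] ℝ) (volW : W [⋀^Fin 6]→L[ℝ] ℝ)
    (u : Fin 2 → V) (v : Fin 2 → W) (x : Fin 7 → V × W) :
    boxWedge volV volW (Fin.append (m := 4) (n := 7)
      (Fin.append (fun a => (u a, 0)) fun a => (0, v a)) x) =
      boxWedge (k := 3) (l := 4) (contractFirst (m := 3) u volV) (contractFirst (m := 4) v volW)
        x :=
  contract_product_append (fun _ _ => boxWedge) (fun _ _ => boxWedge_cons_left)
    (fun _ _ => boxWedge_cons_right) volV volW u v x

variable [FiniteDimensional ℝ V] [FiniteDimensional ℝ W]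

theorem hodge_eq_sum_of_contract (hb : IsFrame g b c) (hb' : IsFrame g' b' c')
    (hh : ∀ u v, h u v = g u.1 v.1 + g' u.2 v.2) (vol : (V × W) [⋀^Fin (4 + 7)]→L[ℝ] ℝ)
    (F : (V × W) [⋀^Fin 4]→L[ℝ] ℝ) (γ : V [⋀^Fin 2]→L[ℝ] ℝ) (δ : W [⋀^Fin 2]→L[ℝ] ℝ)
    (A : (Fin 2 → V) → (Fin 2 → W) → (Fin 7 → V × W) → ℝ)
    (hvol : ∀ u v x, vol (Fin.append (m := 4) (n := 7)
      (Fin.append (m := 2) (n := 2) (fun a => (u a, 0)) fun a => (0, v a)) x) = A u v x)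
    (hF : ∀ η : (Fin 4 → V × W) → ℝ, (∀ (v : Fin 4 → V × W) (σ : Equiv.Perm (Fin 4)),
        η (v ∘ σ) = (Equiv.Perm.sign σ : ℤ) * η v) →
      (frameSum (b.prod b') (Sum.elim c c') fun w => η w * F w) =
        (Nat.factorial 4 : ℕ) * (((Nat.factorial 2 : ℕ) * (Nat.factorial 2 : ℕ) : ℝ)⁻¹ *
          frameSum b c fun u => frameSum b' c' fun v =>
            η (Fin.append (m := 2) (n := 2) (fun a => (u a, 0)) fun a => (0, v a)) *
              (γ u * δ v))) (x : Fin 7 → V × W) :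
    hodge h vol F x = ∑ i : Fin 2 → κ, ∑ j : Fin 2 → κ',
      ((((Nat.factorial 2 : ℕ) : ℝ)⁻¹ * ((∏ a, c (i a)) * γ (b ∘ i))) *
        (((Nat.factorial 2 : ℕ) : ℝ)⁻¹ * ((∏ a, c' (j a)) * δ (b' ∘ j)))) *
        A (b ∘ i) (b' ∘ j) x := by
  rw [(hb.prod hb' hh).hodge_apply]
  have hη : ∀ (v : Fin 4 → V × W) (σ : Equiv.Perm (Fin 4)),
      vol (Fin.append (v ∘ σ) x) = (Equiv.Perm.sign σ : ℤ) * vol (Fin.append v x) := by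
    intro v σ
    have h1 := map_comp_perm vol (Fin.append v x) (blockPerm σ 1)
    rw [sign_blockPerm, map_one, mul_one] at h1
    rw [← h1]
    congr 1
    funext i
    refine Fin.addCases (fun j => ?_) (fun j => ?_) i
    · have := congrFun (blockPerm_comp_castAdd (l := 7) σ 1) j
      simp only [Function.comp_apply] at this ⊢
      rw [this, Fin.append_left, Fin.append_left]
      rfl
    · have := congrFun (blockPerm_comp_natAdd (l := 7) σ 1) j
      simp only [Function.comp_apply] at this ⊢
      rw [this, Fin.append_right, Fin.append_right]
      rfl
  have h2 := hF (fun w => vol (Fin.append w x)) hη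
  simp only [hvol] at h2
  simp only [mul_comm (F _)]
  rw [h2]
  simp only [frameSum, Finset.mul_sum]
  refine Finset.sum_congr rfl fun i _ => Finset.sum_congr rfl fun j _ => ?_
  have h4 : ((Nat.factorial 4 : ℕ) : ℝ)⁻¹ * (Nat.factorial 4 : ℕ) = 1 :=
    inv_mul_cancel₀ (by positivity)
  rw [mul_inv]
  linear_combination (((Nat.factorial 2 : ℕ) : ℝ)⁻¹ * ((∏ a, c (i a)) * γ (b ∘ i)) *
    (((Nat.factorial 2 : ℕ) : ℝ)⁻¹ * ((∏ a, c' (j a)) * δ (b' ∘ j))) *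
      A (b ∘ i) (b' ∘ j) x) * h4

theorem hodge_eq_of_bilinear (hb : IsFrame g b c) (hb' : IsFrame g' b' c')
    (hh : ∀ u v, h u v = g u.1 v.1 + g' u.2 v.2)
    (P : V [⋀^Fin 3]→L[ℝ] ℝ → W [⋀^Fin 4]→L[ℝ] ℝ → (Fin 7 → V × W) → ℝ)
    (hP : ∀ (r : (Fin 2 → κ) → ℝ) (s : (Fin 2 → κ') → ℝ) (α : (Fin 2 → κ) → V [⋀^Fin 3]→L[ℝ] ℝ)
      (β : (Fin 2 → κ') → W [⋀^Fin 4]→L[ℝ] ℝ) (x : Fin 7 → V × W),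
      P (∑ i, r i • α i) (∑ j, s j • β j) x = ∑ i, ∑ j, (r i * s j) * P (α i) (β j) x)
    (volV : V [⋀^Fin (2 + 3)]→L[ℝ] ℝ) (volW : W [⋀^Fin (2 + 4)]→L[ℝ] ℝ)
    (vol : (V × W) [⋀^Fin (4 + 7)]→L[ℝ] ℝ)
    (F : (V × W) [⋀^Fin 4]→L[ℝ] ℝ) (γ : V [⋀^Fin 2]→L[ℝ] ℝ) (δ : W [⋀^Fin 2]→L[ℝ] ℝ)
    (hvol : ∀ u v x, vol (Fin.append (m := 4) (n := 7)
      (Fin.append (m := 2) (n := 2) (fun a => (u a, 0)) fun a => (0, v a)) x) =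
        P (contractFirst (m := 3) u volV) (contractFirst (m := 4) v volW) x)
    (hF : ∀ η : (Fin 4 → V × W) → ℝ, (∀ (v : Fin 4 → V × W) (σ : Equiv.Perm (Fin 4)),
        η (v ∘ σ) = (Equiv.Perm.sign σ : ℤ) * η v) →
      (frameSum (b.prod b') (Sum.elim c c') fun w => η w * F w) =
        (Nat.factorial 4 : ℕ) * (((Nat.factorial 2 : ℕ) * (Nat.factorial 2 : ℕ) : ℝ)⁻¹ *
          frameSum b c fun u => frameSum b' c' fun v =>
            η (Fin.append (m := 2) (n := 2) (fun a => (u a, 0)) fun a => (0, v a)) *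
              (γ u * δ v))) (x : Fin 7 → V × W) :
    hodge h vol F x = P (hodge g volV γ) (hodge g' volW δ) x := by
  rw [hodge_eq_sum_of_contract hb hb' hh vol F γ δ
    (fun u v x => P (contractFirst (m := 3) u volV) (contractFirst (m := 4) v volW) x) hvol hF,
    hb.hodge_eq, hb'.hodge_eq]
  exact (hP _ _ _ _ x).symm

theorem hodge_boxWedge (hb : IsFrame g b c) (hb' : IsFrame g' b' c')
    (hh : ∀ u v, h u v = g u.1 v.1 + g' u.2 v.2)
    (volV : V [⋀^Fin 5]→L[ℝ] ℝ) (volW : W [⋀^Fin 6]→L[ℝ] ℝ)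
    (γ : V [⋀^Fin 2]→L[ℝ] ℝ) (δ : W [⋀^Fin 2]→L[ℝ] ℝ) (vol : (V × W) [⋀^Fin (4 + 7)]→L[ℝ] ℝ)
    (hvol : boxWedge (k := 5) (l := 6) volV volW = vol) (F : (V × W) [⋀^Fin 4]→L[ℝ] ℝ)
    (hF : boxWedge (k := 2) (l := 2) γ δ = F) (x : Fin 7 → V × W) :
    hodge h (k := 4) (m := 7) vol F x =
      boxWedge (k := 3) (l := 4) (hodge g (k := 2) (m := 3) volV γ)
        (hodge g' (k := 2) (m := 4) volW δ) (x ∘ Fin.cast (show 3 + 4 = 7 from rfl)) := by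
  have hx : x ∘ Fin.cast (show 3 + 4 = 7 from rfl) = x := rfl
  rw [hx]
  obtain ⟨P, hP⟩ : ∃ P : V [⋀^Fin 3]→L[ℝ] ℝ → W [⋀^Fin 4]→L[ℝ] ℝ → (Fin 7 → V × W) → ℝ,
      ∀ α β x, boxWedge (k := 3) (l := 4) α β x = P α β x := ⟨_, fun _ _ _ => rfl⟩
  have h1 := fun u v x => boxWedge_append volV volW u v x
  have h2 := fun η hη => frameSum_mul_boxWedge (b := b) (c := c) (b' := b') (c' := c') (k := 2)
    (l := 2) η hη γ δ
  have h3 := fun r s α β (x : Fin (3 + 4) → V × W) => boxWedge_sum_smul_apply (k := 3) (l := 4)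
    (Finset.univ : Finset (Fin 2 → κ)) (Finset.univ : Finset (Fin 2 → κ')) r s α β x
  simp only [hP] at h1 h3
  rw [hvol] at h1
  rw [hF] at h2
  rw [hP]
  exact hodge_eq_of_bilinear hb hb' hh P h3 volV volW vol F γ δ h1 h2 x

end HodgeProduct

section Kahler

variable {W κ : Type*} [AddCommGroup W] [Module ℝ W] [TopologicalSpace W] [Fintype κ]
  [DecidableEq κ] {g : W →L[ℝ] W →L[ℝ] ℝ} {b : Module.Basis κ ℝ W} {c : κ → ℝ}

omit [TopologicalSpace W] [DecidableEq κ] in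
theorem frameSum_one (f : (Fin 1 → W) → ℝ) : frameSum b c f = ∑ p, c p * f ![b p] := by
  refine Fintype.sum_equiv (Equiv.funUnique (Fin 1) κ) _ _ fun i => ?_
  rw [Fin.prod_univ_one]
  simp only [Equiv.funUnique_apply]
  congr 2
  funext a; fin_cases a; rfl

omit [TopologicalSpace W] [DecidableEq κ] in
theorem frameSum_two (f : (Fin 2 → W) → ℝ) :
    frameSum b c f = ∑ p, ∑ q, c p * c q * f ![b p, b q] := by
  rw [← Fintype.sum_prod_type']
  refine Fintype.sum_equiv (finTwoArrowEquiv κ) _ _ fun i => ?_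
  rw [Fin.prod_univ_two]
  simp only [finTwoArrowEquiv_apply]
  congr 2
  funext a; fin_cases a <;> rfl

theorem IsFrame.sum_smul (hb : IsFrame g b c) (u : W) : ∑ q, (c q * g (b q) u) • b q = u := by
  simp only [← hb.repr_eq]
  exact b.sum_repr u

variable {J : W →L[ℝ] W} {δ : W [⋀^Fin 2]→L[ℝ] ℝ}

theorem kahler_skew (hJ : ∀ u, J (J u) = -u)
    (hgJ : ∀ u v, g (J u) (J v) = g u v) (u v : W) : g (J u) v = -g u (J v) := by
  rw [← hgJ (J u) v, hJ, map_neg]; rfl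

variable [FiniteDimensional ℝ W]

theorem IsFrame.formInner_interiorProd_kahler (hb : IsFrame g b c)
    (hgJ : ∀ u v, g (J u) (J v) = g u v) (hδ : ∀ u v, δ ![u, v] = g (J u) v) (u v : W) :
    formInner g (interiorProd (k := 1) u δ) (interiorProd (k := 1) v δ) = g u v := by
  rw [hb.formInner_eq, frameSum_one, ← hgJ u v, hb.inner_eq_sum]
  simp only [interiorProd_apply]
  norm_num
  refine Finset.sum_congr rfl fun p _ => ?_
  have e : ∀ x : W, δ (Matrix.vecCons x ![b p]) = g (J x) (b p) := fun x => hδ x (b p)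
  rw [e, e, hb.symm (b p)]

theorem IsFrame.formInner_kahler (hb : IsFrame g b c)
    (hgJ : ∀ u v, g (J u) (J v) = g u v) (hδ : ∀ u v, δ ![u, v] = g (J u) v) :
    formInner g δ δ = Fintype.card κ / 2 := by
  rw [hb.formInner_eq, frameSum_two]
  have h : ∀ p, ∑ q, c p * c q * (δ ![b p, b q] * δ ![b p, b q]) = 1 := by
    intro p
    have h1 := hb.inner_eq_sum (J (b p)) (J (b p))
    rw [hgJ, hb.apply_eq, if_pos rfl] at h1
    rw [← hb.sq p]
    conv_rhs => rw [h1, ← h1]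
    conv_rhs => enter [2]; rw [h1]
    rw [Finset.mul_sum]
    refine Finset.sum_congr rfl fun q _ => ?_
    rw [hδ, hb.symm (b q)]
    ring
  simp only [h]
  simp
  ring

/-- The Hodge dual of the Kähler form when the volume form is `δ³/6`. -/
theorem IsFrame.hodge_kahler {b : Module.Basis (Fin 6) ℝ W}
    (hb : IsFrame g b fun _ => -1) (hJ : ∀ u, J (J u) = -u)
    (hgJ : ∀ u v, g (J u) (J v) = g u v) (hδ : ∀ u v, δ ![u, v] = g (J u) v)
    (vol : W [⋀^Fin 6]→L[ℝ] ℝ) (hvol : ∀ v, wedge (wedge δ δ) δ v = 6 * vol v) :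
    hodge g (k := 2) (m := 4) vol δ = (1 / 2 : ℝ) • wedge δ δ := by
  ext l
  have hv : ∀ p q, vol (Fin.append (m := 2) (n := 4) ![p, q] l) =
      pf6 (fun a b => δ ![a, b]) p q (l 0) (l 1) (l 2) (l 3) := by
    intro p q
    have h1 := hvol (Fin.append (m := 2) (n := 4) ![p, q] l)
    rw [wedge_self_self_apply] at h1
    exact (mul_left_cancel₀ (by norm_num) h1).symm
  have hcontr : ∀ p, ∑ q, g (J (b p)) (b q) * vol (Fin.append (m := 2) (n := 4) ![b p, b q] l) =
      - vol (Fin.append (m := 2) (n := 4) ![b p, J (b p)] l) := by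
    intro p
    let φ : W →ₗ[ℝ] ℝ := vol.toMultilinearMap.toLinearMap
      (Fin.append (m := 2) (n := 4) ![b p, 0] l) 1
    have hφ : ∀ x, φ x = vol (Fin.append (m := 2) (n := 4) ![b p, x] l) := by
      intro x
      change vol _ = vol _
      congr 1
      funext i; fin_cases i <;> rfl
    have h1 := congrArg φ (hb.sum_smul (J (b p)))
    rw [map_sum] at h1
    simp only [LinearMap.map_smul, smul_eq_mul] at h1
    simp only [hφ] at h1
    rw [← h1, ← Finset.sum_neg_distrib]
    exact Finset.sum_congr rfl fun q _ => by rw [hb.symm (b q)]; ring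
  have hsum : ∀ x y, ∑ p, δ ![b p, x] * δ ![J (b p), y] = -δ ![x, y] := by
    intro x y
    have h1 := hb.inner_eq_sum (J x) y
    rw [hδ, h1, ← Finset.sum_neg_distrib]
    refine Finset.sum_congr rfl fun p _ => ?_
    rw [hδ, hδ, hJ, kahler_skew hJ hgJ, hb.symm (b p) (J x), map_neg]
    simp
  have hdiag : ∀ p, δ ![b p, J (b p)] = -1 := by
    intro p
    rw [hδ, hgJ, hb.apply_eq, if_pos rfl]
  rw [hb.hodge_apply, frameSum_two, ContinuousAlternatingMap.smul_apply, wedge_self_apply]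
  have h0 : ∀ p, ∑ q, (-1 : ℝ) * -1 * (δ ![b p, b q] *
      vol (Fin.append (m := 2) (n := 4) ![b p, b q] l)) =
      -pf6 (fun a b => δ ![a, b]) (b p) (J (b p)) (l 0) (l 1) (l 2) (l 3) := by
    intro p
    rw [← hv, ← hcontr]
    exact Finset.sum_congr rfl fun q _ => by rw [hδ]; ring
  have h1 : ∀ p, pf6 (fun a b => δ ![a, b]) (b p) (J (b p)) (l 0) (l 1) (l 2) (l 3) =
      -1 * pf4 (fun a b => δ ![a, b]) (l 0) (l 1) (l 2) (l 3)
      - (δ ![b p, l 0] * δ ![J (b p), l 1] * δ ![l 2, l 3]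
        - δ ![b p, l 0] * δ ![J (b p), l 2] * δ ![l 1, l 3]
        + δ ![b p, l 0] * δ ![J (b p), l 3] * δ ![l 1, l 2])
      + (δ ![b p, l 1] * δ ![J (b p), l 0] * δ ![l 2, l 3]
        - δ ![b p, l 1] * δ ![J (b p), l 2] * δ ![l 0, l 3]
        + δ ![b p, l 1] * δ ![J (b p), l 3] * δ ![l 0, l 2])
      - (δ ![b p, l 2] * δ ![J (b p), l 0] * δ ![l 1, l 3]
        - δ ![b p, l 2] * δ ![J (b p), l 1] * δ ![l 0, l 3]
        + δ ![b p, l 2] * δ ![J (b p), l 3] * δ ![l 0, l 1])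
      + (δ ![b p, l 3] * δ ![J (b p), l 0] * δ ![l 1, l 2]
        - δ ![b p, l 3] * δ ![J (b p), l 1] * δ ![l 0, l 2]
        + δ ![b p, l 3] * δ ![J (b p), l 2] * δ ![l 0, l 1]) := by
    intro p
    simp only [pf6, hdiag, pf4]
    ring
  simp only [h0, h1, Finset.sum_neg_distrib, Finset.sum_add_distrib, Finset.sum_sub_distrib,
    ← Finset.sum_mul, hsum]
  rw [two_form_antisymm δ (l 1) (l 0), two_form_antisymm δ (l 2) (l 0),
    two_form_antisymm δ (l 3) (l 0), two_form_antisymm δ (l 2) (l 1),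
    two_form_antisymm δ (l 3) (l 1), two_form_antisymm δ (l 3) (l 2)]
  simp [pf4]
  ring

end Kahler

section UnitaryFrame

variable {W : Type*} [AddCommGroup W] [Module ℝ W] [TopologicalSpace W]
  {g : W →L[ℝ] W →L[ℝ] ℝ}

theorem linearIndependent_of_gram {ι : Type*} [Fintype ι] [DecidableEq ι] (b : ι → W)
    (h : ∀ i j, g (b i) (b j) = if i = j then -1 else 0) : LinearIndependent ℝ b := by
  rw [Fintype.linearIndependent_iff]
  intro x hx i
  have h1 := congrArg (g (b i)) hx
  simpa [map_sum, h] using h1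

variable [FiniteDimensional ℝ W]

theorem exists_unit_orthogonal (hneg : ∀ u, u ≠ 0 → g u u < 0) {m : ℕ}
    (hm : m < Module.finrank ℝ W) (w : Fin m → W) :
    ∃ u, (∀ j, g (w j) u = 0) ∧ g u u = -1 := by
  let L : W →ₗ[ℝ] (Fin m → ℝ) := LinearMap.pi fun j => (g (w j) : W →ₗ[ℝ] ℝ)
  have hL : LinearMap.ker L ≠ ⊥ := LinearMap.ker_ne_bot_of_finrank_lt (by simpa using hm)
  obtain ⟨u, hu, hu0⟩ := Submodule.exists_mem_ne_zero_of_ne_bot hL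
  have hw : ∀ j, g (w j) u = 0 := fun j => congrFun (LinearMap.mem_ker.1 hu) j
  have hpos : 0 < -g u u := neg_pos.2 (hneg u hu0)
  refine ⟨(√(-g u u))⁻¹ • u, fun j => by simp [hw j], ?_⟩
  have hs := Real.mul_self_sqrt hpos.le
  have hs0 : √(-g u u) ≠ 0 := (Real.sqrt_pos.2 hpos).ne'
  simp only [map_smul, _root_.smul_apply, smul_eq_mul]
  field_simp
  linarith [hs, sq √(-g u u)]

variable {J : W →L[ℝ] W} {δ : W [⋀^Fin 2]→L[ℝ] ℝ}

theorem exists_unitary_basis (hdim : Module.finrank ℝ W = 6) (hs : ∀ u v, g u v = g v u)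
    (hneg : ∀ u, u ≠ 0 → g u u < 0) (hJ : ∀ u, J (J u) = -u)
    (hgJ : ∀ u v, g (J u) (J v) = g u v) :
    ∃ b : Module.Basis (Fin 6) ℝ W, IsFrame g b (fun _ => -1) ∧
      J (b 0) = b 1 ∧ J (b 2) = b 3 ∧ J (b 4) = b 5 := by
  have skew : ∀ u v, g (J u) v = -g u (J v) := kahler_skew hJ hgJ
  have self : ∀ u, g u (J u) = 0 := fun u => by
    have h1 := skew u u
    rw [hs (J u) u] at h1
    linarith
  obtain ⟨x, -, hx⟩ := exists_unit_orthogonal hneg (m := 0) (by omega) ![]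
  obtain ⟨y, hxy, hy⟩ := exists_unit_orthogonal hneg (m := 2) (by omega) ![x, J x]
  obtain ⟨z, hxz, hz⟩ := exists_unit_orthogonal hneg (m := 4) (by omega) ![x, J x, y, J y]
  have h1 : g x y = 0 := hxy 0
  have h2 : g (J x) y = 0 := hxy 1
  have h3 : g x z = 0 := hxz 0
  have h4 : g (J x) z = 0 := hxz 1
  have h5 : g y z = 0 := hxz 2
  have h6 : g (J y) z = 0 := hxz 3
  have h2' : g x (J y) = 0 := by linarith [skew x y]
  have h4' : g x (J z) = 0 := by linarith [skew x z]
  have h6' : g y (J z) = 0 := by linarith [skew y z]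
  have gram : ∀ i j : Fin 6, g (![x, J x, y, J y, z, J z] i) (![x, J x, y, J y, z, J z] j) =
      if i = j then -1 else 0 := by
    have key : ∀ i j : Fin 6, i ≤ j →
        g (![x, J x, y, J y, z, J z] i) (![x, J x, y, J y, z, J z] j) =
          if i = j then -1 else 0 := by
      intro i j h
      fin_cases i <;> fin_cases j <;>
        simp [hx, hy, hz, self, hgJ, h1, h2, h3, h4, h5, h6, h2', h4', h6'] at h ⊢
    intro i j
    rcases le_total i j with h | h
    · exact key i j h
    · rw [hs, key j i h]
      simp only [eq_comm]
  let b := basisOfLinearIndependentOfCardEqFinrank (linearIndependent_of_gram _ gram)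
    (by simpa using hdim.symm)
  have hb : ⇑b = ![x, J x, y, J y, z, J z] := coe_basisOfLinearIndependentOfCardEqFinrank _ _
  refine ⟨b, ⟨fun i j => ?_, fun i => by norm_num⟩, ?_, ?_, ?_⟩
  · rw [hb]; exact gram i j
  all_goals rw [hb]; rfl

omit [FiniteDimensional ℝ W] in
theorem kahler_cube_unitary {b : Module.Basis (Fin 6) ℝ W} (hb : IsFrame g b fun _ => -1)
    (h0 : J (b 0) = b 1) (h2 : J (b 2) = b 3) (h4 : J (b 4) = b 5)
    (hJ : ∀ u, J (J u) = -u) (hδ : ∀ u v, δ ![u, v] = g (J u) v) :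
    wedge (wedge δ δ) δ b = -6 := by
  have h1 : J (b 1) = -b 0 := by rw [← h0, hJ]
  have h3 : J (b 3) = -b 2 := by rw [← h2, hJ]
  have h5 : J (b 5) = -b 4 := by rw [← h4, hJ]
  rw [wedge_self_self_apply]
  simp [pf6, pf4, hδ, h0, h1, h2, h3, h4, hb.apply_eq]

omit [FiniteDimensional ℝ W] in
theorem eq_mul_of_apply_basis {n : ℕ} (b : Module.Basis (Fin n) ℝ W) (η vol : W [⋀^Fin n]→L[ℝ] ℝ)
    (r : ℝ) (h : η b = r * vol b) (v : Fin n → W) : η v = r * vol v := by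
  have e1 := DFunLike.congr_fun (η.toAlternatingMap.eq_smul_basis_det b) v
  have e2 := DFunLike.congr_fun (vol.toAlternatingMap.eq_smul_basis_det b) v
  have e3 : η v = η b * b.det v := e1
  have e4 : vol v = vol b * b.det v := e2
  rw [e3, e4, h]
  ring

theorem kahler_cube_eq (hdim : Module.finrank ℝ W = 6) (hs : ∀ u v, g u v = g v u)
    (hneg : ∀ u, u ≠ 0 → g u u < 0) (hJ : ∀ u, J (J u) = -u)
    (hgJ : ∀ u v, g (J u) (J v) = g u v) (hδ : ∀ u v, δ ![u, v] = g (J u) v)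
    (vol : W [⋀^Fin 6]→L[ℝ] ℝ)
    (hvol : ∀ v : Fin 6 → W, vol v ^ 2 = |(Matrix.of fun i j => g (v i) (v j)).det|)
    (hor : ∀ v : Fin 6 → W, 0 < vol v → 0 < wedge (wedge δ δ) δ v) :
    ∃ b : Module.Basis (Fin 6) ℝ W, IsFrame g b (fun _ => -1) ∧
      wedge (wedge δ δ) δ b = -6 ∧ ∀ v, wedge (wedge δ δ) δ v = 6 * vol v := by
  obtain ⟨b, hb, h0, h2, h4⟩ := exists_unitary_basis hdim hs hneg hJ hgJ
  have hc := kahler_cube_unitary hb h0 h2 h4 hJ hδ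
  have hv : vol b = -1 := by
    have h1 := hvol b
    have h2 : (Matrix.of fun i j => g (b i) (b j)) = -(1 : Matrix (Fin 6) (Fin 6) ℝ) := by
      ext i j
      simp only [Matrix.of_apply, hb.apply_eq, Matrix.neg_apply, Matrix.one_apply]
      split_ifs <;> simp
    rw [h2, Matrix.det_neg] at h1
    norm_num at h1
    rcases h1 with h1 | h1
    · have := hor b (by rw [h1]; norm_num)
      rw [hc] at this
      norm_num at this
    · exact h1
  exact ⟨b, hb, hc, eq_mul_of_apply_basis b _ vol 6 (by rw [hc, hv]; norm_num)⟩

end UnitaryFrame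

section FormSpace

variable {E : Type*} [NormedAddCommGroup E] [NormedSpace ℝ E] [FiniteDimensional ℝ E] {k l n : ℕ}

/-- The components of a form in the basis `Module.finBasis ℝ E`. -/
noncomputable def formComponents (E : Type*) [NormedAddCommGroup E] [NormedSpace ℝ E]
    [FiniteDimensional ℝ E] (k : ℕ) :
    E [⋀^Fin k]→L[ℝ] ℝ →ₗ[ℝ] ((Fin k → Fin (Module.finrank ℝ E)) → ℝ) where
  toFun η i := η fun a => Module.finBasis ℝ E (i a)
  map_add' _ _ := rfl
  map_smul' _ _ := rfl

theorem formComponents_injective : Function.Injective (formComponents E k) := by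
  intro η φ h
  have h1 : η.toMultilinearMap = φ.toMultilinearMap :=
    Module.Basis.ext_multilinear (fun _ => Module.finBasis ℝ E) fun i => congrFun h i
  ext v
  exact congrArg (fun m : MultilinearMap ℝ (fun _ : Fin k => E) ℝ => m v) h1

instance form_finiteDimensional : FiniteDimensional ℝ (E [⋀^Fin k]→L[ℝ] ℝ) :=
  Module.Finite.of_injective (formComponents E k) formComponents_injective

theorem differentiableAt_form {X : Type*} [NormedAddCommGroup X] [NormedSpace ℝ X]
    {f : X → E [⋀^Fin k]→L[ℝ] ℝ} {x : X} (h : ∀ v, DifferentiableAt ℝ (fun y => f y v) x) :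
    DifferentiableAt ℝ f x := by
  obtain ⟨r, hr⟩ := (formComponents E k).exists_leftInverse_of_injective
    (LinearMap.ker_eq_bot.2 formComponents_injective)
  have h1 : DifferentiableAt ℝ (fun y => formComponents E k (f y)) x :=
    differentiableAt_pi.2 fun i => h _
  have h2 : f = fun y => LinearMap.toContinuousLinearMap r (formComponents E k (f y)) := by
    funext y
    exact (LinearMap.congr_fun hr (f y)).symm
  rw [h2]
  exact (LinearMap.toContinuousLinearMap r).differentiableAt.comp x h1

/-- The wedge product as a continuous bilinear map. -/
noncomputable def wedgeCLM (E : Type*) [NormedAddCommGroup E] [NormedSpace ℝ E]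
    [FiniteDimensional ℝ E] (k l : ℕ) :
    E [⋀^Fin k]→L[ℝ] ℝ →L[ℝ] E [⋀^Fin l]→L[ℝ] ℝ →L[ℝ] E [⋀^Fin (k + l)]→L[ℝ] ℝ :=
  LinearMap.toContinuousBilinearMap
    (LinearMap.mk₂ ℝ wedge wedge_add_left wedge_smul_left wedge_add_right wedge_smul_right)

variable {A : E → E [⋀^Fin k]→L[ℝ] ℝ} {B : E → E [⋀^Fin l]→L[ℝ] ℝ} {x : E}

theorem differentiableAt_wedge (hA : DifferentiableAt ℝ A x) (hB : DifferentiableAt ℝ B x) :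
    DifferentiableAt ℝ (fun y => wedge (A y) (B y)) x :=
  ((wedgeCLM E k l).differentiableAt.comp x hA).clm_apply hB

theorem fderiv_wedge (hA : DifferentiableAt ℝ A x) (hB : DifferentiableAt ℝ B x) (u : E) :
    fderiv ℝ (fun y => wedge (A y) (B y)) x u =
      wedge (fderiv ℝ A x u) (B x) + wedge (A x) (fderiv ℝ B x u) := by
  have h := (wedgeCLM E k l).fderiv_of_bilinear hA hB
  have h' := congrArg (fun L : E →L[ℝ] E [⋀^Fin (k + l)]→L[ℝ] ℝ => L u) h
  exact h'.trans (add_comm _ _)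

omit [FiniteDimensional ℝ E] in
theorem extDeriv_apply_eq_sum (A : E → E [⋀^Fin k]→L[ℝ] ℝ) (x : E) (v : Fin (k + 1) → E) :
    extDeriv A x v = ∑ p : Fin (k + 1), (-1) ^ (p : ℕ) * fderiv ℝ A x (v p) (p.removeNth v) := by
  rw [extDeriv, ContinuousAlternatingMap.alternatizeUncurryFin_apply]
  simp only [zsmul_eq_mul, Int.cast_pow, Int.cast_neg, Int.cast_one]

omit [FiniteDimensional ℝ E] in
theorem extDeriv_eq_altSum (A : E → E [⋀^Fin k]→L[ℝ] ℝ) (x : E) :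
    (extDeriv A x : (Fin (k + 1) → E) → ℝ) = fun v => (k.factorial : ℝ)⁻¹ *
      altSum (fun w => fderiv ℝ A x (w 0) (Fin.tail w)) v := by
  funext v
  rw [extDeriv_apply_eq_sum, altSum_eq_sum_removeNth, Finset.mul_sum]
  refine Finset.sum_congr rfl fun p _ => ?_
  simp only [Fin.cons_zero, Fin.tail_cons]
  rw [altSum_form]
  have : (k.factorial : ℝ) ≠ 0 := by positivity
  field_simp

/-- The Leibniz rule for the exterior derivative of a wedge product. -/
theorem extDeriv_wedge_apply (hA : DifferentiableAt ℝ A x) (hB : DifferentiableAt ℝ B x)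
    (v : Fin (k + l + 1) → E) :
    extDeriv (fun y => wedge (A y) (B y)) x v =
      wedge (extDeriv A x) (B x) (v ∘ Fin.cast (show k + 1 + l = k + l + 1 by omega)) +
        (-1) ^ k * wedge (A x) (extDeriv B x) v := by
  have hkl : (k.factorial : ℝ) * l.factorial ≠ 0 := by positivity
  have hk : (k.factorial : ℝ) ≠ 0 := by positivity
  have hl : (l.factorial : ℝ) ≠ 0 := by positivity
  have e0 : extDeriv (fun y => wedge (A y) (B y)) x v = ((k.factorial : ℝ) * l.factorial)⁻¹ *
      (altSum (fun w : Fin (k + l + 1) → E => tmul (fderiv ℝ A x (w 0)) (B x) (Fin.tail w)) v +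
        altSum (fun w : Fin (k + l + 1) → E =>
          tmul (A x) (fderiv ℝ B x (w 0)) (Fin.tail w)) v) := by
    rw [extDeriv_apply_eq_sum, altSum_eq_sum_removeNth, altSum_eq_sum_removeNth,
      ← Finset.sum_add_distrib, Finset.mul_sum]
    refine Finset.sum_congr rfl fun p _ => ?_
    simp only [Fin.cons_zero, Fin.tail_cons]
    rw [fderiv_wedge hA hB, ContinuousAlternatingMap.add_apply, wedge_apply, wedge_apply]
    ring
  have e1 : wedge (extDeriv A x) (B x) (v ∘ Fin.cast (show k + 1 + l = k + l + 1 by omega)) =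
      ((k.factorial : ℝ) * l.factorial)⁻¹ *
        altSum (fun w : Fin (k + l + 1) → E => tmul (fderiv ℝ A x (w 0)) (B x) (Fin.tail w)) v := by
    rw [wedge_apply, extDeriv_eq_altSum, tmul_const_mul_left, altSum_const_mul,
      altSum_tmul_altSum_left, ← altSum_comp_cast, Nat.factorial_succ]
    have : (fun w : Fin (k + l + 1) → E => tmul (fderiv ℝ A x (w 0)) (B x) (Fin.tail w)) =
        fun w : Fin (k + l + 1) → E =>
          tmul (fun w : Fin (k + 1) → E => fderiv ℝ A x (w 0) (Fin.tail w)) (B x)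
            (w ∘ Fin.cast (show k + 1 + l = k + l + 1 by omega)) := by
      funext w
      simp only [tmul]
      congr 1
      congr 1
      funext i
      simp only [Function.comp_apply, Fin.tail]
      congr 1
      ext
      simp
      omega
    rw [this]
    push_cast
    field_simp
  have e2 : wedge (A x) (extDeriv B x) v = (-1) ^ k * (((k.factorial : ℝ) * l.factorial)⁻¹ *
      altSum (fun w : Fin (k + l + 1) → E =>
          tmul (A x) (fderiv ℝ B x (w 0)) (Fin.tail w)) v) := by
    have h1 : (fun w : Fin (k + l + 1) → E => tmul (A x) (fderiv ℝ B x (w 0)) (Fin.tail w)) =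
        fun w : Fin (k + l + 1) → E =>
          tmul (A x) (fun w : Fin (l + 1) → E => fderiv ℝ B x (w 0) (Fin.tail w))
            (w ∘ permFinSucc (k + l) (Fin.natAdd k (0 : Fin (l + 1)), 1)) := by
      funext w
      obtain ⟨u, w, rfl⟩ : ∃ u w', w = Fin.cons u w' := ⟨_, _, (Fin.cons_self_tail w).symm⟩
      rw [cons_comp_permFinSucc]
      simp only [tmul, Fin.cons_zero, Fin.tail_cons, Equiv.Perm.coe_one, Function.comp_id]
      rw [insertNth_natAdd_comp_castAdd, insertNth_natAdd_comp_natAdd, Fin.insertNth_zero',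
        Fin.cons_zero, Fin.tail_cons]
    rw [h1, altSum_comp_perm, sign_permFinSucc, wedge_apply, extDeriv_eq_altSum,
      tmul_const_mul_right, altSum_const_mul, altSum_tmul_altSum_right, Nat.factorial_succ]
    have h2 := neg_one_pow_mul_neg_one_pow k
    simp only [Fin.val_natAdd, Fin.val_zero, add_zero, Equiv.Perm.sign_one]
    push_cast
    field_simp
    linear_combination -(altSum (tmul (A x) fun w : Fin (l + 1) → E =>
      fderiv ℝ B x (w 0) (Fin.tail w)) v) * h2
  rw [e0, e1, e2]
  have h2 := neg_one_pow_mul_neg_one_pow k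
  linear_combination -(((k.factorial : ℝ) * l.factorial)⁻¹ *
      altSum (fun w : Fin (k + l + 1) → E =>
          tmul (A x) (fderiv ℝ B x (w 0)) (Fin.tail w)) v) * h2

end FormSpace

section Charts

variable {E : Type*} [NormedAddCommGroup E] [NormedSpace ℝ E] {H : Type*} [TopologicalSpace H]
  {I : ModelWithCorners ℝ E H} {M : Type*} [TopologicalSpace M] [ChartedSpace H M]

/-- The derivative of the inverse of the chart at `x`, as an endomorphism of the model space. -/
noncomputable def chartDeriv (I : ModelWithCorners ℝ E H) (x : M) (z : E) : E →L[ℝ] E :=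
  mfderiv 𝓘(ℝ, E) I (extChartAt I x).symm z

/-- A form at a point, on the model space. -/
def FormField.model {k : ℕ} (η : FormField I M k) (p : M) : E [⋀^Fin k]→L[ℝ] ℝ := η p

/-- A bilinear form at a point, on the model space. -/
def BilinField.model (g : BilinField I M) (p : M) : E →L[ℝ] E →L[ℝ] ℝ := g p

theorem FormField.inChart_eq {k : ℕ} (η : FormField I M k) (x : M) (z : E) :
    η.inChart x z =
      (η.model ((extChartAt I x).symm z)).compContinuousLinearMap (chartDeriv I x z) := rfl

theorem BilinField.inChart_apply (g : BilinField I M) (x : M) (z u v : E) :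
    g.inChart x z u v =
      g.model ((extChartAt I x).symm z) (chartDeriv I x z u) (chartDeriv I x z v) := rfl

variable [I.Boundaryless] [IsManifold I ∞ M]

theorem mdifferentiableAt_chart_symm (x : M) {z : E} (hz : z ∈ (extChartAt I x).target) :
    MDifferentiableAt 𝓘(ℝ, E) I (extChartAt I x).symm z := by
  have h : ContMDiffOn 𝓘(ℝ, E) I ∞ (extChartAt I x).symm (extChartAt I x).target :=
    contMDiffOn_extChartAt_symm x
  exact (h.contMDiffAt ((isOpen_extChartAt_target x).mem_nhds hz)).mdifferentiableAt (by simp)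

theorem chartDeriv_isInvertible (x : M) {z : E} (hz : z ∈ (extChartAt I x).target) :
    (chartDeriv I x z).IsInvertible := by
  have : IsManifold I 1 M := IsManifold.of_le (n := ∞) (by simp)
  have h := isInvertible_mfderivWithin_extChartAt_symm (I := I) hz
  rw [I.range_eq_univ, mfderivWithin_univ] at h
  exact h

theorem chartDeriv_self (x : M) :
    chartDeriv I x (extChartAt I x x) = ContinuousLinearMap.id ℝ E := by
  have : IsManifold I 1 M := IsManifold.of_le (n := ∞) (by simp)
  have h := mfderivWithin_range_extChartAt_symm (I := I) (x := x)
  rw [I.range_eq_univ, mfderivWithin_univ] at h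
  exact h

omit [I.Boundaryless] in
theorem mfderiv_chart_self (x : M) :
    (mfderiv I 𝓘(ℝ, E) (extChartAt I x) x : E →L[ℝ] E) = ContinuousLinearMap.id ℝ E := by
  have : IsManifold I 1 M := IsManifold.of_le (n := ∞) (by simp)
  exact mfderiv_extChartAt_self

theorem FormField.inChart_self {k : ℕ} (η : FormField I M k) (x : M) :
    η.inChart x (extChartAt I x x) = η.model x := by
  rw [FormField.inChart_eq, chartDeriv_self, extChartAt_to_inv]
  ext v
  rfl

theorem BilinField.inChart_self (g : BilinField I M) (x : M) :
    g.inChart x (extChartAt I x x) = g.model x := by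
  ext u v
  rw [BilinField.inChart_apply, chartDeriv_self, extChartAt_to_inv]
  rfl

omit [I.Boundaryless] in
theorem FormField.d_eq {k : ℕ} (η : FormField I M k) (x : M) :
    η.d x = extDeriv (η.inChart x) (extChartAt I x x) := by
  have h : ∀ T : E →L[ℝ] E, T = ContinuousLinearMap.id ℝ E →
      (extDeriv (η.inChart x) (extChartAt I x x)).compContinuousLinearMap T =
        extDeriv (η.inChart x) (extChartAt I x x) := by
    rintro T rfl
    ext v
    rfl
  exact h _ (mfderiv_chart_self x)

omit [I.Boundaryless] in
theorem ricci_eq (g : BilinField I M) (x : M) (u v : E) :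
    ricci g x u v = flatRicci (g.inChart x) (extChartAt I x x) u v := by
  have h : ∀ T : E →L[ℝ] E, T = ContinuousLinearMap.id ℝ E →
      flatRicci (g.inChart x) (extChartAt I x x) (T u) (T v) =
        flatRicci (g.inChart x) (extChartAt I x x) u v := by
    rintro T rfl
    rfl
  exact h _ (mfderiv_chart_self x)

variable {E' : Type*} [NormedAddCommGroup E'] [NormedSpace ℝ E'] {H' : Type*}
  [TopologicalSpace H'] {I' : ModelWithCorners ℝ E' H'} {M' : Type*} [TopologicalSpace M']
  [ChartedSpace H' M'] [I'.Boundaryless] [IsManifold I' ∞ M']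

omit [I.Boundaryless] [IsManifold I ∞ M] [I'.Boundaryless] [IsManifold I' ∞ M'] in
theorem prodWedge_model {k l : ℕ} (α : FormField I M k) (β : FormField I' M' l) (p : M × M') :
    (prodWedge α β).model p = boxWedge (α.model p.1) (β.model p.2) := by
  have h : ∀ (S : E × E' →L[ℝ] E) (T : E × E' →L[ℝ] E'), S = ContinuousLinearMap.fst ℝ E E' →
      T = ContinuousLinearMap.snd ℝ E E' →
      wedge ((α.model p.1).compContinuousLinearMap S) ((β.model p.2).compContinuousLinearMap T) =
        boxWedge (α.model p.1) (β.model p.2) := by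
    rintro S T rfl rfl
    rfl
  exact h _ _ mfderiv_fst mfderiv_snd

omit [I.Boundaryless] [IsManifold I ∞ M] [I'.Boundaryless] [IsManifold I' ∞ M'] in
theorem prodMetric_model (g : BilinField I M) (g' : BilinField I' M') (p : M × M')
    (u v : E × E') :
    (prodMetric g g').model p u v = g.model p.1 u.1 v.1 + g'.model p.2 u.2 v.2 := by
  have h : ∀ (S : E × E' →L[ℝ] E) (T : E × E' →L[ℝ] E'), S = ContinuousLinearMap.fst ℝ E E' →
      T = ContinuousLinearMap.snd ℝ E E' →
      g.model p.1 (S u) (S v) + g'.model p.2 (T u) (T v) =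
        g.model p.1 u.1 v.1 + g'.model p.2 u.2 v.2 := by
    rintro S T rfl rfl
    rfl
  exact h _ _ mfderiv_fst mfderiv_snd

theorem chartDeriv_prod (p : M × M') {z : E × E'} (h1 : z.1 ∈ (extChartAt I p.1).target)
    (h2 : z.2 ∈ (extChartAt I' p.2).target) (u : E × E') :
    chartDeriv (I.prod I') p z u = (chartDeriv I p.1 z.1 u.1, chartDeriv I' p.2 z.2 u.2) := by
  have hz : z ∈ (extChartAt (I.prod I') p).target := by
    rw [extChartAt_prod]; exact ⟨h1, h2⟩
  have hd := mdifferentiableAt_chart_symm (I := I.prod I') p hz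
  have e1 : mfderiv 𝓘(ℝ, E × E') I (Prod.fst ∘ (extChartAt (I.prod I') p).symm) z =
      _ := mfderiv_comp z mdifferentiableAt_fst hd
  have e2 : mfderiv 𝓘(ℝ, E × E') I' (Prod.snd ∘ (extChartAt (I.prod I') p).symm) z =
      _ := mfderiv_comp z mdifferentiableAt_snd hd
  have f1 : Prod.fst ∘ (extChartAt (I.prod I') p).symm = (extChartAt I p.1).symm ∘ Prod.fst := by
    rw [extChartAt_prod]; rfl
  have f2 : Prod.snd ∘ (extChartAt (I.prod I') p).symm = (extChartAt I' p.2).symm ∘ Prod.snd := by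
    rw [extChartAt_prod]; rfl
  have g1 : mfderiv 𝓘(ℝ, E × E') I ((extChartAt I p.1).symm ∘ Prod.fst) z = _ :=
    mfderiv_comp (I' := 𝓘(ℝ, E)) z (mdifferentiableAt_chart_symm p.1 h1)
      (differentiableAt_fst (𝕜 := ℝ) (p := z)).mdifferentiableAt
  have g2 : mfderiv 𝓘(ℝ, E × E') I' ((extChartAt I' p.2).symm ∘ Prod.snd) z = _ :=
    mfderiv_comp (I' := 𝓘(ℝ, E')) z (mdifferentiableAt_chart_symm p.2 h2)
      (differentiableAt_snd (𝕜 := ℝ) (p := z)).mdifferentiableAt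
  rw [f1] at e1
  rw [f2] at e2
  have k1 := e1.symm.trans g1
  have k2 := e2.symm.trans g2
  rw [mfderiv_fst, mfderiv_eq_fderiv, fderiv_fst] at k1
  rw [mfderiv_snd, mfderiv_eq_fderiv, fderiv_snd] at k2
  have l1 := congrArg (fun L : E × E' →L[ℝ] E => L u) k1
  have l2 := congrArg (fun L : E × E' →L[ℝ] E' => L u) k2
  exact Prod.ext l1 l2

theorem prodWedge_inChart {k l : ℕ} (α : FormField I M k) (β : FormField I' M' l)
    (p : M × M') {z : E × E'} (h1 : z.1 ∈ (extChartAt I p.1).target)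
    (h2 : z.2 ∈ (extChartAt I' p.2).target) :
    (prodWedge α β).inChart p z = boxWedge (α.inChart p.1 z.1) (β.inChart p.2 z.2) := by
  have hs : (extChartAt (I.prod I') p).symm z =
      ((extChartAt I p.1).symm z.1, (extChartAt I' p.2).symm z.2) := by
    rw [extChartAt_prod]; rfl
  rw [FormField.inChart_eq, prodWedge_model, boxWedge, wedge_compContinuousLinearMap, boxWedge, hs]
  congr 1
  · ext v
    rw [FormField.inChart_eq]
    change α.model _ _ = α.model _ _
    congr 1
    funext i
    exact congrArg Prod.fst (chartDeriv_prod p h1 h2 (v i))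
  · ext v
    rw [FormField.inChart_eq]
    change β.model _ _ = β.model _ _
    congr 1
    funext i
    exact congrArg Prod.snd (chartDeriv_prod p h1 h2 (v i))

theorem prodMetric_inChart (g : BilinField I M) (g' : BilinField I' M')
    (p : M × M') {z : E × E'} (h1 : z.1 ∈ (extChartAt I p.1).target)
    (h2 : z.2 ∈ (extChartAt I' p.2).target) (u v : E × E') :
    (prodMetric g g').inChart p z u v =
      g.inChart p.1 z.1 u.1 v.1 + g'.inChart p.2 z.2 u.2 v.2 := by
  have hs : (extChartAt (I.prod I') p).symm z =
      ((extChartAt I p.1).symm z.1, (extChartAt I' p.2).symm z.2) := by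
    rw [extChartAt_prod]; rfl
  rw [BilinField.inChart_apply, prodMetric_model, hs, chartDeriv_prod p h1 h2,
    chartDeriv_prod p h1 h2, BilinField.inChart_apply, BilinField.inChart_apply]

end Charts

section HodgeCalculus

variable {X E κ : Type*} [NormedAddCommGroup X] [NormedSpace ℝ X] [NormedAddCommGroup E]
  [NormedSpace ℝ E] [FiniteDimensional ℝ E] [Fintype κ] [DecidableEq κ] {k m : ℕ}

theorem differentiableAt_prod {ι : Type*} (s : Finset ι) {f : ι → X → ℝ} {x : X}
    (h : ∀ i, DifferentiableAt ℝ (f i) x) : DifferentiableAt ℝ (fun y => ∏ i ∈ s, f i y) x := by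
  classical
  induction s using Finset.induction_on with
  | empty => simp
  | insert i s hi ih =>
    simp only [Finset.prod_insert hi]
    exact (h i).mul ih

theorem differentiableAt_det {n : Type*} [Fintype n] [DecidableEq n] {A : X → Matrix n n ℝ} {x : X}
    (h : ∀ i j, DifferentiableAt ℝ (fun y => A y i j) x) :
    DifferentiableAt ℝ (fun y => (A y).det) x := by
  simp only [Matrix.det_apply']
  exact DifferentiableAt.fun_sum fun σ _ => (differentiableAt_const _).mul
    (differentiableAt_prod _ fun i => h _ _)

theorem differentiableAt_matrix_inv {n : Type*} [Fintype n] [DecidableEq n] {A : X → Matrix n n ℝ}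
    {x : X} (h : ∀ i j, DifferentiableAt ℝ (fun y => A y i j) x) (hx : (A x).det ≠ 0) (i j : n) :
    DifferentiableAt ℝ (fun y => (A y)⁻¹ i j) x := by
  simp only [Matrix.inv_def, Ring.inverse_eq_inv', Matrix.smul_apply, smul_eq_mul]
  refine ((differentiableAt_det h).inv hx).mul ?_
  simp only [Matrix.adjugate_apply]
  refine differentiableAt_det fun a b => ?_
  by_cases hj : a = j
  · subst hj
    simp
  · simpa [Matrix.updateRow_ne hj] using h a b

variable {G : X → E →L[ℝ] E →L[ℝ] ℝ} {vol : X → E [⋀^Fin (k + m)]→L[ℝ] ℝ}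
  {β : X → E [⋀^Fin k]→L[ℝ] ℝ} {x : X} {b : Module.Basis κ ℝ E} {c : κ → ℝ}

theorem differentiableAt_form_apply {f : X → E [⋀^Fin k]→L[ℝ] ℝ} (hf : DifferentiableAt ℝ f x)
    (v : Fin k → E) : DifferentiableAt ℝ (fun y => f y v) x := by
  let L : E [⋀^Fin k]→L[ℝ] ℝ →ₗ[ℝ] ℝ :=
    { toFun := fun η => η v, map_add' := fun _ _ => rfl, map_smul' := fun _ _ => rfl }
  exact (LinearMap.toContinuousLinearMap L).differentiableAt.comp x hf

theorem differentiableAt_gramInv (hG : DifferentiableAt ℝ G x) (hb : IsFrame (G x) b c)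
    (i j : Fin (Module.finrank ℝ E)) : DifferentiableAt ℝ (fun y => gramInv (G y) i j) x := by
  refine differentiableAt_matrix_inv (fun a b => ?_) ?_ i j
  · exact (hG.clm_apply (differentiableAt_const _)).clm_apply (differentiableAt_const _)
  · exact (Matrix.isUnit_det_of_right_inverse hb.gram_mul_eq_one).ne_zero

theorem differentiableAt_hodge (hG : DifferentiableAt ℝ G x) (hb : IsFrame (G x) b c)
    (hvol : DifferentiableAt ℝ vol x) (hβ : DifferentiableAt ℝ β x) :
    DifferentiableAt ℝ (fun y => hodge (G y) (vol y) (β y)) x := by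
  refine differentiableAt_form fun v => ?_
  simp only [hodge, ContinuousAlternatingMap.smul_apply, ContinuousAlternatingMap.sum_apply,
    smul_eq_mul]
  refine (differentiableAt_const _).mul (DifferentiableAt.fun_sum fun i _ =>
    DifferentiableAt.fun_sum fun j _ => ?_)
  refine ((differentiableAt_form_apply hβ _).mul (differentiableAt_prod _ fun a =>
    differentiableAt_gramInv hG hb _ _)).mul ?_
  exact differentiableAt_form_apply hvol _

omit [FiniteDimensional ℝ E] [Fintype κ] in
theorem IsFrame.comp_equiv {g G : E →L[ℝ] E →L[ℝ] ℝ} (hb : IsFrame g b c) (T : E ≃L[ℝ] E)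
    (hG : ∀ u v, G u v = g (T u) (T v)) : IsFrame G (b.map T.symm.toLinearEquiv) c where
  apply_eq i j := by
    rw [hG]
    simpa using hb.apply_eq i j
  sq := hb.sq

/-- The Hodge star is natural under linear isomorphisms. -/
theorem IsFrame.hodge_comp_equiv {g G : E →L[ℝ] E →L[ℝ] ℝ} (hb : IsFrame g b c) (T : E ≃L[ℝ] E)
    (hG : ∀ u v, G u v = g (T u) (T v)) (vol : E [⋀^Fin (k + m)]→L[ℝ] ℝ)
    (β : E [⋀^Fin k]→L[ℝ] ℝ) :
    (hodge g vol β).compContinuousLinearMap (T : E →L[ℝ] E) =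
      hodge G (vol.compContinuousLinearMap (T : E →L[ℝ] E))
        (β.compContinuousLinearMap (T : E →L[ℝ] E)) := by
  ext v
  rw [(hb.comp_equiv T hG).hodge_apply, ContinuousAlternatingMap.compContinuousLinearMap_apply,
    hb.hodge_apply, frameSum, frameSum]
  congr 1
  refine Finset.sum_congr rfl fun i _ => ?_
  congr 1
  rw [ContinuousAlternatingMap.compContinuousLinearMap_apply,
    ContinuousAlternatingMap.compContinuousLinearMap_apply]
  congr 1
  · congr 1
    funext a
    simp
  · congr 1
    funext a
    refine Fin.addCases (fun a => ?_) (fun a => ?_) a <;> simp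

end HodgeCalculus

section ManifoldCalculus

variable {E : Type*} [NormedAddCommGroup E] [NormedSpace ℝ E] [FiniteDimensional ℝ E]
  {H : Type*} [TopologicalSpace H]
  {I : ModelWithCorners ℝ E H} {M : Type*} [TopologicalSpace M] [ChartedSpace H M]
  [I.Boundaryless] [IsManifold I ∞ M]

omit [FiniteDimensional ℝ E] [IsManifold I ∞ M] in
theorem FormField.IsSmooth.differentiableAt {k : ℕ} {η : FormField I M k} (h : η.IsSmooth) (x : M) :
    DifferentiableAt ℝ (η.inChart x) (extChartAt I x x) :=
  ((h x).contDiffAt (extChartAt_target_mem_nhds x)).differentiableAt (by simp)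

omit [FiniteDimensional ℝ E] [IsManifold I ∞ M] in
theorem BilinField.IsSmooth.contDiffAt {g : BilinField I M} (h : g.IsSmooth) (x : M) :
    ContDiffAt ℝ ∞ (g.inChart x) (extChartAt I x x) :=
  (h x).contDiffAt (extChartAt_target_mem_nhds x)

theorem star_inChart {κ : Type*} [Fintype κ] [DecidableEq κ] {k m : ℕ} {c : κ → ℝ}
    (g : BilinField I M) (vol : FormField I M (k + m)) (β : FormField I M k)
    (hg : ∀ p, ∃ b : Module.Basis κ ℝ E, IsFrame (g.model p) b c) (x : M) {z : E}
    (hz : z ∈ (extChartAt I x).target) :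
    (FormField.star g vol β).inChart x z =
      hodge (g.inChart x z) (vol.inChart x z) (β.inChart x z) := by
  obtain ⟨T, hT⟩ := chartDeriv_isInvertible (I := I) x hz
  obtain ⟨b, hb⟩ := hg ((extChartAt I x).symm z)
  rw [FormField.inChart_eq, FormField.inChart_eq, FormField.inChart_eq, ← hT]
  exact hb.hodge_comp_equiv T (fun u v => by rw [BilinField.inChart_apply, ← hT]; rfl) _ _

theorem differentiableAt_star {κ : Type*} [Fintype κ] [DecidableEq κ] {k m : ℕ} {c : κ → ℝ}
    {g : BilinField I M} {vol : FormField I M (k + m)} {β : FormField I M k} (hs : g.IsSmooth)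
    (hvol : vol.IsSmooth) (hβ : β.IsSmooth)
    (hg : ∀ p, ∃ b : Module.Basis κ ℝ E, IsFrame (g.model p) b c) (x : M) :
    DifferentiableAt ℝ ((FormField.star g vol β).inChart x) (extChartAt I x x) := by
  obtain ⟨b, hb⟩ := hg x
  rw [← BilinField.inChart_self (I := I) g x] at hb
  refine (differentiableAt_hodge ((hs.contDiffAt x).differentiableAt (by simp)) hb
    (hvol.differentiableAt x) (hβ.differentiableAt x)).congr_of_eventuallyEq ?_
  filter_upwards [extChartAt_target_mem_nhds x] with z hz using star_inChart g vol β hg x hz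

theorem FormField.d_wedge_apply {k l : ℕ} {α : FormField I M k} {β : FormField I M l} (x : M)
    (hα : DifferentiableAt ℝ (α.inChart x) (extChartAt I x x))
    (hβ : DifferentiableAt ℝ (β.inChart x) (extChartAt I x x)) (v : Fin (k + l + 1) → E) :
    (α.wedge β).d.model x v =
      Sugra.wedge (α.d.model x) (β.model x) (v ∘ Fin.cast (show k + 1 + l = k + l + 1 by omega)) +
        (-1) ^ k * Sugra.wedge (α.model x) (β.d.model x) v := by
  have h : (α.wedge β).inChart x = fun z => Sugra.wedge (α.inChart x z) (β.inChart x z) := by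
    funext z
    exact wedge_compContinuousLinearMap _ _ _
  have e := FormField.d_eq (α.wedge β) x
  rw [h] at e
  have e1 : α.d.model x = _ := FormField.d_eq α x
  have e2 : β.d.model x = _ := FormField.d_eq β x
  rw [e1, e2, ← FormField.inChart_self α, ← FormField.inChart_self β]
  exact (congrArg (fun η : E [⋀^Fin (k + l + 1)]→L[ℝ] ℝ => η v) e).trans
    (extDeriv_wedge_apply hα hβ v)

omit [FiniteDimensional ℝ E] [I.Boundaryless] in
theorem FormField.d_smul {k : ℕ} (r : ℝ) (α : FormField I M k) (x : M) :
    FormField.d (fun y => r • α y : FormField I M k) x = r • α.d x := by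
  have h : FormField.inChart (fun y => r • α y : FormField I M k) x = r • α.inChart x := rfl
  have e1 : FormField.d (fun y => r • α y : FormField I M k) x = _ := FormField.d_eq _ x
  have e2 : α.d x = _ := FormField.d_eq α x
  rw [e1, e2, h]
  exact extDeriv_smul r _

omit [FiniteDimensional ℝ E] [I.Boundaryless] [IsManifold I ∞ M] in
theorem FormField.differentiableAt_smul {k : ℕ} (r : ℝ) {α : FormField I M k} {x : M}
    (hα : DifferentiableAt ℝ (α.inChart x) (extChartAt I x x)) :
    DifferentiableAt ℝ (FormField.inChart (fun y => r • α y : FormField I M k) x)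
      (extChartAt I x x) :=
  hα.const_smul r

omit [I.Boundaryless] [IsManifold I ∞ M] in
theorem FormField.differentiableAt_wedge {k l : ℕ} {α : FormField I M k} {β : FormField I M l}
    {x : M} (hα : DifferentiableAt ℝ (α.inChart x) (extChartAt I x x))
    (hβ : DifferentiableAt ℝ (β.inChart x) (extChartAt I x x)) :
    DifferentiableAt ℝ ((α.wedge β).inChart x) (extChartAt I x x) := by
  have h : (α.wedge β).inChart x = fun z => Sugra.wedge (α.inChart x z) (β.inChart x z) := by
    funext z
    exact wedge_compContinuousLinearMap _ _ _
  rw [h]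
  exact Sugra.differentiableAt_wedge hα hβ

variable {E' : Type*} [NormedAddCommGroup E'] [NormedSpace ℝ E'] [FiniteDimensional ℝ E']
  {H' : Type*} [TopologicalSpace H'] {I' : ModelWithCorners ℝ E' H'} {M' : Type*}
  [TopologicalSpace M'] [ChartedSpace H' M'] [I'.Boundaryless] [IsManifold I' ∞ M']

omit [FiniteDimensional ℝ E] [FiniteDimensional ℝ E'] in
theorem extDeriv_comp_fst {k : ℕ} {A : E → E [⋀^Fin k]→L[ℝ] ℝ} {z : E × E'}
    (hA : DifferentiableAt ℝ A z.1) :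
    DifferentiableAt ℝ (fun y : E × E' =>
      (A y.1).compContinuousLinearMap (ContinuousLinearMap.fst ℝ E E')) z ∧
    extDeriv (fun y : E × E' =>
      (A y.1).compContinuousLinearMap (ContinuousLinearMap.fst ℝ E E')) z =
      (extDeriv A z.1).compContinuousLinearMap (ContinuousLinearMap.fst ℝ E E') := by
  constructor
  · exact (ContinuousAlternatingMap.compContinuousLinearMapCLM
      (ContinuousLinearMap.fst ℝ E E')).differentiableAt.comp z (hA.comp z differentiableAt_fst)
  · have h := extDeriv_pullback (f := (Prod.fst : E × E' → E)) (x := z) (r := 2) hA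
      contDiffAt_fst (by simp)
    simpa only [fderiv_fst] using h

omit [FiniteDimensional ℝ E] [FiniteDimensional ℝ E'] in
theorem extDeriv_comp_snd {k : ℕ} {A : E' → E' [⋀^Fin k]→L[ℝ] ℝ} {z : E × E'}
    (hA : DifferentiableAt ℝ A z.2) :
    DifferentiableAt ℝ (fun y : E × E' =>
      (A y.2).compContinuousLinearMap (ContinuousLinearMap.snd ℝ E E')) z ∧
    extDeriv (fun y : E × E' =>
      (A y.2).compContinuousLinearMap (ContinuousLinearMap.snd ℝ E E')) z =
      (extDeriv A z.2).compContinuousLinearMap (ContinuousLinearMap.snd ℝ E E') := by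
  constructor
  · exact (ContinuousAlternatingMap.compContinuousLinearMapCLM
      (ContinuousLinearMap.snd ℝ E E')).differentiableAt.comp z (hA.comp z differentiableAt_snd)
  · have h := extDeriv_pullback (f := (Prod.snd : E × E' → E')) (x := z) (r := 2) hA
      contDiffAt_snd (by simp)
    simpa only [fderiv_snd] using h

omit [FiniteDimensional ℝ E] [IsManifold I ∞ M] [FiniteDimensional ℝ E'] [IsManifold I' ∞ M'] in
theorem eventually_mem_chart_targets (p : M × M') :
    ∀ᶠ z : E × E' in nhds (extChartAt I p.1 p.1, extChartAt I' p.2 p.2),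
      z.1 ∈ (extChartAt I p.1).target ∧ z.2 ∈ (extChartAt I' p.2).target :=
  prod_mem_nhds (extChartAt_target_mem_nhds p.1) (extChartAt_target_mem_nhds p.2)

theorem d_prodWedge_apply {k l : ℕ} {α : FormField I M k} {β : FormField I' M' l} (p : M × M')
    (hα : DifferentiableAt ℝ (α.inChart p.1) (extChartAt I p.1 p.1))
    (hβ : DifferentiableAt ℝ (β.inChart p.2) (extChartAt I' p.2 p.2))
    (v : Fin (k + l + 1) → E × E') :
    (prodWedge α β).d.model p v =
      boxWedge (α.d.model p.1) (β.model p.2)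
          (v ∘ Fin.cast (show k + 1 + l = k + l + 1 by omega)) +
        (-1) ^ k * boxWedge (α.model p.1) (β.d.model p.2) v := by
  have e := FormField.d_eq (prodWedge α β) p
  have hp : extChartAt (I.prod I') p p = (extChartAt I p.1 p.1, extChartAt I' p.2 p.2) := by
    rw [extChartAt_prod]; rfl
  have h : (prodWedge α β).inChart p =ᶠ[nhds (extChartAt I p.1 p.1, extChartAt I' p.2 p.2)]
      fun z => boxWedge (α.inChart p.1 z.1) (β.inChart p.2 z.2) :=
    (eventually_mem_chart_targets p).mono fun z hz => prodWedge_inChart α β p hz.1 hz.2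
  rw [hp, h.extDeriv_eq] at e
  have e1 : α.d.model p.1 = _ := FormField.d_eq α p.1
  have e2 : β.d.model p.2 = _ := FormField.d_eq β p.2
  rw [e1, e2, ← FormField.inChart_self α, ← FormField.inChart_self β]
  obtain ⟨a1, a2⟩ := extDeriv_comp_fst (E' := E')
    (z := (extChartAt I p.1 p.1, extChartAt I' p.2 p.2)) hα
  obtain ⟨b1, b2⟩ := extDeriv_comp_snd (E := E)
    (z := (extChartAt I p.1 p.1, extChartAt I' p.2 p.2)) hβ
  have key := extDeriv_wedge_apply a1 b1 v
  rw [a2, b2] at key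
  exact (congrArg (fun η : (E × E') [⋀^Fin (k + l + 1)]→L[ℝ] ℝ => η v) e).trans key

end ManifoldCalculus

section ProductCurvature

variable {E : Type*} [NormedAddCommGroup E] [NormedSpace ℝ E] [FiniteDimensional ℝ E]
  {E' : Type*} [NormedAddCommGroup E'] [NormedSpace ℝ E'] [FiniteDimensional ℝ E']

omit [FiniteDimensional ℝ E] in
theorem christoffel_congr {G G' : E → E →L[ℝ] E →L[ℝ] ℝ} {y : E} (h : G =ᶠ[nhds y] G') :
    christoffel G y = christoffel G' y := by
  rw [christoffel, christoffel, christoffelFirst, christoffelFirst, h.fderiv_eq, h.self_of_nhds]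

omit [FiniteDimensional ℝ E] in
theorem curvatureEnd_congr {G G' : E → E →L[ℝ] E →L[ℝ] ℝ} {y : E} (h : G =ᶠ[nhds y] G') (v w : E) :
    curvatureEnd G y v w = curvatureEnd G' y v w := by
  have h1 : christoffel G =ᶠ[nhds y] christoffel G' :=
    h.eventuallyEq_nhds.mono fun z hz => christoffel_congr hz
  rw [curvatureEnd, curvatureEnd, h1.fderiv_eq, h1.self_of_nhds]

theorem differentiableAt_christoffel {G : E → E →L[ℝ] E →L[ℝ] ℝ} {y : E}
    (hG : ContDiffAt ℝ 2 G y) (hinv : (G y).IsInvertible) :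
    DifferentiableAt ℝ (christoffel G) y := by
  have hd : DifferentiableAt ℝ (fderiv ℝ G) y :=
    (hG.fderiv_right (m := 1) (by norm_num)).differentiableAt (by simp)
  have h1 : DifferentiableAt ℝ (christoffelFirst G) y := by
    have hf : DifferentiableAt ℝ (fun z => (fderiv ℝ G z).flip) y :=
      ((ContinuousLinearMap.flipₗᵢ ℝ E E (E →L[ℝ] ℝ)).toContinuousLinearEquiv.differentiableAt).comp
        y hd
    unfold christoffelFirst
    exact ((hd.add hf).sub ((differentiableAt_const _).clm_comp hf)).const_smul (1 / 2 : ℝ)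
  have h2 : DifferentiableAt ℝ (fun z => (G z).inverse) y := by
    obtain ⟨e, he⟩ := hinv
    have h3 : DifferentiableAt ℝ (ContinuousLinearMap.inverse : (E →L[ℝ] E →L[ℝ] ℝ) → _) (G y) := by
      rw [← he]
      exact (contDiffAt_map_inverse (n := 1) e).differentiableAt (by simp)
    exact h3.comp y (hG.differentiableAt (by simp))
  unfold christoffel
  exact ((ContinuousLinearMap.compL ℝ E (E →L[ℝ] ℝ) E).differentiableAt.comp y h2).clm_comp h1

/-- The product of two bilinear forms. -/
noncomputable def prodForm (g : E →L[ℝ] E →L[ℝ] ℝ) (g' : E' →L[ℝ] E' →L[ℝ] ℝ) :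
    (E × E') →L[ℝ] (E × E') →L[ℝ] ℝ :=
  (ContinuousLinearMap.precomp ℝ (ContinuousLinearMap.fst ℝ E E')).comp
      (g.comp (ContinuousLinearMap.fst ℝ E E')) +
    (ContinuousLinearMap.precomp ℝ (ContinuousLinearMap.snd ℝ E E')).comp
      (g'.comp (ContinuousLinearMap.snd ℝ E E'))

omit [FiniteDimensional ℝ E] [FiniteDimensional ℝ E'] in
theorem prodForm_apply (g : E →L[ℝ] E →L[ℝ] ℝ) (g' : E' →L[ℝ] E' →L[ℝ] ℝ) (u v : E × E') :
    prodForm g g' u v = g u.1 v.1 + g' u.2 v.2 := rfl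

omit [FiniteDimensional ℝ E] [FiniteDimensional ℝ E'] in
theorem contDiffAt_prodForm {n : ℕ∞ω} {G : E → E →L[ℝ] E →L[ℝ] ℝ}
    {G' : E' → E' →L[ℝ] E' →L[ℝ] ℝ} {z : E × E'} (hG : ContDiffAt ℝ n G z.1)
    (hG' : ContDiffAt ℝ n G' z.2) :
    ContDiffAt ℝ n (fun z : E × E' => prodForm (G z.1) (G' z.2)) z := by
  have h1 : ContDiffAt ℝ n (fun z : E × E' => G z.1) z := hG.comp z contDiffAt_fst
  have h2 : ContDiffAt ℝ n (fun z : E × E' => G' z.2) z := hG'.comp z contDiffAt_snd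
  exact (contDiffAt_const.clm_comp (h1.clm_comp contDiffAt_const)).add
    (contDiffAt_const.clm_comp (h2.clm_comp contDiffAt_const))

theorem isInvertible_iff_injective (g : E →L[ℝ] E →L[ℝ] ℝ) :
    g.IsInvertible ↔ ∀ u, (∀ v, g u v = 0) → u = 0 := by
  constructor
  · rintro ⟨e, rfl⟩ u hu
    have : e u = 0 := ContinuousLinearMap.ext hu
    simpa using this
  · intro h
    have hinj : Function.Injective (g : E →ₗ[ℝ] E →L[ℝ] ℝ) :=
      (injective_iff_map_eq_zero _).2 fun u hu => h u fun v => congrArg (fun L : E →L[ℝ] ℝ => L v) hu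
    have hd : Module.finrank ℝ E = Module.finrank ℝ (E →L[ℝ] ℝ) := by
      rw [← LinearEquiv.finrank_eq (LinearMap.toContinuousLinearMap (𝕜 := ℝ) (E := E) (F' := ℝ))]
      exact (Subspace.dual_finrank_eq (K := ℝ) (V := E)).symm
    refine ⟨(LinearEquiv.ofInjectiveOfFinrankEq _ hinj hd).toContinuousLinearEquiv, ?_⟩
    ext u v
    rfl

theorem isInvertible_prodForm {g : E →L[ℝ] E →L[ℝ] ℝ} {g' : E' →L[ℝ] E' →L[ℝ] ℝ}
    (hg : g.IsInvertible) (hg' : g'.IsInvertible) : (prodForm g g').IsInvertible := by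
  rw [isInvertible_iff_injective] at hg hg' ⊢
  intro u hu
  refine Prod.ext (hg _ fun v => ?_) (hg' _ fun v => ?_)
  · simpa [prodForm_apply] using hu (v, 0)
  · simpa [prodForm_apply] using hu (0, v)

omit [FiniteDimensional ℝ E] in
theorem christoffel_inner {G : E → E →L[ℝ] E →L[ℝ] ℝ} {y : E} (hinv : (G y).IsInvertible)
    (u v w : E) : G y (christoffel G y u v) w = christoffelFirst G y u v w := by
  rw [christoffel_apply, hinv.self_apply_inverse]

omit [FiniteDimensional ℝ E] [FiniteDimensional ℝ E'] in
theorem fderiv_prodForm_apply {G : E → E →L[ℝ] E →L[ℝ] ℝ}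
    {G' : E' → E' →L[ℝ] E' →L[ℝ] ℝ} {z : E × E'} (hG : DifferentiableAt ℝ G z.1)
    (hG' : DifferentiableAt ℝ G' z.2) (u v w : E × E') :
    fderiv ℝ (fun z : E × E' => prodForm (G z.1) (G' z.2)) z u v w =
      fderiv ℝ G z.1 u.1 v.1 w.1 + fderiv ℝ G' z.2 u.2 v.2 w.2 := by
  have h1 : HasFDerivAt (fun z : E × E' => G z.1) _ z := hG.hasFDerivAt.comp z hasFDerivAt_fst
  have h2 : HasFDerivAt (fun z : E × E' => G' z.2) _ z := hG'.hasFDerivAt.comp z hasFDerivAt_snd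
  have h := ((hasFDerivAt_const (ContinuousLinearMap.precomp ℝ (ContinuousLinearMap.fst ℝ E E')) z).clm_comp
    (h1.clm_comp (hasFDerivAt_const (ContinuousLinearMap.fst ℝ E E') z))).add
    ((hasFDerivAt_const (ContinuousLinearMap.precomp ℝ (ContinuousLinearMap.snd ℝ E E')) z).clm_comp
    (h2.clm_comp (hasFDerivAt_const (ContinuousLinearMap.snd ℝ E E') z)))
  have h3 := congrArg (fun L : (E × E') →L[ℝ] (E × E') →L[ℝ] (E × E') →L[ℝ] ℝ => L u v w) h.fderiv
  refine Eq.trans h3 ?_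
  simp

theorem christoffel_prodForm {G : E → E →L[ℝ] E →L[ℝ] ℝ}
    {G' : E' → E' →L[ℝ] E' →L[ℝ] ℝ} {z : E × E'} (hG : DifferentiableAt ℝ G z.1)
    (hG' : DifferentiableAt ℝ G' z.2) (hi : (G z.1).IsInvertible) (hi' : (G' z.2).IsInvertible)
    (u v : E × E') :
    christoffel (fun z : E × E' => prodForm (G z.1) (G' z.2)) z u v =
      (christoffel G z.1 u.1 v.1, christoffel G' z.2 u.2 v.2) := by
  have hinv := isInvertible_prodForm hi hi'
  rw [christoffel_apply]
  have h : christoffelFirst (fun z : E × E' => prodForm (G z.1) (G' z.2)) z u v =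
      prodForm (G z.1) (G' z.2) (christoffel G z.1 u.1 v.1, christoffel G' z.2 u.2 v.2) := by
    refine ContinuousLinearMap.ext fun w => ?_
    rw [christoffelFirst_apply, prodForm_apply, christoffel_inner hi, christoffel_inner hi',
      fderiv_prodForm_apply hG hG', fderiv_prodForm_apply hG hG', fderiv_prodForm_apply hG hG',
      christoffelFirst_apply, christoffelFirst_apply]
    ring
  rw [h, hinv.inverse_apply_self]

omit [FiniteDimensional ℝ E] in
theorem fderiv_clm_apply_apply {X : Type*} [NormedAddCommGroup X] [NormedSpace ℝ X]
    {F : X → E →L[ℝ] E →L[ℝ] E} {x : X} (hF : DifferentiableAt ℝ F x) (u : X) (v w : E) :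
    fderiv ℝ (fun y => F y v w) x u = fderiv ℝ F x u v w := by
  have h := (hF.hasFDerivAt.clm_apply (hasFDerivAt_const v x)).clm_apply (hasFDerivAt_const w x)
  rw [h.fderiv]
  simp

theorem eventually_isInvertible {X : Type*} [TopologicalSpace X] {G : X → E →L[ℝ] E →L[ℝ] ℝ} {x : X}
    (hG : ContinuousAt G x) (hi : (G x).IsInvertible) : ∀ᶠ y in nhds x, (G y).IsInvertible :=
  hG.eventually ((ContinuousLinearEquiv.isOpen (E := E) (F := E →L[ℝ] ℝ)).mem_nhds hi)

theorem curvatureEnd_prodForm {G : E → E →L[ℝ] E →L[ℝ] ℝ}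
    {G' : E' → E' →L[ℝ] E' →L[ℝ] ℝ} {z : E × E'} (hG : ContDiffAt ℝ 2 G z.1)
    (hG' : ContDiffAt ℝ 2 G' z.2) (hi : (G z.1).IsInvertible) (hi' : (G' z.2).IsInvertible)
    (u v w : E × E') :
    curvatureEnd (fun z : E × E' => prodForm (G z.1) (G' z.2)) z v w u =
      (curvatureEnd G z.1 v.1 w.1 u.1, curvatureEnd G' z.2 v.2 w.2 u.2) := by
  set K := fun z : E × E' => prodForm (G z.1) (G' z.2) with hK
  have hd1 : ∀ᶠ y in nhds z.1, DifferentiableAt ℝ G y ∧ (G y).IsInvertible :=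
    ((hG.eventually (by simp)).mono fun y hy => hy.differentiableAt (by simp)).and
      (eventually_isInvertible hG.continuousAt hi)
  have hd2 : ∀ᶠ y in nhds z.2, DifferentiableAt ℝ G' y ∧ (G' y).IsInvertible :=
    ((hG'.eventually (by simp)).mono fun y hy => hy.differentiableAt (by simp)).and
      (eventually_isInvertible hG'.continuousAt hi')
  have hev : ∀ᶠ y : E × E' in nhds z, ∀ a b : E × E', christoffel K y a b =
      (christoffel G y.1 a.1 b.1, christoffel G' y.2 a.2 b.2) := by
    have hd := (hd1.prodMk_nhds hd2 : ∀ᶠ y in nhds (z.1, z.2), _)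
    filter_upwards [hd] with y hy a b
    exact christoffel_prodForm hy.1.1 hy.2.1 hy.1.2 hy.2.2 a b
  have hz := hev.self_of_nhds
  have D1 := differentiableAt_christoffel hG hi
  have D2 := differentiableAt_christoffel hG' hi'
  have D : DifferentiableAt ℝ (christoffel K) z :=
    differentiableAt_christoffel (contDiffAt_prodForm hG hG') (isInvertible_prodForm hi hi')
  have hder : ∀ a b c : E × E', fderiv ℝ (christoffel K) z a b c =
      (fderiv ℝ (christoffel G) z.1 a.1 b.1 c.1, fderiv ℝ (christoffel G') z.2 a.2 b.2 c.2) := by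
    intro a b c
    rw [← fderiv_clm_apply_apply D, ← fderiv_clm_apply_apply D1, ← fderiv_clm_apply_apply D2]
    have e : (fun y => christoffel K y b c) =ᶠ[nhds z]
        fun y => (christoffel G y.1 b.1 c.1, christoffel G' y.2 b.2 c.2) :=
      hev.mono fun y hy => hy b c
    rw [e.fderiv_eq]
    have k1 : DifferentiableAt ℝ (fun y => christoffel G y b.1 c.1) z.1 :=
      (D1.clm_apply (differentiableAt_const _)).clm_apply (differentiableAt_const _)
    have k2 : DifferentiableAt ℝ (fun y => christoffel G' y b.2 c.2) z.2 :=
      (D2.clm_apply (differentiableAt_const _)).clm_apply (differentiableAt_const _)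
    have l1 : HasFDerivAt (fun y : E × E' => christoffel G y.1 b.1 c.1) _ z :=
      k1.hasFDerivAt.comp z hasFDerivAt_fst
    have l2 : HasFDerivAt (fun y : E × E' => christoffel G' y.2 b.2 c.2) _ z :=
      k2.hasFDerivAt.comp z hasFDerivAt_snd
    rw [(l1.prodMk l2).fderiv]
    rfl
  rw [curvatureEnd_apply, curvatureEnd_apply, curvatureEnd_apply, hder, hder]
  simp only [hz]
  rfl

theorem flatRicci_prodForm {G : E → E →L[ℝ] E →L[ℝ] ℝ}
    {G' : E' → E' →L[ℝ] E' →L[ℝ] ℝ} {z : E × E'} (hG : ContDiffAt ℝ 2 G z.1)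
    (hG' : ContDiffAt ℝ 2 G' z.2) (hi : (G z.1).IsInvertible) (hi' : (G' z.2).IsInvertible)
    (v w : E × E') :
    flatRicci (fun z : E × E' => prodForm (G z.1) (G' z.2)) z v w =
      flatRicci G z.1 v.1 w.1 + flatRicci G' z.2 v.2 w.2 := by
  rw [flatRicci, flatRicci, flatRicci, ← LinearMap.trace_prodMap']
  congr 1
  ext1 <;> ext1 u <;> exact curvatureEnd_prodForm hG hG' hi hi' _ v w

end ProductCurvature

section Ricci

variable {E : Type*} [NormedAddCommGroup E] [NormedSpace ℝ E] [FiniteDimensional ℝ E]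
  {H : Type*} [TopologicalSpace H]
  {I : ModelWithCorners ℝ E H} {M : Type*} [TopologicalSpace M] [ChartedSpace H M]
  [I.Boundaryless] [IsManifold I ∞ M]
  {E' : Type*} [NormedAddCommGroup E'] [NormedSpace ℝ E'] [FiniteDimensional ℝ E']
  {H' : Type*} [TopologicalSpace H'] {I' : ModelWithCorners ℝ E' H'} {M' : Type*}
  [TopologicalSpace M'] [ChartedSpace H' M'] [I'.Boundaryless] [IsManifold I' ∞ M']

theorem IsFrame.isInvertible {κ : Type*} [Fintype κ] [DecidableEq κ] {g : E →L[ℝ] E →L[ℝ] ℝ}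
    {b : Module.Basis κ ℝ E} {c : κ → ℝ} (hb : IsFrame g b c) : g.IsInvertible := by
  rw [isInvertible_iff_injective]
  intro u hu
  refine b.repr.map_eq_zero_iff.1 (Finsupp.ext fun i => ?_)
  rw [hb.repr_eq, hb.symm, hu, mul_zero]
  rfl

/-- The Ricci tensor of a product metric. -/
theorem ricci_prodMetric {g : BilinField I M} {g' : BilinField I' M'} (hs : g.IsSmooth)
    (hs' : g'.IsSmooth) (p : M × M') (hi : (g.model p.1).IsInvertible)
    (hi' : (g'.model p.2).IsInvertible) (u v : E × E') :
    ricci (prodMetric g g') p u v =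
      ricci g p.1 u.1 v.1 + ricci g' p.2 u.2 v.2 := by
  rw [ricci_eq, ricci_eq, ricci_eq]
  have hp : extChartAt (I.prod I') p p = (extChartAt I p.1 p.1, extChartAt I' p.2 p.2) := by
    rw [extChartAt_prod]; rfl
  have h : (prodMetric g g').inChart p =ᶠ[nhds (extChartAt I p.1 p.1, extChartAt I' p.2 p.2)]
      fun z => prodForm (g.inChart p.1 z.1) (g'.inChart p.2 z.2) :=
    (eventually_mem_chart_targets p).mono fun z hz =>
      ContinuousLinearMap.ext fun u => ContinuousLinearMap.ext fun v =>
        prodMetric_inChart g g' p hz.1 hz.2 u v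
  rw [hp, flatRicci, curvatureEnd_congr h]
  refine flatRicci_prodForm (z := (extChartAt I p.1 p.1, extChartAt I' p.2 p.2))
    ((hs.contDiffAt p.1).of_le (WithTop.coe_le_coe.2 le_top)) ((hs'.contDiffAt p.2).of_le (WithTop.coe_le_coe.2 le_top)) ?_ ?_ u v
  · rwa [BilinField.inChart_self]
  · rwa [BilinField.inChart_self]

end Ricci

section Background

theorem boxWedge_eq_boxWedge_iff {V W : Type*} [AddCommGroup V] [Module ℝ V] [TopologicalSpace V]
    [AddCommGroup W] [Module ℝ W] [TopologicalSpace W] {k l : ℕ} (r : ℝ) (hr : r ≠ 0)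
    (α α' : V [⋀^Fin k]→L[ℝ] ℝ) {β : W [⋀^Fin l]→L[ℝ] ℝ} (hβ : β ≠ 0) :
    (∀ v, boxWedge α (r • β) v = r * boxWedge α' β v) ↔ α = α' := by
  constructor
  · intro h
    have h1 : boxWedge (α + (-1 : ℝ) • α') β = 0 := by
      ext v
      have h2 := h v
      rw [boxWedge_smul_right] at h2
      have h3 : boxWedge α β v = boxWedge α' β v := mul_left_cancel₀ hr h2
      rw [boxWedge_add_left, boxWedge_smul_left, ContinuousAlternatingMap.add_apply, h3,
        ContinuousAlternatingMap.smul_apply]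
      simp
    have h2 := boxWedge_eq_zero_left h1 hβ
    rw [neg_one_smul, ← sub_eq_add_neg, sub_eq_zero] at h2
    exact h2
  · rintro rfl v
    rw [boxWedge_smul_right]
    rfl

theorem wedge_boxWedge_boxWedge {V W : Type*} [AddCommGroup V] [Module ℝ V] [TopologicalSpace V]
    [AddCommGroup W] [Module ℝ W] [TopologicalSpace W] (γ : V [⋀^Fin 2]→L[ℝ] ℝ)
    (δ : W [⋀^Fin 2]→L[ℝ] ℝ) :
    wedge (boxWedge γ δ) (boxWedge γ δ) = boxWedge (wedge γ γ) (wedge δ δ) := by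
  rw [boxWedge, boxWedge, wedge_wedge_wedge_comm, wedge_compContinuousLinearMap,
    wedge_compContinuousLinearMap]

theorem wedge_boxWedge_boxWedge_apply {V W : Type*} [AddCommGroup V] [Module ℝ V]
    [TopologicalSpace V] [AddCommGroup W] [Module ℝ W] [TopologicalSpace W] {k l : ℕ}
    (hk : k = 2) (hl : l = 2) (γ : V [⋀^Fin k]→L[ℝ] ℝ) (δ : W [⋀^Fin l]→L[ℝ] ℝ)
    (v : Fin ((k + l) + (k + l)) → V × W) :
    wedge (boxWedge γ δ) (boxWedge γ δ) v = boxWedge (wedge γ γ) (wedge δ δ)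
      (v ∘ Fin.cast (show (k + k) + (l + l) = (k + l) + (k + l) by omega)) := by
  subst hk hl
  obtain ⟨B, hB⟩ : ∃ B, boxWedge (wedge γ γ) (wedge δ δ) = B := ⟨_, rfl⟩
  rw [wedge_boxWedge_boxWedge, hB]
  rfl

theorem flatRicci_zero {E : Type*} [NormedAddCommGroup E] [NormedSpace ℝ E]
    (G : E → E →L[ℝ] E →L[ℝ] ℝ) (y : E) : flatRicci G y 0 0 = 0 := by
  have h : curvatureEnd G y 0 0 = 0 := by
    ext u
    simp [curvatureEnd_apply]
  rw [flatRicci, h]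
  simp

theorem formInner_zero_left {V : Type*} [AddCommGroup V] [Module ℝ V] [TopologicalSpace V]
    [FiniteDimensional ℝ V] (g : V →L[ℝ] V →L[ℝ] ℝ) {k : ℕ} (φ : V [⋀^Fin k]→L[ℝ] ℝ) :
    formInner g 0 φ = 0 := by
  simp [formInner]

variable {E : Type*} [NormedAddCommGroup E] [NormedSpace ℝ E] [FiniteDimensional ℝ E]
  {H : Type*} [TopologicalSpace H]
  {I : ModelWithCorners ℝ E H} {N : Type*} [TopologicalSpace N] [ChartedSpace H N]
  [I.Boundaryless] [IsManifold I ∞ N]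
  {E' : Type*} [NormedAddCommGroup E'] [NormedSpace ℝ E'] [FiniteDimensional ℝ E']
  {H' : Type*} [TopologicalSpace H'] {I' : ModelWithCorners ℝ E' H'} {M : Type*}
  [TopologicalSpace M] [ChartedSpace H' M] [I'.Boundaryless] [IsManifold I' ∞ M]

omit [FiniteDimensional ℝ E] [I.Boundaryless] [IsManifold I ∞ N] in
theorem FormField.wedge_model {k l : ℕ} (α : FormField I N k) (β : FormField I N l) (p : N) :
    (α.wedge β).model p = Sugra.wedge (α.model p) (β.model p) := rfl

theorem hodge_boxWedge_of_normed {κ κ' : Type*} [Fintype κ] [DecidableEq κ] [Fintype κ'] [DecidableEq κ'] {g : E →L[ℝ] E →L[ℝ] ℝ} {g' : E' →L[ℝ] E' →L[ℝ] ℝ}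
  {h : (E × E') →L[ℝ] (E × E') →L[ℝ] ℝ}
  {b : Module.Basis κ ℝ E} {c : κ → ℝ} {b' : Module.Basis κ' ℝ E'} {c' : κ' → ℝ} (hb : IsFrame g b c) (hb' : IsFrame g' b' c')
    (hh : ∀ u v, h u v = g u.1 v.1 + g' u.2 v.2)
    (volV : E [⋀^Fin 5]→L[ℝ] ℝ) (volW : E' [⋀^Fin 6]→L[ℝ] ℝ)
    (γ : E [⋀^Fin 2]→L[ℝ] ℝ) (δ : E' [⋀^Fin 2]→L[ℝ] ℝ) (vol : (E × E') [⋀^Fin (4 + 7)]→L[ℝ] ℝ)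
    (hvol : boxWedge (k := 5) (l := 6) volV volW = vol) (F : (E × E') [⋀^Fin 4]→L[ℝ] ℝ)
    (hF : boxWedge (k := 2) (l := 2) γ δ = F) (x : Fin 7 → E × E') :
    hodge h (k := 4) (m := 7) vol F x =
      boxWedge (k := 3) (l := 4) (hodge g (k := 2) (m := 3) volV γ)
        (hodge g' (k := 2) (m := 4) volW δ) (x ∘ Fin.cast (show 3 + 4 = 7 from rfl)) :=
  hodge_boxWedge hb hb' hh volV volW γ δ vol hvol F hF x

omit [I.Boundaryless] [IsManifold I ∞ N] in
theorem FormField.star_model (g : BilinField I N) {k m : ℕ} (vol : FormField I N (k + m))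
    (β : FormField I N k) (x : N) :
    (FormField.star g vol β).model x = hodge (g.model x) (vol.model x) (β.model x) := rfl

omit [I.Boundaryless] [IsManifold I ∞ N] [I'.Boundaryless] [IsManifold I' ∞ M] in
theorem star_prodWedge_apply {κ κ' : Type*} [Fintype κ] [DecidableEq κ] [Fintype κ']
    [DecidableEq κ'] {gt : BilinField I N} {volN : FormField I N 5} {g : BilinField I' M}
    {volM : FormField I' M 6} {γ : FormField I N 2} {δ : FormField I' M 2} (p : N × M)
    {b : Module.Basis κ ℝ E} {c : κ → ℝ} (hb : IsFrame (gt.model p.1) b c)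
    {b' : Module.Basis κ' ℝ E'} {c' : κ' → ℝ} (hb' : IsFrame (g.model p.2) b' c')
    (vol : FormField (I.prod I') (N × M) (4 + 7))
    (hvol : prodWedge (k := 5) (l := 6) volN volM = vol)
    (F : FormField (I.prod I') (N × M) 4) (hF : prodWedge (k := 2) (l := 2) γ δ = F)
    (v : Fin 7 → E × E') :
    (FormField.star (prodMetric gt g) (k := 4) (m := 7) vol F).model p v =
      boxWedge (k := 3) (l := 4) ((FormField.star gt (k := 2) (m := 3) volN γ).model p.1)
        ((FormField.star g (k := 2) (m := 4) volM δ).model p.2)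
        (v ∘ Fin.cast (show 3 + 4 = 7 from rfl)) :=
by
  have hv : boxWedge (k := 5) (l := 6) (volN.model p.1) (volM.model p.2) = vol.model p := by
    have h1 := prodWedge_model volN volM p
    rw [hvol] at h1
    exact h1.symm
  have hF' : boxWedge (k := 2) (l := 2) (γ.model p.1) (δ.model p.2) = F.model p := by
    have h1 := prodWedge_model γ δ p
    rw [hF] at h1
    exact h1.symm
  have hN : volN.model p.1 = FormField.model (k := 2 + 3) volN p.1 := rfl
  have hM : volM.model p.2 = FormField.model (k := 2 + 4) volM p.2 := rfl
  rw [FormField.star_model, FormField.star_model, FormField.star_model]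
  rw [← hN, ← hM]
  generalize volN.model p.1 = vN at *
  generalize volM.model p.2 = vM at *
  exact hodge_boxWedge_of_normed hb hb' (prodMetric_model gt g p) _ _ _ _ _ hv _ hF' v

theorem boxWedge_cast_eq_iff {V W : Type*} [AddCommGroup V] [Module ℝ V] [TopologicalSpace V]
    [AddCommGroup W] [Module ℝ W] [TopologicalSpace W] {k k' l l' n : ℕ} (hk : k' = k) (hl : l' = l)
    (h : k + l = n) (h' : k' + l' = n) (r : ℝ) (hr : r ≠ 0) (α : V [⋀^Fin k]→L[ℝ] ℝ)
    (α' : V [⋀^Fin k']→L[ℝ] ℝ) (β : W [⋀^Fin l]→L[ℝ] ℝ) {β' : W [⋀^Fin l']→L[ℝ] ℝ} (hβ' : β' ≠ 0)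
    (hβ : ∀ x, β x = r * β' (x ∘ Fin.cast hl)) :
    (∀ v : Fin n → V × W, boxWedge α β (v ∘ Fin.cast h) = r * boxWedge α' β' (v ∘ Fin.cast h')) ↔
      ∀ x, α x = α' (x ∘ Fin.cast hk) := by
  subst hk hl h
  have e : β = r • β' := ContinuousAlternatingMap.ext hβ
  subst e
  exact (boxWedge_eq_boxWedge_iff r hr α α' hβ').trans DFunLike.ext_iff

theorem d_apply_of_eq_boxWedge {k l n : ℕ} (h : k + l = n)
    (η : FormField (I.prod I') (N × M) n) (α : FormField I N k) (β : FormField I' M l)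
    (e : ∀ p (v : Fin n → E × E'),
      η.model p v = boxWedge (α.model p.1) (β.model p.2) (v ∘ Fin.cast h)) (p : N × M)
    (hα : DifferentiableAt ℝ (α.inChart p.1) (extChartAt I p.1 p.1))
    (hβ : DifferentiableAt ℝ (β.inChart p.2) (extChartAt I' p.2 p.2))
    (hd : β.d.model p.2 = 0) (v : Fin (n + 1) → E × E') :
    η.d.model p v = boxWedge (α.d.model p.1) (β.model p.2)
      (v ∘ Fin.cast (show k + 1 + l = n + 1 by omega)) := by
  subst h
  have h1 : η = prodWedge α β := funext fun p => ContinuousAlternatingMap.ext fun v =>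
    (e p v).trans (DFunLike.congr_fun (prodWedge_model α β p).symm v)
  rw [h1, d_prodWedge_apply p hα hβ, hd, boxWedge_zero_right]
  simp

omit [FiniteDimensional ℝ E] [FiniteDimensional ℝ E'] [I.Boundaryless] [IsManifold I ∞ N]
  [I'.Boundaryless] [IsManifold I' ∞ M] in
theorem wedge_self_apply_of_eq_boxWedge {k l n : ℕ} (h : k + l = n) (γ : FormField I N k)
    (δ : FormField I' M l) (F : FormField (I.prod I') (N × M) n)
    (hF : ∀ p (v : Fin n → E × E'), F.model p v =
      boxWedge (γ.model p.1) (δ.model p.2) (v ∘ Fin.cast h)) (p : N × M)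
    (v : Fin (n + n) → E × E') :
    (F.wedge F).model p v = Sugra.wedge (boxWedge (γ.model p.1) (δ.model p.2))
      (boxWedge (γ.model p.1) (δ.model p.2))
      (v ∘ Fin.cast (show (k + l) + (k + l) = n + n by omega)) := by
  subst h
  have h1 : F.model p = boxWedge (γ.model p.1) (δ.model p.2) :=
    ContinuousAlternatingMap.ext fun v => hF p v
  rw [FormField.wedge_model, h1]
  rfl

omit [FiniteDimensional ℝ E] [FiniteDimensional ℝ E'] [I.Boundaryless] [IsManifold I ∞ N]
  [I'.Boundaryless] [IsManifold I' ∞ M] in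
theorem wedge_self_apply_of_eq_prodWedge {k l n : ℕ} (h : k + l = n) (γ : FormField I N k)
    (δ : FormField I' M l) (F : FormField (I.prod I') (N × M) n)
    (hF : ∀ p (v : Fin n → E × E'), F.model p v =
      boxWedge (γ.model p.1) (δ.model p.2) (v ∘ Fin.cast h)) (p : N × M)
    (hw : ∀ v, Sugra.wedge (boxWedge (γ.model p.1) (δ.model p.2))
      (boxWedge (γ.model p.1) (δ.model p.2)) v =
        boxWedge (Sugra.wedge (γ.model p.1) (γ.model p.1))
          (Sugra.wedge (δ.model p.2) (δ.model p.2))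
          (v ∘ Fin.cast (show (k + k) + (l + l) = (k + l) + (k + l) by omega)))
    (v : Fin (n + n) → E × E') :
    (F.wedge F).model p v = boxWedge ((γ.wedge γ).model p.1) ((δ.wedge δ).model p.2)
      (v ∘ Fin.cast (show (k + k) + (l + l) = n + n by omega)) := by
  rw [wedge_self_apply_of_eq_boxWedge h γ δ F hF, FormField.wedge_model, FormField.wedge_model, hw]
  rfl

end Background

section Equations

variable {E : Type*} [NormedAddCommGroup E] [NormedSpace ℝ E] [FiniteDimensional ℝ E]
  {H : Type*} [TopologicalSpace H]
  {I : ModelWithCorners ℝ E H} {N : Type*} [TopologicalSpace N] [ChartedSpace H N]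
  [I.Boundaryless] [IsManifold I ∞ N]
  {E' : Type*} [NormedAddCommGroup E'] [NormedSpace ℝ E'] [FiniteDimensional ℝ E']
  {H' : Type*} [TopologicalSpace H'] {I' : ModelWithCorners ℝ E' H'} {M : Type*}
  [TopologicalSpace M] [ChartedSpace H' M] [I'.Boundaryless] [IsManifold I' ∞ M]

theorem d_prodWedge_eq_zero {k l : ℕ} {α : FormField I N k} {β : FormField I' M l}
    (hα : α.IsSmooth) (hβ : β.IsSmooth) (hdα : ∀ x, α.d x = 0) (hdβ : ∀ y, β.d y = 0)
    (p : N × M) : (prodWedge α β).d p = 0 := by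
  refine ContinuousAlternatingMap.ext fun v => ?_
  refine (d_prodWedge_apply p (hα.differentiableAt p.1) (hβ.differentiableAt p.2) v).trans ?_
  have h1 : α.d.model p.1 = 0 := hdα p.1
  have h2 : β.d.model p.2 = 0 := hdβ p.2
  rw [h1, h2, boxWedge_zero_left, boxWedge_zero_right]
  exact (show (0 : ℝ) + (-1) ^ k * 0 = 0 by simp)

theorem d_wedge_self_eq_zero {k : ℕ} {β : FormField I' M k}
    (hβ : β.IsSmooth) (hdβ : ∀ y, β.d y = 0) (y : M) : (β.wedge β).d.model y = 0 := by
  refine ContinuousAlternatingMap.ext fun v => ?_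
  refine (FormField.d_wedge_apply y (hβ.differentiableAt y) (hβ.differentiableAt y) v).trans ?_
  have h2 : β.d.model y = 0 := hdβ y
  rw [h2, wedge_zero_left, wedge_zero_right]
  simp

theorem d_eq_iff_of_eq_boxWedge [Nonempty M] {k l n : ℕ} (h : k + l = n) (r : ℝ) (hr : r ≠ 0)
    (η : FormField (I.prod I') (N × M) n) (φ : FormField (I.prod I') (N × M) (n + 1))
    (α : FormField I N k) (α' : FormField I N (k + 1)) (β β' : FormField I' M l)
    (hη : ∀ p (v : Fin n → E × E'),
      η.model p v = boxWedge (α.model p.1) (β.model p.2) (v ∘ Fin.cast h))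
    (hφ : ∀ p (v : Fin (n + 1) → E × E'), φ.model p v =
      boxWedge (α'.model p.1) (β'.model p.2) (v ∘ Fin.cast (show k + 1 + l = n + 1 by omega)))
    (hβ : ∀ y, β.model y = r • β'.model y) (hβ0 : ∀ y, β'.model y ≠ 0)
    (hα : ∀ x, DifferentiableAt ℝ (α.inChart x) (extChartAt I x x))
    (hβ' : ∀ y, DifferentiableAt ℝ (β'.inChart y) (extChartAt I' y y))
    (hd : ∀ y, β'.d.model y = 0) :
    (∀ p, η.d p = r • φ p) ↔ ∀ x, α.d x = α' x := by
  have h1 : β = fun y => r • β' y := funext fun y => hβ y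
  subst h1
  have hd1 : ∀ y, FormField.d (fun y => r • β' y) y = 0 := by
    intro y
    rw [FormField.d_smul r β' y]
    have h2 : β'.d y = 0 := hd y
    rw [h2]
    exact smul_zero r
  have hdη := fun p v => d_apply_of_eq_boxWedge h η α _ hη p (hα p.1)
    (FormField.differentiableAt_smul r (hβ' p.2)) (hd1 p.2) v
  have key : ∀ p : N × M, η.d p = r • φ p ↔ α.d p.1 = α' p.1 := by
    intro p
    refine Iff.trans ?_ (boxWedge_cast_eq_iff rfl rfl (show k + 1 + l = n + 1 by omega)
      (show k + 1 + l = n + 1 by omega) r hr (α.d.model p.1) (α'.model p.1)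
      (r • β'.model p.2) (hβ0 p.2) (fun x => rfl) |>.trans ?_)
    · constructor
      · intro e v
        refine (hdη p v).symm.trans ?_
        refine (congrArg (fun ψ : (E × E') [⋀^Fin (n + 1)]→L[ℝ] ℝ => ψ v) e).trans ?_
        exact congrArg (fun t => r * t) (hφ p v)
      · intro e
        refine ContinuousAlternatingMap.ext fun v => ?_
        refine (hdη p v).trans ((e v).trans ?_)
        exact congrArg (fun t => r * t) (hφ p v).symm
    · exact (DFunLike.ext_iff (F := E [⋀^Fin (k + 1)]→L[ℝ] ℝ)).symm
  constructor
  · intro e x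
    exact (key (x, Classical.arbitrary M)).1 (e _)
  · exact fun e p => (key p).2 (e p.1)

omit [FiniteDimensional ℝ E] [I.Boundaryless] [IsManifold I ∞ N] [FiniteDimensional ℝ E']
  [I'.Boundaryless] [IsManifold I' ∞ M] in
theorem eq_boxWedge_congr {k k' l l' n n' : ℕ} (hk : k = k') (hl : l = l') (hn : n = n')
    {φ : FormField (I.prod I') (N × M) n} {φ' : FormField (I.prod I') (N × M) n'}
    {α : FormField I N k} {α' : FormField I N k'} {β : FormField I' M l} {β' : FormField I' M l'}
    (hφ : HEq φ φ') (hα : HEq α α') (hβ : HEq β β') (h : k + l = n) (h' : k' + l' = n')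
    (e : ∀ p (v : Fin n → E × E'),
      φ.model p v = boxWedge (α.model p.1) (β.model p.2) (v ∘ Fin.cast h))
    (p : N × M) (v : Fin n' → E × E') :
    φ'.model p v = boxWedge (α'.model p.1) (β'.model p.2) (v ∘ Fin.cast h') := by
  subst hk hl hn
  obtain rfl := eq_of_heq hφ
  obtain rfl := eq_of_heq hα
  obtain rfl := eq_of_heq hβ
  exact e p v

omit [FiniteDimensional ℝ E] [I.Boundaryless] [IsManifold I ∞ N] [FiniteDimensional ℝ E']
  [I'.Boundaryless] [IsManifold I' ∞ M] in
theorem model_apply_of_heq_prodWedge {k l n : ℕ} (h : k + l = n)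
    {φ : FormField (I.prod I') (N × M) n} {α : FormField I N k} {β : FormField I' M l}
    (hφ : HEq (prodWedge α β) φ) (p : N × M) (v : Fin n → E × E') :
    φ.model p v = boxWedge (α.model p.1) (β.model p.2) (v ∘ Fin.cast h) := by
  subst h
  obtain rfl := eq_of_heq hφ
  exact DFunLike.congr_fun (prodWedge_model α β p) v

theorem d_eq_iff_of_eq_prodWedge [Nonempty M] {k l n m m' q : ℕ} (hk2 : k = 2)
    (hl2 : l = 2) (h : k + l = n) (h' : m + m' = q) (hk : k + k = m + 1) (hl : l + l = m') (hn : n + n = q + 1)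
    (r : ℝ) (hr : r ≠ 0) (γ : FormField I N k) (δ : FormField I' M l)
    (F : FormField (I.prod I') (N × M) n) (hF : HEq (prodWedge γ δ) F)
    (η : FormField (I.prod I') (N × M) q) (α : FormField I N m) (β : FormField I' M m')
    (φ : FormField (I.prod I') (N × M) (q + 1)) (α' : FormField I N (m + 1)) (β' : FormField I' M m')
    (hφ : HEq (F.wedge F) φ) (hα' : HEq (γ.wedge γ) α') (hβ' : HEq (δ.wedge δ) β')
    (hη : ∀ p (v : Fin q → E × E'),
      η.model p v = boxWedge (α.model p.1) (β.model p.2) (v ∘ Fin.cast h'))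
    (hβ : ∀ y, β.model y = r • β'.model y) (hβ0 : ∀ y, β'.model y ≠ 0)
    (hα : ∀ x, DifferentiableAt ℝ (α.inChart x) (extChartAt I x x))
    (hδ : δ.IsSmooth) (hdδ : ∀ y, δ.d y = 0) :
    (∀ p, η.d p = r • φ p) ↔ ∀ x, α.d x = α' x := by
  subst hl
  obtain rfl := eq_of_heq hβ'
  have hF' := model_apply_of_heq_prodWedge h hF
  have hFF := fun p v => wedge_self_apply_of_eq_prodWedge h γ δ F hF' p
    (fun w => wedge_boxWedge_boxWedge_apply hk2 hl2 _ _ w) v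
  have hφ' := eq_boxWedge_congr hk rfl hn hφ hα' (HEq.refl (δ.wedge δ)) (by omega) (by omega) hFF
  exact d_eq_iff_of_eq_boxWedge h' r hr η φ α α' β _ hη hφ' hβ hβ0 hα
    (fun y => FormField.differentiableAt_wedge (hδ.differentiableAt y) (hδ.differentiableAt y))
    (d_wedge_self_eq_zero hδ hdδ)

theorem maxwell_iff {κ κ' : Type*} [Fintype κ] [DecidableEq κ] [Fintype κ']
    [DecidableEq κ'] [Nonempty M] {gt : BilinField I N} {volN : FormField I N 5}
    {g : BilinField I' M}
    {volM : FormField I' M 6} {γ : FormField I N 2} {δ : FormField I' M 2}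
    {c : κ → ℝ} (hb : ∀ x, ∃ b : Module.Basis κ ℝ E, IsFrame (gt.model x) b c)
    {c' : κ' → ℝ} (hb' : ∀ y, ∃ b' : Module.Basis κ' ℝ E', IsFrame (g.model y) b' c')
    (hstar : ∀ y, (FormField.star g (k := 2) (m := 4) volM δ).model y =
      (1 / 2 : ℝ) • (δ.wedge δ).model y)
    (hδ0 : ∀ y, (δ.wedge δ).model y ≠ 0)
    (hgt : gt.IsSmooth) (hvolN : volN.IsSmooth) (hγ : γ.IsSmooth) (hδ : δ.IsSmooth)
    (hdδ : ∀ y, δ.d y = 0)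
    (vol : FormField (I.prod I') (N × M) (4 + 7))
    (hvol : prodWedge (k := 5) (l := 6) volN volM = vol)
    (F : FormField (I.prod I') (N × M) 4) (hF : prodWedge (k := 2) (l := 2) γ δ = F) :
    (∀ p, (FormField.star (prodMetric gt g) (k := 4) (m := 7) vol F).d p =
      (1 / 2 : ℝ) • (F.wedge F) p) ↔
    ∀ x, (FormField.star gt (k := 2) (m := 3) volN γ).d x = (γ.wedge γ) x := by
  have hS : ∀ x, DifferentiableAt ℝ ((FormField.star gt (k := 2) (m := 3) volN γ).inChart x)
      (extChartAt I x x) := differentiableAt_star hgt hvolN hγ hb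
  have hstar7 : ∀ p (v : Fin 7 → E × E'),
      (FormField.star (prodMetric gt g) (k := 4) (m := 7) vol F).model p v =
      boxWedge (k := 3) (l := 4) ((FormField.star gt (k := 2) (m := 3) volN γ).model p.1)
        ((FormField.star g (k := 2) (m := 4) volM δ).model p.2)
        (v ∘ Fin.cast (show 3 + 4 = 7 from rfl)) := by
    intro p v
    obtain ⟨b, h⟩ := hb p.1
    obtain ⟨b', h'⟩ := hb' p.2
    exact star_prodWedge_apply p h h' vol hvol F hF v
  generalize FormField.star (prodMetric gt g) (k := 4) (m := 7) vol F = η at *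
  generalize FormField.star gt (k := 2) (m := 3) volN γ = α at *
  generalize FormField.star g (k := 2) (m := 4) volM δ = β at *
  have h1 := d_eq_iff_of_eq_prodWedge rfl rfl (show 2 + 2 = 4 from rfl) (show 3 + 4 = 7 from rfl)
    (show 2 + 2 = 3 + 1 from rfl) (show 2 + 2 = 4 from rfl) (show 4 + 4 = 7 + 1 from rfl) (1 / 2)
    (by norm_num) γ δ F (heq_of_eq hF) η α β (F.wedge F) (γ.wedge γ)
    (δ.wedge δ) HEq.rfl HEq.rfl HEq.rfl (fun p v => by rw [hstar7 p v])
  have h2 := h1 hstar hδ0 hS hδ hdδ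
  exact h2

end Equations

theorem formInner_interiorProd_of_heq_boxWedge {V W κ κ' : Type*} [AddCommGroup V] [Module ℝ V]
    [TopologicalSpace V] [FiniteDimensional ℝ V] [AddCommGroup W] [Module ℝ W]
    [TopologicalSpace W] [FiniteDimensional ℝ W] [Fintype κ] [DecidableEq κ] [Fintype κ']
    [DecidableEq κ'] {g : V →L[ℝ] V →L[ℝ] ℝ} {g' : W →L[ℝ] W →L[ℝ] ℝ}
    {h : (V × W) →L[ℝ] (V × W) →L[ℝ] ℝ} {b : Module.Basis κ ℝ V} {c : κ → ℝ}
    {b' : Module.Basis κ' ℝ W} {c' : κ' → ℝ} (hb : IsFrame g b c) (hb' : IsFrame g' b' c')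
    (hh : ∀ u v, h u v = g u.1 v.1 + g' u.2 v.2) {k l n : ℕ} (hk : k = 1) (hl : l = 1)
    (hn : n = 3) {γ : V [⋀^Fin (k + 1)]→L[ℝ] ℝ} {δ : W [⋀^Fin (l + 1)]→L[ℝ] ℝ}
    {F : (V × W) [⋀^Fin (n + 1)]→L[ℝ] ℝ} (hF : HEq (boxWedge γ δ) F) (u v : V × W) :
    formInner h (interiorProd u F) (interiorProd v F) =
      formInner g (interiorProd u.1 γ) (interiorProd v.1 γ) * formInner g' δ δ +
        formInner g γ γ * formInner g' (interiorProd u.2 δ) (interiorProd v.2 δ) := by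
  subst hk hl hn
  obtain rfl := eq_of_heq hF
  exact formInner_interiorProd_boxWedge hb hb' hh γ δ u v

theorem formInner_of_heq_boxWedge {V W κ κ' : Type*} [AddCommGroup V] [Module ℝ V]
    [TopologicalSpace V] [FiniteDimensional ℝ V] [AddCommGroup W] [Module ℝ W]
    [TopologicalSpace W] [FiniteDimensional ℝ W] [Fintype κ] [DecidableEq κ] [Fintype κ']
    [DecidableEq κ'] {g : V →L[ℝ] V →L[ℝ] ℝ} {g' : W →L[ℝ] W →L[ℝ] ℝ}
    {h : (V × W) →L[ℝ] (V × W) →L[ℝ] ℝ} {b : Module.Basis κ ℝ V} {c : κ → ℝ}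
    {b' : Module.Basis κ' ℝ W} {c' : κ' → ℝ} (hb : IsFrame g b c) (hb' : IsFrame g' b' c')
    (hh : ∀ u v, h u v = g u.1 v.1 + g' u.2 v.2) {k l n : ℕ} (hn : k + l = n)
    {γ : V [⋀^Fin k]→L[ℝ] ℝ} {δ : W [⋀^Fin l]→L[ℝ] ℝ}
    {F : (V × W) [⋀^Fin n]→L[ℝ] ℝ} (hF : HEq (boxWedge γ δ) F) :
    formInner h F F = formInner g γ γ * formInner g' δ δ := by
  subst hn
  obtain rfl := eq_of_heq hF
  exact formInner_boxWedge hb hb' hh γ γ δ δ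

theorem exists_frame_of_kahler_cube {W : Type*} [AddCommGroup W] [Module ℝ W]
    [TopologicalSpace W] [FiniteDimensional ℝ W] {g : W →L[ℝ] W →L[ℝ] ℝ} {J : W →L[ℝ] W} {δ : W [⋀^Fin 2]→L[ℝ] ℝ}
    (hdim : Module.finrank ℝ W = 6)
    (hs : ∀ u v, g u v = g v u) (hneg : ∀ u, u ≠ 0 → g u u < 0) (hJ : ∀ u, J (J u) = -u)
    (hgJ : ∀ u v, g (J u) (J v) = g u v) (hδ : ∀ u v, δ ![u, v] = g (J u) v)
    {vol Δ : W [⋀^Fin 6]→L[ℝ] ℝ} (hΔ : HEq (wedge (wedge δ δ) δ) Δ)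
    (hvol : ∀ v : Fin 6 → W, vol v ^ 2 = |(Matrix.of fun i j => g (v i) (v j)).det|)
    (hor : ∀ v : Fin 6 → W, 0 < vol v → 0 < Δ v) :
    ∃ b : Module.Basis (Fin 6) ℝ W, IsFrame g b (fun _ => -1) ∧
      Δ b = -6 ∧ ∀ v, Δ v = 6 * vol v := by
  obtain rfl := eq_of_heq hΔ
  exact kahler_cube_eq hdim hs hneg hJ hgJ hδ vol hvol hor

section Einstein

variable {E : Type*} [NormedAddCommGroup E] [NormedSpace ℝ E] [FiniteDimensional ℝ E]
  {H : Type*} [TopologicalSpace H]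
  {I : ModelWithCorners ℝ E H} {N : Type*} [TopologicalSpace N] [ChartedSpace H N]
  [I.Boundaryless] [IsManifold I ∞ N]
  {E' : Type*} [NormedAddCommGroup E'] [NormedSpace ℝ E'] [FiniteDimensional ℝ E']
  {H' : Type*} [TopologicalSpace H'] {I' : ModelWithCorners ℝ E' H'} {M : Type*}
  [TopologicalSpace M] [ChartedSpace H' M] [I'.Boundaryless] [IsManifold I' ∞ M]

omit [FiniteDimensional ℝ E] [I.Boundaryless] in
theorem ricci_zero (g : BilinField I N) (x : N) : ricci g x (0 : E) (0 : E) = 0 := by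
  rw [ricci_eq, flatRicci_zero]

omit [FiniteDimensional ℝ E] [I.Boundaryless] [IsManifold I ∞ N] [FiniteDimensional ℝ E']
  [I'.Boundaryless] [IsManifold I' ∞ M] in
theorem heq_boxWedge_model_of_heq_prodWedge {k l n : ℕ} (h : k + l = n) {α : FormField I N k}
    {β : FormField I' M l} {φ : FormField (I.prod I') (N × M) n} (hφ : HEq (prodWedge α β) φ)
    (p : N × M) : HEq (boxWedge (α.model p.1) (β.model p.2)) (φ.model p) := by
  subst h
  obtain rfl := eq_of_heq hφ
  exact heq_of_eq (prodWedge_model α β p).symm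

theorem einstein_iff {κ κ' : Type*} [Fintype κ] [DecidableEq κ] [Fintype κ']
    [DecidableEq κ'] [Nonempty N] [Nonempty M] {gt : BilinField I N} {g : BilinField I' M}
    {k l n : ℕ} (hk : k = 1) (hl : l = 1) (hn : n = 3)
    {γ : FormField I N (k + 1)} {δ : FormField I' M (l + 1)}
    {c : κ → ℝ} (hb : ∀ x, ∃ b : Module.Basis κ ℝ E, IsFrame (gt.model x) b c)
    {c' : κ' → ℝ} (hb' : ∀ y, ∃ b' : Module.Basis κ' ℝ E', IsFrame (g.model y) b' c')
    (hgt : gt.IsSmooth) (hg : g.IsSmooth)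
    (hδ : ∀ y, formInner (g.model y) (δ.model y) (δ.model y) = 3)
    (hδ' : ∀ y u v, formInner (g.model y) (interiorProd u (δ.model y))
      (interiorProd v (δ.model y)) = g.model y u v)
    {F : FormField (I.prod I') (N × M) (n + 1)} (hF : HEq (prodWedge γ δ) F) :
    (∀ p (u v : E × E'), ricci (prodMetric gt g) p u v =
      -(1 / 2) * formInner ((prodMetric gt g).model p) (interiorProd u (F.model p))
          (interiorProd v (F.model p)) +
        1 / 6 * (prodMetric gt g).model p u v *
          formInner ((prodMetric gt g).model p) (F.model p) (F.model p)) ↔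
    (∀ y (u v : E'), ricci g y u v = 0) ∧
      ∀ x (u v : E), ricci gt x u v =
        1 / 2 * formInner (gt.model x) (γ.model x) (γ.model x) * gt.model x u v -
          3 / 2 * formInner (gt.model x) (interiorProd u (γ.model x))
            (interiorProd v (γ.model x)) := by
  have key : ∀ p (u v : E × E'), (ricci (prodMetric gt g) p u v =
      -(1 / 2) * formInner ((prodMetric gt g).model p) (interiorProd u (F.model p))
          (interiorProd v (F.model p)) +
        1 / 6 * (prodMetric gt g).model p u v *
          formInner ((prodMetric gt g).model p) (F.model p) (F.model p)) ↔
      ricci gt p.1 u.1 v.1 + ricci g p.2 u.2 v.2 =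
        1 / 2 * formInner (gt.model p.1) (γ.model p.1) (γ.model p.1) * gt.model p.1 u.1 v.1 -
          3 / 2 * formInner (gt.model p.1) (interiorProd u.1 (γ.model p.1))
            (interiorProd v.1 (γ.model p.1)) := by
    intro p u v
    obtain ⟨b, hb⟩ := hb p.1
    obtain ⟨b', hb'⟩ := hb' p.2
    have hp := heq_boxWedge_model_of_heq_prodWedge (show k + 1 + (l + 1) = n + 1 by omega) hF p
    have e1 := formInner_interiorProd_of_heq_boxWedge hb hb' (prodMetric_model gt g p) hk hl hn
      hp u v
    have e2 := formInner_of_heq_boxWedge hb hb' (prodMetric_model gt g p)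
      (show k + 1 + (l + 1) = n + 1 by omega) hp
    rw [e1, e2, ricci_prodMetric hgt hg p hb.isInvertible hb'.isInvertible, prodMetric_model, hδ,
      hδ']
    constructor <;> intro e <;> linear_combination e
  constructor
  · intro e
    constructor
    · intro y u v
      have h := (key (Classical.arbitrary N, y) (0, u) (0, v)).1 (e _ _ _)
      simpa [ricci_zero, interiorProd_zero, formInner_zero_left] using h
    · intro x u v
      have h := (key (x, Classical.arbitrary M) (u, 0) (v, 0)).1 (e _ _ _)
      simpa [ricci_zero] using h
  · rintro ⟨h1, h2⟩ p u v
    rw [key, h1, h2, add_zero]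

theorem isBosonicBackground_iff {κ κ' : Type*} [Fintype κ] [DecidableEq κ] [Fintype κ']
    [DecidableEq κ'] [Nonempty N] [Nonempty M] {gt : BilinField I N} {volN : FormField I N 5}
    {g : BilinField I' M}
    {volM : FormField I' M 6} {γ : FormField I N 2} {δ : FormField I' M 2}
    {c : κ → ℝ} (hb : ∀ x, ∃ b : Module.Basis κ ℝ E, IsFrame (gt.model x) b c)
    {c' : κ' → ℝ} (hb' : ∀ y, ∃ b' : Module.Basis κ' ℝ E', IsFrame (g.model y) b' c')
    (hstar : ∀ y, (FormField.star g (k := 2) (m := 4) volM δ).model y =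
      (1 / 2 : ℝ) • (δ.wedge δ).model y)
    (hδ0 : ∀ y, (δ.wedge δ).model y ≠ 0)
    (hin : ∀ y, formInner (g.model y) (δ.model y) (δ.model y) = 3)
    (hin' : ∀ y u v, formInner (g.model y) (interiorProd (k := 1) u (δ.model y))
      (interiorProd (k := 1) v (δ.model y)) = g.model y u v)
    (hgt : gt.IsSmooth) (hg : g.IsSmooth) (hvolN : volN.IsSmooth) (hγ : γ.IsSmooth)
    (hδ : δ.IsSmooth) (hdγ : ∀ x, γ.d x = 0) (hdδ : ∀ y, δ.d y = 0) :
    IsBosonicBackground (prodMetric gt g) (prodWedge volN volM) (prodWedge γ δ) ↔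
      (∀ y (u v : TangentSpace I' y), ricci g y u v = 0) ∧
      (∀ x : N, (FormField.star gt (k := 2) (m := 3) volN γ).d x = (γ.wedge γ) x) ∧
      ∀ x (u v : TangentSpace I x), ricci gt x u v =
        1 / 2 * formInner (gt x) (γ x) (γ x) * gt x u v -
          3 / 2 * formInner (gt x) (interiorProd (k := 1) u (γ x))
            (interiorProd (k := 1) v (γ x)) := by
  have hd : ∀ n (h : 2 + 2 = n) (F : FormField (I.prod I') (N × M) n), HEq (prodWedge γ δ) F →
      ∀ p, F.d p = 0 := by
    rintro n rfl F hF p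
    obtain rfl := eq_of_heq hF
    exact d_prodWedge_eq_zero hγ hδ hdγ hdδ p
  obtain ⟨vol, hvol⟩ : ∃ vol : FormField (I.prod I') (N × M) 11,
    prodWedge volN volM = vol := ⟨_, rfl⟩
  obtain ⟨F, hF⟩ : ∃ F : FormField (I.prod I') (N × M) 4, prodWedge γ δ = F := ⟨_, rfl⟩
  have hd' := hd 4 rfl F (heq_of_eq hF)
  have hmax := maxwell_iff hb hb' hstar hδ0 hgt hvolN hγ hδ hdδ vol hvol F hF
  have hein := einstein_iff (k := 1) (l := 1) (n := 3) rfl rfl rfl hb hb' hgt hg hin hin'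
    (heq_of_eq hF)
  rw [hvol, hF]
  constructor
  · intro h
    exact ⟨(hein.1 h.einstein).1, hmax.1 h.maxwell, (hein.1 h.einstein).2⟩
  · rintro ⟨h1, h2, h3⟩
    exact ⟨hd', hmax.2 h2, hein.2 ⟨h1, h3⟩⟩

end Einstein

end Sugra

theorem mainTheorem11
    -- the oriented Lorentzian manifold of dimension 5
    {N : Type*} [TopologicalSpace N] [T2Space N] [SecondCountableTopology N] [ConnectedSpace N]
    [ChartedSpace (EuclideanSpace ℝ (Fin 5)) N] [IsManifold (𝓡 5) ∞ N]
    (gt : BilinField (𝓡 5) N) (volN : FormField (𝓡 5) N 5)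
    (hgt : IsLorentzianMetric 4 gt) (hvolN : IsVolumeForm gt volN)
    -- the Kähler manifold of real dimension 6, oriented by the cube of its Kähler form
    {M : Type*} [TopologicalSpace M] [T2Space M] [SecondCountableTopology M] [ConnectedSpace M]
    [ChartedSpace (EuclideanSpace ℝ (Fin 6)) M] [IsManifold (𝓡 6) ∞ M]
    (g : BilinField (𝓡 6) M) (volM : FormField (𝓡 6) M 6)
    (hg : IsNegRiemannianMetric g) (hvolM : IsVolumeForm g volM)
    (J : ∀ x : M, TangentSpace (𝓡 6) x →L[ℝ] TangentSpace (𝓡 6) x) (δ : FormField (𝓡 6) M 2)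
    (hK : IsKahler g J δ)
    (hor : ∀ (x : M) (v : Fin 6 → TangentSpace (𝓡 6) x),
      0 < volM x v → 0 < ((δ.wedge δ).wedge δ) x v)
    -- the closed 2-form on the Lorentzian manifold
    (γ : FormField (𝓡 5) N 2) (hγ : γ.IsSmooth) (hγ_closed : ∀ x : N, γ.d x = 0) :
    IsBosonicBackground (prodMetric gt g) (prodWedge volN volM) (prodWedge γ δ) ↔
      (∀ (x : M) (u v : TangentSpace (𝓡 6) x), ricci g x u v = 0) ∧
      (∀ x : N, (FormField.star gt (k := 2) (m := 3) volN γ).d x = (γ.wedge γ) x) ∧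
      (∀ (x : N) (u v : TangentSpace (𝓡 5) x),
        ricci gt x u v =
          1 / 2 * formInner (gt x) (γ x) (γ x) * gt x u v
            - 3 / 2 * formInner (gt x) (interiorProd (k := 1) u (γ x)) (interiorProd (k := 1) v (γ x))) := by
  have hbN : ∀ x, ∃ b : Module.Basis (Fin 5) ℝ (EuclideanSpace ℝ (Fin 5)),
      IsFrame (gt.model x) b (fun i => if i = 0 then 1 else -1) := by
    intro x
    obtain ⟨b, hb⟩ := hgt.signature x
    refine ⟨b, hb, fun i => ?_⟩
    split_ifs <;> norm_num
  have hJ : ∀ y u, J y (J y u) = -u := hK.J_sq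
  have hgJ : ∀ y (u v : EuclideanSpace ℝ (Fin 6)), g.model y (J y u) (J y v) = g.model y u v :=
    hK.orthogonal
  have hδJ : ∀ y (u v : EuclideanSpace ℝ (Fin 6)), δ.model y ![u, v] = g.model y (J y u) v :=
    hK.form_eq
  obtain ⟨Δ, hΔ⟩ : ∃ Δ : FormField (𝓡 6) M 6, (δ.wedge δ).wedge δ = Δ := ⟨_, rfl⟩
  have hΔ' : ∀ y, Δ.model y = wedge (wedge (δ.model y) (δ.model y)) (δ.model y) := by
    intro y
    rw [← hΔ, FormField.wedge_model, FormField.wedge_model]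
  rw [hΔ] at hor
  have hK6 := fun y => exists_frame_of_kahler_cube (W := EuclideanSpace ℝ (Fin 6))
    (g := g.model y) (J := J y) (δ := δ.model y) (vol := volM.model y) (by simp) (hg.symm y)
    (hg.neg y) (hJ y) (hgJ y) (hδJ y) (heq_of_eq (hΔ' y).symm)
    (hvolM.normalized y) (hor y)
  have hbM : ∀ y, ∃ b : Module.Basis (Fin 6) ℝ (EuclideanSpace ℝ (Fin 6)),
      IsFrame (g.model y) b (fun _ => -1) := by
    intro y
    obtain ⟨b, hb, -, -⟩ := hK6 y
    exact ⟨b, hb⟩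
  have hstar : ∀ y, (FormField.star g (k := 2) (m := 4) volM δ).model y =
      (1 / 2 : ℝ) • (δ.wedge δ).model y := by
    intro y
    obtain ⟨b, hb, -, hv⟩ := hK6 y
    rw [FormField.star_model, FormField.wedge_model]
    exact hb.hodge_kahler (hJ y) (hgJ y) (hδJ y) (volM.model y)
      (fun v => by rw [← hv, hΔ' y])
  have hδ0 : ∀ y, (δ.wedge δ).model y ≠ 0 := by
    intro y h0
    obtain ⟨b, -, hb, -⟩ := hK6 y
    rw [FormField.wedge_model] at h0
    have h1 : Δ.model y = 0 := by rw [hΔ' y, h0, wedge_zero_left]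
    rw [h1] at hb
    exact absurd hb (show (0 : ℝ) ≠ -6 by norm_num)
  have hin : ∀ y, formInner (g.model y) (δ.model y) (δ.model y) = 3 := by
    intro y
    obtain ⟨b, hb⟩ := hbM y
    rw [hb.formInner_kahler (hgJ y) (hδJ y)]
    norm_num
  have hin' : ∀ y u v, formInner (g.model y) (interiorProd (k := 1) u (δ.model y))
      (interiorProd (k := 1) v (δ.model y)) = g.model y u v := by
    intro y u v
    obtain ⟨b, hb⟩ := hbM y
    exact hb.formInner_interiorProd_kahler (hgJ y) (hδJ y) u v
  exact isBosonicBackground_iff hbN hbM hstar hδ0 hin hin' hgt.smooth hg.smooth hvolN.smooth hγ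
    hK.smooth_form hγ_closed hK.closed
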